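/- Let $\mathcal G$ be a noncompact metric graph with finitely many vertices and edges, with at least one bounded edge and at least one half-line. Its compact core $\mathcal K$ is the union of its bounded edges. Let $$H^1(\mathcal G)=\{u:\mathcal G\to\mathbb R \text{ continuous},\ u_e\in H^1(\mathring e)\text{ for every edge } e\},\qquad \|u\|_{H^1}^2=\int_{\mathcal G}|u'|^2+|u|^2,$$ and, for $\mu>0$, $H^1_\mu(\mathcal G)=\{u\in H^1(\mathcal G):\int_{\mathcal G}|u|^2=\mu\}$, with the topology of $H^1(\mathcal G)$. For $\rho\in[\tfrac12,1]$ put $$E_\rho(u)=\frac12\int_{\mathcal G}|u'|^2\,dx-\frac{\rho}{p}\int_{\mathcal K}|u|^p\,dx ,\qquad u\in H^1(\mathcal G).$$ Write $\mathbb S^{N-2}$ for the unit sphere of $\mathbb R^{N-1}$. Given odd maps $\gamma_0,\gamma_1:\mathbb S^{N-2}\to H^1_\mu(\mathcal G)$, let $\Gamma_N$ be the set of all continuous $\gamma:[0,1]\times\mathbb S^{N-2}\to H^1_\mu(\mathcal G)$ such that $\gamma(t,\cdot)$ is odd for every $t$, $\gamma(0,\cdot)=\gamma_0$ and $\gamma(1,\cdot)=\gamma_1$,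 and let $$c_\rho^N=\inf_{\gamma\in\Gamma_N}\ \max_{(t,a)\in[0,1]\times\mathbb S^{N-2}}E_\rho(\gamma(t,a)).$$ **Proposition.** For every $\mu>0$ and $p>6$ there is $N_0\in\mathbb N$ such that for every $N\ge N_0$ there are odd maps $\gamma_{0,N},\gamma_{1,N}:\mathbb S^{N-2}\to H^1_\mu(\mathcal G)$, independent of $\rho$, with the following properties. 1. For every $N\ge N_0$ the family $(E_\rho)_{\rho\in[1/2,1]}$ satisfies all the hypotheses of the abstract minimax theorem, with $E=H^1(\mathcal G)$, $H=L^2(\mathcal G)$ and $S_\mu=H^1_\mu(\mathcal G)$. That is: - $E$ and $H$ are infinite-dimensional Hilbert spaces and $E\hookrightarrow H\hookrightarrow E'$ are continuous injections, the first of norm at most $1$; - $[\tfrac12,1]$ is an interval in $(0,\infty)$, and $E_\rho=A-\rho B$ with $B\ge0$ on $E$, where $A(u)\to+\infty$ or $B(u)\to+\infty$ as $u\in S_\mu$, $\|u\|_E\to+\infty$; - each $E_\rho$ is of class $C^2$ on $E$ and even on $S_\mu$, and for some $\alpha\in(0,1]$ all the derivatives $E_\rho'$ and $E_\rho''$ are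 $\alpha$-Hölder continuous on bounded sets; - $N\ge2$, $\gamma_{0,N}$ and $\gamma_{1,N}$ are odd, $\Gamma_N\neq\emptyset$, and for every $\rho\in[\tfrac12,1]$ $$c_\rho^N>\max_{a\in\mathbb S^{N-2}}\max\{E_\rho(\gamma_{0,N}(a)),\,E_\rho(\gamma_{1,N}(a))\}.$$ 2. $c_\rho^N\to+\infty$ as $N\to\infty$, uniformly in $\rho\in[\tfrac12,1]$. 3. For every $\rho\in[\tfrac12,1]$ the levels $c_\rho^N$, $N\ge N_0$, take infinitely many distinct real values. -/

import Mathlib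

open MeasureTheory Set Filter
open scoped Topology ContDiff InnerProductSpace

noncomputable section

/-! ## Metric graphs -/

/-- A metric graph with vertex set `V`, bounded edges indexed by `B` and half-lines indexed by `R`.
A bounded edge `e` is identified with `[0, len e]`, the point `0` being glued to the vertex `src e`
and the point `len e` to the vertex `tgt e`; a half-line `h` is identified with `[0, ∞)`, the point
`0` being glued to `root h`.  Loops and multiple edges are allowed. -/
structure MetricGraph (V B R : Type*) where
  len : B → ℝ
  len_pos : ∀ e, 0 < len e
  src : B → V
  tgt : B → V
  root : R → V
  /-- there are no isolated vertices -/
  incident : ∀ v, (∃ e, src e = v ∨ tgt e = v) ∨ ∃ h, root h = v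

namespace MetricGraph

variable {V B R : Type*}

/-- The closed interval `I_e` with which the edge `e` is identified. -/
def interval (G : MetricGraph V B R) : B ⊕ R → Set ℝ
  | .inl e => Icc 0 (G.len e)
  | .inr _ => Ici 0

/-- Lebesgue measure on the edge `e`. -/
abbrev edgeMeasure (G : MetricGraph V B R) (e : B ⊕ R) : Measure ℝ :=
  volume.restrict (G.interval e)

/-- `f`, given by one function on each edge, is a continuous function on the graph: it is
continuous along each edge and takes a single value at each vertex. -/
def IsContinuous (G : MetricGraph V B R) (f : B ⊕ R → ℝ → ℝ) : Prop :=
  (∀ e, ContinuousOn (f e) (G.interval e)) ∧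
    ∃ c : V → ℝ, (∀ e : B, f (.inl e) 0 = c (G.src e) ∧ f (.inl e) (G.len e) = c (G.tgt e)) ∧
      ∀ h : R, f (.inr h) 0 = c (G.root h)

/-- `g` is the weak derivative of `u` in the interior of the interval `I`. -/
def IsWeakDeriv (I : Set ℝ) (u g : ℝ → ℝ) : Prop :=
  ∀ φ : ℝ → ℝ, ContDiff ℝ ∞ φ → HasCompactSupport φ → tsupport φ ⊆ interior I →
    ∫ x in I, u x * deriv φ x = - ∫ x in I, g x * φ x

variable [Fintype B] [Fintype R]

/-- `L²(G)`, with `‖u‖² = ∑ₑ ‖uₑ‖²`. -/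
abbrev L2 (G : MetricGraph V B R) : Type _ :=
  PiLp 2 (fun e : B ⊕ R => Lp ℝ 2 (G.edgeMeasure e))

theorem integrable_mul_test {I : Set ℝ} (u : Lp ℝ 2 (volume.restrict I)) {ψ : ℝ → ℝ}
    (hc : Continuous ψ) (hs : HasCompactSupport ψ) :
    Integrable (fun x => u x * ψ x) (volume.restrict I) :=
  (Lp.memLp u).integrable_mul
    (show MemLp ψ 2 (volume.restrict I) from hc.memLp_of_hasCompactSupport hs)

/-- The pairs `(u, u')` of elements of `L²(G)` such that `u` agrees almost everywhere with a
continuous function on the graph and, on every edge, `u'` is the weak derivative of `u`. -/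
def sobolevPairs (G : MetricGraph V B R) : Submodule ℝ (WithLp 2 (G.L2 × G.L2)) where
  carrier := {w |
    (∃ f, G.IsContinuous f ∧ ∀ e, ⇑(w.fst e) =ᵐ[G.edgeMeasure e] f e) ∧
      ∀ e, IsWeakDeriv (G.interval e) (w.fst e) (w.snd e)}
  zero_mem' := by
    refine ⟨⟨fun _ _ => 0, ⟨fun e => continuousOn_const, fun _ => 0, by simp⟩, fun e => ?_⟩, ?_⟩
    · exact Lp.coeFn_zero ℝ 2 (G.edgeMeasure e)
    · intro e φ _ _ _
      have h : ⇑(0 : Lp ℝ 2 (G.edgeMeasure e)) =ᵐ[G.edgeMeasure e] 0 := Lp.coeFn_zero ℝ 2 _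
      have h1 : ∫ x in G.interval e, (0 : Lp ℝ 2 (G.edgeMeasure e)) x * deriv φ x = 0 :=
        integral_eq_zero_of_ae (by filter_upwards [h] with x hx; rw [hx]; simp)
      have h2 : ∫ x in G.interval e, (0 : Lp ℝ 2 (G.edgeMeasure e)) x * φ x = 0 :=
        integral_eq_zero_of_ae (by filter_upwards [h] with x hx; rw [hx]; simp)
      change ∫ x in G.interval e, (0 : Lp ℝ 2 (G.edgeMeasure e)) x * deriv φ x =
        - ∫ x in G.interval e, (0 : Lp ℝ 2 (G.edgeMeasure e)) x * φ x
      rw [h1, h2, neg_zero]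
  add_mem' := by
    rintro w z ⟨⟨f, ⟨hf, c, hc, hc'⟩, hwf⟩, hw⟩ ⟨⟨g, ⟨hg, d, hd, hd'⟩, hzg⟩, hz⟩
    refine ⟨⟨fun e x => f e x + g e x, ⟨fun e => (hf e).add (hg e), fun v => c v + d v,
      fun e => ?_, fun h => ?_⟩, fun e => ?_⟩, fun e φ h1 h2 h3 => ?_⟩
    · simp [(hc e).1, (hc e).2, (hd e).1, (hd e).2]
    · simp [hc' h, hd' h]
    · change ⇑(w.fst e + z.fst e) =ᵐ[_] _
      filter_upwards [Lp.coeFn_add (w.fst e) (z.fst e), hwf e, hzg e] with x hx h1 h2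
      rw [hx, Pi.add_apply, h1, h2]
    · have hφ' : Continuous (deriv φ) := h1.continuous_deriv (by simp)
      have key : ∀ (a b : Lp ℝ 2 (G.edgeMeasure e)) (ψ : ℝ → ℝ), Continuous ψ →
          HasCompactSupport ψ → ∫ x in G.interval e, (a + b : Lp ℝ 2 (G.edgeMeasure e)) x * ψ x =
            (∫ x in G.interval e, a x * ψ x) + ∫ x in G.interval e, b x * ψ x := by
        intro a b ψ h4 h5
        rw [← integral_add (integrable_mul_test a h4 h5) (integrable_mul_test b h4 h5)]
        refine integral_congr_ae ?_
        filter_upwards [Lp.coeFn_add a b] with x hx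
        rw [hx, Pi.add_apply, add_mul]
      change ∫ x in G.interval e, (w.fst e + z.fst e : Lp ℝ 2 (G.edgeMeasure e)) x * deriv φ x =
        - ∫ x in G.interval e, (w.snd e + z.snd e : Lp ℝ 2 (G.edgeMeasure e)) x * φ x
      rw [key _ _ _ hφ' h2.deriv, key _ _ _ h1.continuous h2, hw e φ h1 h2 h3, hz e φ h1 h2 h3]
      ring
  smul_mem' := by
    rintro r w ⟨⟨f, ⟨hf, c, hc, hc'⟩, hwf⟩, hw⟩
    refine ⟨⟨fun e x => r * f e x, ⟨fun e => continuousOn_const.mul (hf e), fun v => r * c v,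
      fun e => ?_, fun h => ?_⟩, fun e => ?_⟩, fun e φ h1 h2 h3 => ?_⟩
    · simp [(hc e).1, (hc e).2]
    · simp [hc' h]
    · change ⇑(r • w.fst e) =ᵐ[_] _
      filter_upwards [Lp.coeFn_smul r (w.fst e), hwf e] with x hx h1
      rw [hx, Pi.smul_apply, h1, smul_eq_mul]
    · have key : ∀ (a : Lp ℝ 2 (G.edgeMeasure e)) (ψ : ℝ → ℝ),
          ∫ x in G.interval e, (r • a : Lp ℝ 2 (G.edgeMeasure e)) x * ψ x =
            r * ∫ x in G.interval e, a x * ψ x := by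
        intro a ψ
        rw [← integral_const_mul]
        refine integral_congr_ae ?_
        filter_upwards [Lp.coeFn_smul r a] with x hx
        rw [hx, Pi.smul_apply, smul_eq_mul, mul_assoc]
      change ∫ x in G.interval e, (r • w.fst e : Lp ℝ 2 (G.edgeMeasure e)) x * deriv φ x =
        - ∫ x in G.interval e, (r • w.snd e : Lp ℝ 2 (G.edgeMeasure e)) x * φ x
      rw [key, key, hw e φ h1 h2 h3]
      ring

/-- The Sobolev space `H¹(G)`, with `‖u‖² = ∑ₑ (‖uₑ'‖² + ‖uₑ‖²)`.  A function `u` is recorded as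
the pair `(u, u')`. -/
def H1 (G : MetricGraph V B R) : Type _ := ↥G.sobolevPairs

instance (G : MetricGraph V B R) : NormedAddCommGroup G.H1 :=
  inferInstanceAs (NormedAddCommGroup ↥G.sobolevPairs)

instance (G : MetricGraph V B R) : InnerProductSpace ℝ G.H1 :=
  inferInstanceAs (InnerProductSpace ℝ ↥G.sobolevPairs)

/-- The inclusion `H¹(G) → L²(G)`. -/
def toL2 (G : MetricGraph V B R) : G.H1 →L[ℝ] G.L2 :=
  (WithLp.fstL 2 ℝ G.L2 G.L2).comp G.sobolevPairs.subtypeL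

/-- The weak derivative `u'` of `u ∈ H¹(G)`. -/
def derivL2 (G : MetricGraph V B R) : G.H1 →L[ℝ] G.L2 :=
  (WithLp.sndL 2 ℝ G.L2 G.L2).comp G.sobolevPairs.subtypeL

/-- The energy `E_ρ(u, G) = ½ ∫_G |u'|² - (ρ / p) ∫_K |u|^p`, where the compact core `K` of `G`
consists of all the bounded edges. -/
def energy (G : MetricGraph V B R) (p ρ : ℝ) (u : G.H1) : ℝ :=
  (1 / 2) * (∑ e : B ⊕ R, ∫ x in G.interval e, |G.derivL2 u e x| ^ 2) -
    (ρ / p) * (∑ e : B, ∫ x in G.interval (.inl e), |G.toL2 u (.inl e) x| ^ p)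

end MetricGraph

/-! ## The abstract minimax setting -/

section Abstract

variable {E H : Type*} [NormedAddCommGroup E] [InnerProductSpace ℝ E]
  [NormedAddCommGroup H] [InnerProductSpace ℝ H]

/-- The sphere `S_μ = {u ∈ E : |u|² = μ}`, where `|·|` is the norm of `H` and `E` is viewed in `H`
through `ι`.  It carries the topology of `E`. -/
def massSphere (ι : E →L[ℝ] H) (μ : ℝ) : Set E :=
  {u | ‖ι u‖ ^ 2 = μ}

/-- The unit sphere of dimension `N - 2`, in `ℝ^(N - 1)`. -/
abbrev unitSphere (N : ℕ) : Type :=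
  Metric.sphere (0 : EuclideanSpace ℝ (Fin (N - 1))) 1

/-- The class `Γ_N` of continuous homotopies through odd maps from `γ₀` to `γ₁`. -/
def oddHomotopies (ι : E →L[ℝ] H) (μ : ℝ) (N : ℕ) (γ₀ γ₁ : unitSphere N → massSphere ι μ) :
    Set C(unitInterval × unitSphere N, massSphere ι μ) :=
  {γ | (∀ t a, (γ (t, -a) : E) = -(γ (t, a) : E)) ∧
    (∀ a, γ (0, a) = γ₀ a) ∧ ∀ a, γ (1, a) = γ₁ a}

/-- The level `inf_{γ ∈ Γ_N} max_{(t, a)} Φ (γ (t, a))`, as an extended real number. -/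
def minimaxLevel (ι : E →L[ℝ] H) (μ : ℝ) (N : ℕ) (γ₀ γ₁ : unitSphere N → massSphere ι μ)
    (Φ : E → ℝ) : EReal :=
  ⨅ γ ∈ oddHomotopies ι μ N γ₀ γ₁, ⨆ x, ((Φ (γ x) : ℝ) : EReal)

/-- The first and second derivatives of `Φ` are `α`-Hölder continuous on bounded sets. -/
def HolderDerivsOnBounded (α : ℝ) (Φ : E → ℝ) : Prop :=
  ∀ r > 0, ∃ M > 0, ∀ u₁ ∈ Metric.ball (0 : E) r, ∀ u₂ ∈ Metric.ball (0 : E) r,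
    ‖fderiv ℝ Φ u₁ - fderiv ℝ Φ u₂‖ ≤ M * ‖u₁ - u₂‖ ^ α ∧
      ‖fderiv ℝ (fderiv ℝ Φ) u₁ - fderiv ℝ (fderiv ℝ Φ) u₂‖ ≤ M * ‖u₁ - u₂‖ ^ α

/-- The hypotheses of the abstract minimax theorem on the family `Φ_ρ`, `ρ ∈ I`, for the
inclusion `ι` of `E` in `H`, the mass `μ`, the integer `N` and the odd maps `γ₀`, `γ₁`. -/
structure MinimaxHypotheses (ι : E →L[ℝ] H) (μ : ℝ) (I : Set ℝ) (Φ : ℝ → E → ℝ) (N : ℕ)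
    (γ₀ γ₁ : unitSphere N → massSphere ι μ) : Prop where
  /-- `E` and `H` are infinite-dimensional Hilbert spaces -/
  complete_left : CompleteSpace E
  complete_right : CompleteSpace H
  infinite_left : ¬ FiniteDimensional ℝ E
  infinite_right : ¬ FiniteDimensional ℝ H
  /-- `E ↪ H ↪ E'` are injections, the first one of norm at most `1` -/
  injective : Function.Injective ι
  norm_le : ‖ι‖ ≤ 1
  injective_dual : Function.Injective fun h : H => (innerSL ℝ h).comp ι
  /-- `I` is an interval of positive numbers -/
  interval : I.OrdConnected
  interval_pos : I ⊆ Ioi 0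
  /-- `Φ_ρ = A - ρ B` with `B ≥ 0`, and `A` or `B` is coercive on `S_μ` -/
  form : ∃ A b : E → ℝ, (∀ ρ ∈ I, ∀ u, Φ ρ u = A u - ρ * b u) ∧ (∀ u, 0 ≤ b u) ∧
    (Tendsto A (Bornology.cobounded E ⊓ 𝓟 (massSphere ι μ)) atTop ∨
      Tendsto b (Bornology.cobounded E ⊓ 𝓟 (massSphere ι μ)) atTop)
  even : ∀ ρ ∈ I, ∀ u ∈ massSphere ι μ, Φ ρ (-u) = Φ ρ u
  contDiff : ∀ ρ ∈ I, ContDiff ℝ 2 (Φ ρ)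
  holder : ∃ α : ℝ, 0 < α ∧ α ≤ 1 ∧ ∀ ρ ∈ I, HolderDerivsOnBounded α (Φ ρ)
  two_le : 2 ≤ N
  odd_zero : ∀ a, (γ₀ (-a) : E) = -(γ₀ a : E)
  odd_one : ∀ a, (γ₁ (-a) : E) = -(γ₁ a : E)
  nonempty : (oddHomotopies ι μ N γ₀ γ₁).Nonempty
  /-- the minimax level is above the energies of the end maps -/
  level : ∀ ρ ∈ I, max (⨆ a, ((Φ ρ (γ₀ a) : ℝ) : EReal)) (⨆ a, ((Φ ρ (γ₁ a) : ℝ) : EReal)) <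
    minimaxLevel ι μ N γ₀ γ₁ (Φ ρ)

end Abstract

end

/-!
# The minimax geometry of the energy on a metric graph

Let `L` be the total length of the compact core. If `u` vanishes at the points of a grid that
divides every bounded edge into `m` intervals, then `|u|² ≤ (L / m) ‖u'‖²` on the core. So if moreover
`‖u'‖² = m / L`, then `|u| ≤ 1` on the core and `E_ρ(u) ≥ m / (2 L) - L`, for every `ρ ≤ 1`
(`MetricGraph.le_energy_of_grid`).

For `N` large compared with `m`, every homotopy in `Γ_N` contains such a function as soon as its ends
have kinetic energies below and above `m / L` (`MetricGraph.exists_vanishing_on_grid`): the values at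
the grid points are odd functions of `u`, at most `N - 2` in number, so they vanish together at some
point where the even function `‖u'‖² - m / L` vanishes too. This is a linking theorem of Borsuk–Ulam
type (`exists_common_zero_of_odd_homotopy`). It is proved with cochains modulo two on
tuples of points: the cup product of the coboundaries of the signs of odd functions pairs to `1` with a
hemisphere of an iterated barycentric subdivision of the cross-polytope
(`Cochain.not_locally_constant`). Hence the minimax levels are at least `m / (2 L) - L`, uniformly in
`ρ`, and they tend to infinity with `N`.

The end maps are restrictions to the unit sphere of linear maps whose values are combinations of bumps
with disjoint supports. Wide bumps on a half-line have arbitrarily small energy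
(`MetricGraph.exists_linearMap_halfLine`). Bumps of width `w` on a bounded edge have kinetic energy of
order `w ^ (-2)` and nonlinear energy of order at least `w ^ (1 - p / 2)`; since `p > 6`, for small `w`
the kinetic energy is as large as desired while the energy is nonpositive, for all `ρ ≥ 1 / 2`
(`MetricGraph.exists_linearMap_core`). The two maps have orthogonal values, and a rotation joins them
in the mass sphere.

Completeness of `H¹` and the bound on the oscillation of `u` by `‖u'‖` come from the fundamental theorem
of calculus for weak derivatives (`MetricGraph.IsWeakDeriv.sub_eq_integral`). The nonlinear term is a
continuous linear functional of `|u| ^ p` in the algebra of continuous functions on the edges, in which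
superposition operators are differentiated directly (`hasFDerivAt_superposition`); this gives first and
second derivatives that are Lipschitz continuous on bounded sets.
-/

/-! ### Cochains modulo two on tuples of points -/

/-- A cochain modulo two on a set `W`, with one value for every finite list of points; the empty
list plays the role of the augmentation. -/
abbrev Cochain (W : Type*) := List W → ZMod 2

namespace Cochain

variable {W W' : Type*}

/-- The coboundary: `coboundary φ l` is the sum of the values of `φ` on the faces of `l`. -/
def coboundary (φ : Cochain W) : List W → ZMod 2
  | [] => 0
  | x :: l => φ l + coboundary (fun m => φ (x :: m)) l

@[simp] theorem coboundary_nil (φ : Cochain W) : coboundary φ [] = 0 := rfl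

theorem coboundary_cons (φ : Cochain W) (x : W) (l : List W) :
    coboundary φ (x :: l) = φ l + coboundary (fun m => φ (x :: m)) l := rfl

theorem coboundary_add (φ η : Cochain W) (l : List W) :
    coboundary (fun m => φ m + η m) l = coboundary φ l + coboundary η l := by
  induction l generalizing φ η with
  | nil => simp
  | cons x l ih => simp only [coboundary_cons, ih]; ring

theorem coboundary_const_mul (a : ZMod 2) (φ : Cochain W) (l : List W) :
    coboundary (fun m => a * φ m) l = a * coboundary φ l := by
  induction l generalizing φ with
  | nil => simp
  | cons x l ih => simp only [coboundary_cons, ih]; ring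

theorem coboundary_coboundary (φ : Cochain W) (l : List W) :
    coboundary (coboundary φ) l = 0 := by
  induction l generalizing φ with
  | nil => rfl
  | cons x l ih =>
    have h : (fun m => coboundary φ (x :: m)) =
        fun m => φ m + coboundary (fun m => φ (x :: m)) m := rfl
    rw [coboundary_cons, h, coboundary_add, ih, add_zero, CharTwo.add_self_eq_zero]

theorem coboundary_map (f : W → W') (φ : Cochain W') (l : List W) :
    coboundary (fun m => φ (m.map f)) l = coboundary φ (l.map f) := by
  induction l generalizing φ with
  | nil => rfl
  | cons x l ih =>
    simp only [List.map_cons, coboundary_cons]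
    rw [← ih]

theorem coboundary_eq_zero {φ : Cochain W} {l : List W}
    (h : ∀ m, m.Sublist l → m.length + 1 = l.length → φ m = 0) : coboundary φ l = 0 := by
  induction l generalizing φ with
  | nil => rfl
  | cons x l ih =>
    rw [coboundary_cons, h l (List.sublist_cons_self x l) (by simp), zero_add]
    refine ih fun m hm hl => h _ (hm.cons_cons x) (by simp [← hl])

theorem coboundary_congr {φ η : Cochain W} {l : List W}
    (h : ∀ m, m.Sublist l → m.length + 1 = l.length → φ m = η m) :
    coboundary φ l = coboundary η l := by
  have := coboundary_eq_zero (φ := fun m => φ m + η m) (l := l) fun m h1 h2 => by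
    simp [h m h1 h2, CharTwo.add_self_eq_zero]
  rw [coboundary_add] at this
  exact CharTwo.add_eq_zero.1 this

/-! ### Barycentric subdivision -/

/-- The lists of points of `C` at pairwise distance at most `d`. -/
def IsSmall {E : Type*} [PseudoMetricSpace E] (C : Set E) (d : ℝ) (l : List E) : Prop :=
  (∀ x ∈ l, x ∈ C) ∧ ∀ x ∈ l, ∀ y ∈ l, dist x y ≤ d

theorem IsSmall.sublist {E : Type*} [PseudoMetricSpace E] {C : Set E} {d : ℝ} {l m : List E}
    (h : IsSmall C d l) (hm : m.Sublist l) : IsSmall C d m :=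
  ⟨fun x hx => h.1 x (hm.subset hx), fun x hx y hy => h.2 x (hm.subset hx) y (hm.subset hy)⟩

section Subdivision

variable {E : Type*} [NormedAddCommGroup E] [NormedSpace ℝ E]

/-- The barycenter of a finite family of points. -/
noncomputable def barycenter (l : List E) : E := (l.length : ℝ)⁻¹ • l.sum

/-- Barycentric subdivision of simplices with `k` vertices, on cochains: a simplex is replaced by
the cones, with apex its barycenter, over its subdivided faces. -/
noncomputable def subdivAux : ℕ → Cochain E → Cochain E
  | 0, φ, l => φ l
  | k + 1, φ, l => coboundary (subdivAux k fun m => φ (barycenter l :: m)) l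

/-- The pull-back of a cochain by barycentric subdivision. -/
noncomputable def subdiv (φ : Cochain E) : Cochain E := fun l => subdivAux l.length φ l

theorem subdivAux_add (k : ℕ) (φ η : Cochain E) (l : List E) :
    subdivAux k (fun m => φ m + η m) l = subdivAux k φ l + subdivAux k η l := by
  induction k generalizing φ η l with
  | zero => rfl
  | succ k ih =>
    simp only [subdivAux]
    rw [← coboundary_add]
    congr 1
    ext m
    exact ih _ _ _

theorem subdiv_add (φ η : Cochain E) :
    subdiv (fun m => φ m + η m) = fun m => subdiv φ m + subdiv η m := by
  ext l; exact subdivAux_add _ _ _ _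

theorem subdivAux_coboundary (k : ℕ) (φ : Cochain E) (l : List E) (hl : l.length = k + 1) :
    subdivAux (k + 1) (coboundary φ) l = coboundary (subdivAux k φ) l := by
  induction k generalizing φ l with
  | zero =>
    obtain ⟨x, rfl⟩ := List.length_eq_one_iff.1 hl
    simp [subdivAux, coboundary_cons]
  | succ k ih =>
    have h : (subdivAux (k + 1) fun m => coboundary φ (barycenter l :: m)) = fun m =>
        subdivAux (k + 1) φ m +
          subdivAux (k + 1) (coboundary fun m => φ (barycenter l :: m)) m := by
      ext m
      rw [← subdivAux_add]
      rfl
    rw [subdivAux, h, coboundary_add, add_eq_left]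
    rw [coboundary_congr (η := coboundary (subdivAux k fun m => φ (barycenter l :: m))),
      coboundary_coboundary]
    intro m _ hm
    exact ih _ _ (by omega)

theorem coboundary_subdiv (φ : Cochain E) :
    coboundary (subdiv φ) = subdiv (coboundary φ) := by
  ext l
  rcases hl : l.length with _ | k
  · obtain rfl := List.length_eq_zero_iff.1 hl
    rfl
  · rw [subdiv, hl, subdivAux_coboundary k φ l hl]
    refine coboundary_congr fun m _ hm => ?_
    rw [subdiv, show m.length = k by omega]

theorem barycenter_map (σ : E →ₗ[ℝ] E) (l : List E) :
    barycenter (l.map σ) = σ (barycenter l) := by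
  simp [barycenter, map_list_sum]

theorem subdivAux_map (σ : E →ₗ[ℝ] E) (k : ℕ) (φ : Cochain E) (l : List E) :
    subdivAux k (fun m => φ (m.map σ)) l = subdivAux k φ (l.map σ) := by
  induction k generalizing φ l with
  | zero => rfl
  | succ k ih =>
    rw [subdivAux, subdivAux, ← coboundary_map, barycenter_map]
    congr 1
    ext m
    rw [← ih]
    rfl

theorem subdiv_map (σ : E →ₗ[ℝ] E) (φ : Cochain E) :
    subdiv (fun m => φ (m.map σ)) = fun l => subdiv φ (l.map σ) := by
  ext l
  simp [subdiv, subdivAux_map]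

theorem barycenter_mem {C : Set E} (hC : Convex ℝ C) {l : List E} (hl : l ≠ [])
    (h : ∀ x ∈ l, x ∈ C) : barycenter l ∈ C := by
  have hpos : (0 : ℝ) < l.length := by exact_mod_cast List.length_pos_iff.2 hl
  have : barycenter l = ∑ i : Fin l.length, (l.length : ℝ)⁻¹ • l.get i := by
    rw [← Finset.smul_sum, barycenter]
    congr 1
    conv_lhs => rw [← List.ofFn_get l, List.sum_ofFn]
  rw [this]
  refine hC.sum_mem (fun _ _ => by positivity) ?_ fun i _ => h _ (List.get_mem _ _)
  simp [mul_inv_cancel₀ hpos.ne']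

theorem dist_barycenter_le {d : ℝ} {l : List E} (hd : ∀ x ∈ l, ∀ y ∈ l, dist x y ≤ d)
    {x : E} (hx : x ∈ l) : dist x (barycenter l) ≤ (1 - (l.length : ℝ)⁻¹) * d := by
  have hpos : (0 : ℝ) < l.length := by exact_mod_cast List.length_pos_of_mem hx
  have hsum : barycenter l = (l.length : ℝ)⁻¹ • ∑ i : Fin l.length, l.get i := by
    rw [barycenter]
    congr 1
    conv_lhs => rw [← List.ofFn_get l, List.sum_ofFn]
  obtain ⟨j, rfl⟩ := List.get_of_mem hx
  have key : l.get j - barycenter l =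
      (l.length : ℝ)⁻¹ • ∑ i ∈ Finset.univ.erase j, (l.get j - l.get i) := by
    rw [Finset.sum_erase _ (by simp), Finset.sum_sub_distrib, hsum, smul_sub]
    simp only [Finset.sum_const, Finset.card_univ, Fintype.card_fin, ← Nat.cast_smul_eq_nsmul ℝ,
      smul_smul]
    rw [inv_mul_cancel₀ hpos.ne', one_smul]
  rw [dist_eq_norm, key, norm_smul, Real.norm_of_nonneg (by positivity)]
  have h1 : ‖∑ i ∈ Finset.univ.erase j, (l.get j - l.get i)‖ ≤ (l.length - 1) * d := by
    refine (norm_sum_le_of_le _ (n := fun _ => d) fun i _ => ?_).trans_eq ?_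
    · rw [← dist_eq_norm]; exact hd _ (List.get_mem _ _) _ (List.get_mem _ _)
    · rw [Finset.sum_const, Finset.card_erase_of_mem (Finset.mem_univ _), nsmul_eq_mul,
        Finset.card_univ, Fintype.card_fin, Nat.cast_sub (by exact_mod_cast hpos), Nat.cast_one]
  calc _ ≤ (l.length : ℝ)⁻¹ * ((l.length - 1) * d) := by gcongr
    _ = _ := by field_simp

/-- Subdivision of simplices with at most `n` vertices shrinks diameters by the factor
`1 - 1 / n`. -/
theorem subdivAux_eq_zero {n : ℕ} {d : ℝ} (hd : 0 ≤ d) {k : ℕ} (hk : k ≤ n) {C : Set E}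
    (hC : Convex ℝ C) {φ : Cochain E}
    (hφ : ∀ l, l.length = k → IsSmall C ((1 - (n : ℝ)⁻¹) * d) l → φ l = 0)
    {l : List E} (hl : l.length = k) (hs : IsSmall C d l) : subdivAux k φ l = 0 := by
  induction k generalizing C φ l with
  | zero =>
    obtain rfl := List.length_eq_zero_iff.1 hl
    exact hφ _ rfl ⟨by simp, by simp⟩
  | succ k ih =>
    refine coboundary_eq_zero fun m hm hml => ?_
    have hne : l ≠ [] := by rintro rfl; simp at hl
    set b := barycenter l
    set r := (1 - (n : ℝ)⁻¹) * d
    have hr : ∀ x ∈ l, dist x b ≤ r := fun x hx => by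
      refine (dist_barycenter_le hs.2 hx).trans ?_
      have : (0 : ℝ) < l.length := by exact_mod_cast List.length_pos_iff.2 hne
      have h2 : (l.length : ℝ) ≤ n := by exact_mod_cast hl.trans_le hk
      have := inv_anti₀ this h2
      exact mul_le_mul_of_nonneg_right (by linarith) hd
    have hr0 : 0 ≤ r := by
      obtain ⟨x, hx⟩ := List.exists_mem_of_ne_nil l hne
      exact dist_nonneg.trans (hr x hx)
    -- the faces stay in the convex set of points of `C` close to the barycenter
    refine ih (C := C ∩ Metric.closedBall b r) (by omega)
      (hC.inter (convex_closedBall b r)) ?_ (by omega) ?_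
    · intro q hql hq
      refine hφ _ (by simp [hql]) ⟨?_, ?_⟩
      · simp only [List.mem_cons, forall_eq_or_imp]
        exact ⟨barycenter_mem hC hne hs.1, fun x hx => (hq.1 x hx).1⟩
      · simp only [List.mem_cons, forall_eq_or_imp]
        refine ⟨⟨by simpa using hr0, fun x hx => ?_⟩, fun x hx => ⟨(hq.1 x hx).2, hq.2 x hx⟩⟩
        rw [dist_comm]; exact (hq.1 x hx).2
    · exact ⟨fun x hx => ⟨hs.1 x (hm.subset hx), hr x (hm.subset hx)⟩, (hs.sublist hm).2⟩

theorem subdiv_iterate_eq_zero {n : ℕ} {d : ℝ} (hd : 0 ≤ d) (m : ℕ) {C : Set E}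
    (hC : Convex ℝ C) {φ : Cochain E}
    (hφ : ∀ l, l.length ≤ n → IsSmall C ((1 - (n : ℝ)⁻¹) ^ m * d) l → φ l = 0)
    {l : List E} (hl : l.length ≤ n) (hs : IsSmall C d l) : subdiv^[m] φ l = 0 := by
  induction m generalizing φ with
  | zero => exact hφ l hl (by simpa using hs)
  | succ m ih =>
    rw [Function.iterate_succ_apply]
    refine ih fun q hq hqs => ?_
    have h0 : (0 : ℝ) ≤ 1 - (n : ℝ)⁻¹ := sub_nonneg.2 (Nat.cast_inv_le_one n)
    refine subdivAux_eq_zero (n := n) (mul_nonneg (pow_nonneg h0 m) hd) hq hC ?_ rfl hqs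
    intro l hl hls
    refine hφ l (hl.trans_le hq) ?_
    rwa [pow_succ', mul_assoc]

theorem coboundary_subdiv_iterate (m : ℕ) (φ : Cochain E) :
    coboundary (subdiv^[m] φ) = subdiv^[m] (coboundary φ) := by
  induction m generalizing φ with
  | zero => rfl
  | succ m ih => rw [Function.iterate_succ_apply, ih, coboundary_subdiv]; rfl

theorem subdiv_iterate_add (m : ℕ) (φ η : Cochain E) :
    subdiv^[m] (fun l => φ l + η l) = fun l => subdiv^[m] φ l + subdiv^[m] η l := by
  induction m generalizing φ η with
  | zero => rfl
  | succ m ih => simp only [Function.iterate_succ_apply, subdiv_add, ih]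

theorem subdiv_iterate_map (σ : E →ₗ[ℝ] E) (m : ℕ) (φ : Cochain E) :
    subdiv^[m] (fun l => φ (l.map σ)) = fun l => subdiv^[m] φ (l.map σ) := by
  induction m generalizing φ with
  | zero => rfl
  | succ m ih => simp only [Function.iterate_succ_apply, subdiv_map, ih]

theorem subdiv_iterate_singleton (m : ℕ) (φ : Cochain E) (x : E) :
    subdiv^[m] φ [x] = φ [x] := by
  induction m generalizing φ with
  | zero => rfl
  | succ m ih =>
    rw [Function.iterate_succ_apply, ih]
    simp [subdiv, subdivAux, coboundary_cons, barycenter]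

end Subdivision

/-! ### Cup products of coboundaries of odd functions -/

/-- The cup product of the coboundaries of the functions `s 0, …, s (n - 1)`, a cocycle on lists
with `n + 1` entries. -/
def cup (s : ℕ → W → ZMod 2) : ℕ → Cochain W
  | 0, [_] => 1
  | n + 1, x :: y :: l => (s n x + s n y) * cup s n (y :: l)
  | _, _ => 0

/-- A primitive of the cup product `cup s (n + 1)`. -/
def cupPrimitive (s : ℕ → W → ZMod 2) (n : ℕ) : Cochain W
  | [] => 0
  | x :: l => s n x * cup s n (x :: l)

@[simp] theorem cup_nil (s : ℕ → W → ZMod 2) (n : ℕ) : cup s n [] = 0 := by cases n <;> rfl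

theorem coboundary_cupPrimitive_aux (s : ℕ → W → ZMod 2) (n : ℕ)
    (h : coboundary (cup s n) = 0) : coboundary (cupPrimitive s n) = cup s (n + 1) := by
  ext l
  match l with
  | [] => simp
  | [x] => rfl
  | x :: y :: l =>
    have h1 := congrFun h (x :: y :: l)
    rw [coboundary_cons, Pi.zero_apply, CharTwo.add_eq_zero] at h1
    have h2 : (fun m => cupPrimitive s n (x :: m)) = fun m => s n x * cup s n (x :: m) := rfl
    rw [coboundary_cons, h2, coboundary_const_mul, ← h1]
    simp only [cupPrimitive, cup]
    ring

theorem coboundary_cup (s : ℕ → W → ZMod 2) (n : ℕ) : coboundary (cup s n) = 0 := by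
  induction n with
  | zero =>
    ext l
    match l with
    | [] => rfl
    | [x] => rfl
    | [x, y] => simp [coboundary_cons, cup, CharTwo.add_self_eq_zero]
    | x :: y :: z :: l =>
      refine coboundary_eq_zero fun m _ hm => ?_
      match m, hm with
      | [], _ => rfl
      | [_], hm => simp at hm
      | _ :: _ :: _, _ => rfl
  | succ n ih =>
    rw [← coboundary_cupPrimitive_aux s n ih]
    ext l
    exact coboundary_coboundary _ l

theorem coboundary_cupPrimitive (s : ℕ → W → ZMod 2) (n : ℕ) :
    coboundary (cupPrimitive s n) = cup s (n + 1) :=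
  coboundary_cupPrimitive_aux s n (coboundary_cup s n)

theorem cup_map_of_odd {s : ℕ → W → ZMod 2} {σ : W → W} {n : ℕ} {l : List W}
    (h : ∀ x ∈ l, ∀ i, s i (σ x) = s i x + 1) : cup s n (l.map σ) = cup s n l := by
  induction n generalizing l with
  | zero =>
    match l with
    | [] => rfl
    | [x] => rfl
    | x :: y :: l => rfl
  | succ n ih =>
    match l with
    | [] => rfl
    | [x] => rfl
    | x :: y :: l =>
      have := ih (l := y :: l) fun z hz => h z (List.mem_cons_of_mem _ hz)
      simp only [List.map_cons, cup] at this ⊢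
      rw [this, h x (by simp), h y (by simp)]
      congr 1
      ring_nf
      rw [show (2 : ZMod 2) = 0 from rfl, zero_add]

theorem cupPrimitive_map_of_odd {s : ℕ → W → ZMod 2} {σ : W → W} {n : ℕ} {l : List W}
    (h : ∀ x ∈ l, ∀ i, s i (σ x) = s i x + 1) :
    cupPrimitive s n (l.map σ) = cupPrimitive s n l + cup s n l := by
  match l with
  | [] => simp [cupPrimitive]
  | x :: l =>
    have := cup_map_of_odd (n := n) h
    simp only [List.map_cons, cupPrimitive] at this ⊢
    rw [this, h x (by simp)]
    ring

/-- A cup product vanishes on a list on which one of its factors is constant. -/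
theorem cup_eq_zero {s : ℕ → W → ZMod 2} {n i : ℕ} (hi : i < n) {l : List W}
    (h : ∀ x ∈ l, ∀ y ∈ l, s i x = s i y) : cup s n l = 0 := by
  induction n generalizing l with
  | zero => omega
  | succ n ih =>
    match l with
    | [] => rfl
    | [x] => rfl
    | x :: y :: l =>
      rcases Nat.lt_succ_iff_lt_or_eq.1 hi with h' | rfl
      · rw [cup, ih h' fun a ha b hb => h a (List.mem_cons_of_mem _ ha) b
          (List.mem_cons_of_mem _ hb), mul_zero]
      · rw [cup, h x (by simp) y (by simp), CharTwo.add_self_eq_zero, zero_mul]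

/-! ### Hemispheres of the cross-polytope and prisms -/

section Hemisphere

variable {E : Type*} [AddCommGroup E]

/-- The sum of the values of a cochain on the maximal simplices `(±e (n - 1), …, ±e 0)` of the
boundary of the cross-polytope. -/
def sphereSum (e : ℕ → E) : ℕ → Cochain E → ZMod 2
  | 0, φ => φ []
  | n + 1, φ => sphereSum e n (fun l => φ (e n :: l)) + sphereSum e n fun l => φ (-e n :: l)

/-- The sum of the values of a cochain on the simplices `(e n, ±e (n - 1), …, ±e 0)` of a
hemisphere of the boundary of the cross-polytope. -/
def hemisphereSum (e : ℕ → E) (n : ℕ) (φ : Cochain E) : ZMod 2 :=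
  sphereSum e n fun l => φ (e n :: l)

theorem sphereSum_add (e : ℕ → E) (n : ℕ) (φ η : Cochain E) :
    sphereSum e n (fun l => φ l + η l) = sphereSum e n φ + sphereSum e n η := by
  induction n generalizing φ η with
  | zero => rfl
  | succ n ih => simp only [sphereSum, ih]; ring

theorem sphereSum_map_neg (e : ℕ → E) (n : ℕ) (φ : Cochain E) :
    sphereSum e n (fun l => φ (l.map Neg.neg)) = sphereSum e n φ := by
  induction n generalizing φ with
  | zero => rfl
  | succ n ih =>
    simp only [sphereSum, List.map_cons, neg_neg]
    rw [ih fun l => φ (-e n :: l), ih fun l => φ (e n :: l), add_comm]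

theorem sphereSum_coboundary (e : ℕ → E) (n : ℕ) (φ : Cochain E) :
    sphereSum e n (coboundary φ) = 0 := by
  induction n generalizing φ with
  | zero => rfl
  | succ n ih =>
    simp only [sphereSum, coboundary_cons]
    rw [sphereSum_add, sphereSum_add, ih, ih, add_zero, CharTwo.add_self_eq_zero]

theorem hemisphereSum_add (e : ℕ → E) (n : ℕ) (φ η : Cochain E) :
    hemisphereSum e n (fun l => φ l + η l) = hemisphereSum e n φ + hemisphereSum e n η :=
  sphereSum_add e n _ _

theorem sphereSum_succ (e : ℕ → E) (n : ℕ) (φ : Cochain E) :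
    sphereSum e (n + 1) φ = hemisphereSum e n φ + hemisphereSum e n fun l => φ (l.map Neg.neg) := by
  simp only [sphereSum, hemisphereSum, List.map_cons]
  rw [sphereSum_map_neg e n fun l => φ (-e n :: l)]

/-- The boundary of a hemisphere is the sum of a hemisphere one dimension lower and its antipode. -/
theorem hemisphereSum_coboundary (e : ℕ → E) (n : ℕ) (φ : Cochain E) :
    hemisphereSum e (n + 1) (coboundary φ) =
      hemisphereSum e n φ + hemisphereSum e n fun l => φ (l.map Neg.neg) := by
  rw [hemisphereSum]
  simp only [coboundary_cons]
  rw [sphereSum_add, sphereSum_coboundary, add_zero, sphereSum_succ]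

/-- The simplex `(ε (n - 1) e (n - 1), …, ε 0 e 0)`. -/
def signedSimplex (e : ℕ → E) (ε : ℕ → ℤˣ) (n : ℕ) : List E :=
  ((List.range n).map fun i => ε i • e i).reverse

theorem signedSimplex_succ (e : ℕ → E) (ε : ℕ → ℤˣ) (n : ℕ) :
    signedSimplex e ε (n + 1) = ε n • e n :: signedSimplex e ε n := by
  simp [signedSimplex, List.range_succ]

theorem signedSimplex_congr (e : ℕ → E) {ε ε' : ℕ → ℤˣ} {n : ℕ} (h : ∀ i < n, ε i = ε' i) :
    signedSimplex e ε n = signedSimplex e ε' n := by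
  simp only [signedSimplex, List.reverse_inj]
  exact List.map_congr_left fun i hi => by rw [h i (List.mem_range.1 hi)]

theorem sphereSum_eq_zero {e : ℕ → E} {n : ℕ} {φ : Cochain E}
    (h : ∀ ε, φ (signedSimplex e ε n) = 0) : sphereSum e n φ = 0 := by
  induction n generalizing φ with
  | zero => exact h 1
  | succ n ih =>
    have key : ∀ u : ℤˣ, sphereSum e n (fun l => φ (u • e n :: l)) = 0 := fun u =>
      ih fun ε => by
        have := h (Function.update ε n u)
        rwa [signedSimplex_succ, Function.update_self, signedSimplex_congr e (ε' := ε)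
          fun i hi => Function.update_of_ne hi.ne _ _] at this
    have h1 := key 1
    have h2 := key (-1)
    simp only [one_smul, Units.neg_smul] at h1 h2
    rw [sphereSum, h1, h2, add_zero]

theorem hemisphereSum_eq_zero {e : ℕ → E} {n : ℕ} {φ : Cochain E}
    (h : ∀ ε, φ (signedSimplex e ε (n + 1)) = 0) : hemisphereSum e n φ = 0 := by
  refine sphereSum_eq_zero fun ε => ?_
  have := h (Function.update ε n 1)
  rwa [signedSimplex_succ, Function.update_self, one_smul, signedSimplex_congr e (ε' := ε)
    fun i hi => Function.update_of_ne hi.ne _ _] at this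

end Hemisphere

/-- The prism operator of two maps `a` and `b`, on cochains: the value on `(x₀, …, x_k)` is the sum
over `i` of the values of `φ` on `(a x₀, …, a x_i, b x_i, …, b x_k)`. -/
def prism (a b : W → W') (φ : Cochain W') : List W → ZMod 2
  | [] => 0
  | x :: l => φ (a x :: b x :: l.map b) + prism a b (fun m => φ (a x :: m)) l

theorem prism_add (a b : W → W') (φ η : Cochain W') (l : List W) :
    prism a b (fun m => φ m + η m) l = prism a b φ l + prism a b η l := by
  induction l generalizing φ η with
  | nil => rfl
  | cons x l ih => simp only [prism, ih]; ring

/-- The prism operator is a homotopy between the maps induced by `a` and `b`. -/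
theorem prism_coboundary (a b : W → W') (φ : Cochain W') (l : List W) :
    prism a b (coboundary φ) l + coboundary (prism a b φ) l = φ (l.map a) + φ (l.map b) := by
  induction l generalizing φ with
  | nil => simp [prism, CharTwo.add_self_eq_zero]
  | cons x l ih =>
    have h3 := ih fun m => φ (a x :: m)
    have h4 := coboundary_map b (fun m => φ (a x :: b x :: m)) l
    simp only [prism, coboundary_cons, List.map_cons] at h3 ⊢
    rw [prism_add, coboundary_add, h4]
    generalize coboundary (fun m => φ (a x :: b x :: m)) (l.map b) = A at *
    generalize prism a b φ l = B at *
    linear_combination h3 + A * (CharTwo.two_eq_zero (R := ZMod 2)) +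
      (B + φ (a x :: l.map b)) * (CharTwo.two_eq_zero (R := ZMod 2))

theorem prism_map {a b : W → W'} {τ : W → W} {σ : W' → W'} (ha : ∀ x, a (τ x) = σ (a x))
    (hb : ∀ x, b (τ x) = σ (b x)) (φ : Cochain W') (l : List W) :
    prism a b φ (l.map τ) = prism a b (fun m => φ (m.map σ)) l := by
  induction l generalizing φ with
  | nil => rfl
  | cons x l ih =>
    simp only [List.map_cons, prism, ha, hb, ih, List.map_map]
    rw [show b ∘ τ = σ ∘ b from funext hb]

theorem prism_eq_zero {a b : W → W'} {φ : Cochain W'} {l : List W}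
    (h : ∀ m : List W', m.length = l.length + 1 → (∀ y ∈ m, ∃ x ∈ l, y = a x ∨ y = b x) → φ m = 0) :
    prism a b φ l = 0 := by
  induction l generalizing φ with
  | nil => rfl
  | cons x l ih =>
    rw [prism, h _ (by simp), ih, add_zero]
    · intro m hm hml
      refine h _ (by simp [hm]) fun y hy => ?_
      rcases List.mem_cons.1 hy with rfl | hy
      · exact ⟨x, by simp⟩
      · obtain ⟨z, hz, h⟩ := hml y hy
        exact ⟨z, List.mem_cons_of_mem _ hz, h⟩
    · intro y hy
      simp only [List.mem_cons, List.mem_map] at hy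
      rcases hy with rfl | rfl | ⟨z, hz, rfl⟩
      · exact ⟨x, by simp⟩
      · exact ⟨x, by simp⟩
      · exact ⟨z, by simp [hz]⟩

/-! ### A Borsuk–Ulam theorem for homotopies through odd maps -/

theorem exists_subdiv_iterate_eq_zero {E : Type*} [NormedAddCommGroup E] [NormedSpace ℝ E]
    (n : ℕ) {d δ : ℝ} (hd : 0 ≤ d) (hδ : 0 < δ) :
    ∃ m : ℕ, ∀ (C : Set E) (φ : Cochain E), Convex ℝ C → (∀ x ∈ C, ∀ y ∈ C, dist x y ≤ d) →
      (∀ l, IsSmall C δ l → φ l = 0) →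
      ∀ l : List E, l.length ≤ n → (∀ x ∈ l, x ∈ C) → subdiv^[m] φ l = 0 := by
  have h0 : (0 : ℝ) ≤ 1 - (n : ℝ)⁻¹ := sub_nonneg.2 (Nat.cast_inv_le_one n)
  rcases Nat.eq_zero_or_pos n with rfl | hn
  · refine ⟨0, fun C φ _ _ h l hl _ => ?_⟩
    obtain rfl : l = [] := List.length_eq_zero_iff.1 (by omega)
    exact h _ ⟨by simp, by simp⟩
  have h1 : 1 - (n : ℝ)⁻¹ < 1 := by
    have : (0 : ℝ) < (n : ℝ)⁻¹ := by positivity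
    linarith
  have hlim : Tendsto (fun m : ℕ => (1 - (n : ℝ)⁻¹) ^ m * d) atTop (𝓝 (0 * d)) :=
    (tendsto_pow_atTop_nhds_zero_of_lt_one h0 h1).mul_const d
  rw [zero_mul] at hlim
  obtain ⟨m, hm⟩ := (hlim.eventually (gt_mem_nhds hδ)).exists
  refine ⟨m, fun C φ hC hCd h l hl hlC => ?_⟩
  refine subdiv_iterate_eq_zero hd m hC (fun q _ hq => h q ?_) hl
    ⟨hlC, fun x hx y hy => hCd x (hlC x hx) y (hlC y hy)⟩
  exact ⟨hq.1, fun x hx y hy => (hq.2 x hx y hy).trans hm.le⟩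

theorem mem_of_mem_signedSimplex {E : Type*} [AddCommGroup E] {e : ℕ → E} {n : ℕ}
    {C : (ℕ → ℤˣ) → Set (ℝ × E)} {t : ℝ} (hmem : ∀ ε, ∀ i ≤ n, (t, ε i • e i) ∈ C ε)
    {ε : ℕ → ℤˣ} {k : ℕ} (hk : k ≤ n + 1) {x : E}
    (hx : x ∈ signedSimplex e ε k) : (t, x) ∈ C ε := by
  simp only [signedSimplex, List.mem_reverse, List.mem_map, List.mem_range] at hx
  obtain ⟨i, hi, rfl⟩ := hx
  exact hmem ε i (by omega)

theorem length_signedSimplex {E : Type*} [AddCommGroup E] (e : ℕ → E) (ε : ℕ → ℤˣ) (k : ℕ) :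
    (signedSimplex e ε k).length = k := by
  simp [signedSimplex]

section Cylinder

variable {E : Type*} [NormedAddCommGroup E] [NormedSpace ℝ E]

/-- The involution `(t, y) ↦ (t, -y)`. -/
def flip : ℝ × E →ₗ[ℝ] ℝ × E := LinearMap.prodMap LinearMap.id (-LinearMap.id)

@[simp] theorem flip_apply (t : ℝ) (y : E) : flip (t, y) = (t, -y) := by simp [flip]

theorem map_neg_map_mk (t : ℝ) (l : List E) :
    (l.map Neg.neg).map (Prod.mk t) = (l.map (Prod.mk t)).map flip := by
  simp [Function.comp_def]

/-- The product of the cochain `cup s n` with the function `r`, evaluated at the first vertex. -/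
def weightedCup (r : ℝ × E → ZMod 2) (s : ℕ → ℝ × E → ZMod 2) (n : ℕ) : Cochain (ℝ × E)
  | [] => 0
  | x :: l => r x * cup s n (x :: l)

/-- The parity argument behind the linking theorem: given `n` odd functions `s i` and an even
function `r` on a cylinder over the cross-polytope, where `r = 1` at the bottom and `r = 0` at the
top, there are arbitrarily small simplices on which none of these functions is constant.

Otherwise `weightedCup r s n` is a cocycle on small simplices, because the cup product vanishes
where some `s i` is constant. Its pairing with the subdivided hemisphere is `1` at the bottom, by
induction on the dimension and oddness, and `0` at the top. By the prism operator the two pairings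
differ by the contribution of the boundary of the hemisphere, which is `0` modulo two since this
boundary consists of two antipodal pieces and the cochain is invariant under `flip`. -/
theorem not_locally_constant {e : ℕ → E} {n : ℕ} {C : (ℕ → ℤˣ) → Set (ℝ × E)} {d δ : ℝ}
    {s : ℕ → ℝ × E → ZMod 2} {r : ℝ × E → ZMod 2} (hd : 0 ≤ d) (hδ : 0 < δ)
    (hC : ∀ ε, Convex ℝ (C ε)) (hCd : ∀ ε, ∀ x ∈ C ε, ∀ y ∈ C ε, dist x y ≤ d)
    (h0 : ∀ ε, ∀ i ≤ n, ((0 : ℝ), ε i • e i) ∈ C ε) (h1 : ∀ ε, ∀ i ≤ n, ((1 : ℝ), ε i • e i) ∈ C ε)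
    (hs : ∀ ε, ∀ x ∈ C ε, ∀ i, s i (flip x) = s i x + 1)
    (hr : ∀ ε, ∀ x ∈ C ε, r (flip x) = r x)
    (hr0 : ∀ ε, ∀ x ∈ C ε, x.1 = 0 → r x = 1) (hr1 : ∀ ε, ∀ x ∈ C ε, x.1 = 1 → r x = 0)
    (hloc : ∀ ε l, IsSmall (C ε) δ l → (∀ x ∈ l, ∀ y ∈ l, r x = r y) ∨
      ∃ i < n, ∀ x ∈ l, ∀ y ∈ l, s i x = s i y) : False := by
  obtain ⟨m, hm⟩ := exists_subdiv_iterate_eq_zero (E := ℝ × E) (n + 2) hd hδ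
  -- cochains that vanish on small simplices vanish on the subdivided simplices of the cylinder
  have van : ∀ (t : ℝ) (φ : Cochain (ℝ × E)), (∀ ε, ∀ i ≤ n, (t, ε i • e i) ∈ C ε) →
      (∀ ε l, IsSmall (C ε) δ l → (∀ x ∈ l, x.1 = t) → φ l = 0) → ∀ k ≤ n,
      hemisphereSum e k (fun l => subdiv^[m] φ (l.map (Prod.mk t))) = 0 := by
    intro t φ hmem hφ k hk
    refine hemisphereSum_eq_zero fun ε => ?_
    refine hm (C ε ∩ {x | x.1 = t}) φ
      ((hC ε).inter ((convex_singleton t).linear_preimage (LinearMap.fst ℝ ℝ E)))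
      (fun x hx y hy => hCd ε x hx.1 y hy.1)
      (fun l hl => hφ ε l ⟨fun x hx => (hl.1 x hx).1, hl.2⟩ fun x hx => (hl.1 x hx).2) _
      (by simp [length_signedSimplex]; omega) ?_
    intro x hx
    obtain ⟨y, hy, rfl⟩ := List.mem_map.1 hx
    exact ⟨mem_of_mem_signedSimplex hmem (by omega) hy, rfl⟩
  have vanPrism : ∀ φ : Cochain (ℝ × E), (∀ ε l, IsSmall (C ε) δ l → φ l = 0) → ∀ k ≤ n,
      hemisphereSum e k (prism (Prod.mk 0) (Prod.mk 1) (subdiv^[m] φ)) = 0 := by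
    intro φ hφ k hk
    refine hemisphereSum_eq_zero fun ε => prism_eq_zero fun l hl hmem => ?_
    refine hm (C ε) φ (hC ε) (hCd ε) (hφ ε) l (by rw [hl, length_signedSimplex]; omega) ?_
    intro y hy
    obtain ⟨x, hx, rfl | rfl⟩ := hmem y hy
    · exact mem_of_mem_signedSimplex h0 (by omega) hx
    · exact mem_of_mem_signedSimplex h1 (by omega) hx
  -- the pairing of the cup products with the hemispheres at the bottom is `1`
  have bot : ∀ k ≤ n, hemisphereSum e k
      (fun l => subdiv^[m] (cup s k) (l.map (Prod.mk (0 : ℝ)))) = 1 := by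
    intro k
    induction k with
    | zero =>
      intro _
      simp [hemisphereSum, sphereSum, subdiv_iterate_singleton, cup]
    | succ k ih =>
      intro hk
      rw [← ih (by omega), ← coboundary_cupPrimitive, ← coboundary_subdiv_iterate]
      have e1 : (fun l : List E => coboundary (subdiv^[m] (cupPrimitive s k))
          (l.map (Prod.mk (0 : ℝ)))) =
          coboundary fun l => subdiv^[m] (cupPrimitive s k) (l.map (Prod.mk (0 : ℝ))) := by
        ext l; rw [← coboundary_map]
      rw [e1, hemisphereSum_coboundary]
      have e2 := van 0 (fun l => cupPrimitive s k l + cupPrimitive s k (l.map flip) + cup s k l) h0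
        (fun ε l hl _ => by
          rw [cupPrimitive_map_of_odd fun x hx i => hs ε x (hl.1 x hx) i, add_assoc, add_assoc,
            CharTwo.add_self_eq_zero, add_zero, CharTwo.add_self_eq_zero]) k (by omega)
      rw [subdiv_iterate_add, subdiv_iterate_add, subdiv_iterate_map, hemisphereSum_add,
        hemisphereSum_add, CharTwo.add_eq_zero] at e2
      simpa only [map_neg_map_mk] using e2
  set θ := weightedCup r s n with hθ
  have θ_zero : ∀ l : List (ℝ × E), (∃ i < n, ∀ x ∈ l, ∀ y ∈ l, s i x = s i y) → θ l = 0 := by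
    rintro (_ | ⟨x, l⟩) ⟨i, hi, h⟩
    · rfl
    · change r x * cup s n (x :: l) = 0
      rw [cup_eq_zero hi h, mul_zero]
  have θ_const : ∀ (c : ZMod 2) (l : List (ℝ × E)), (∀ x ∈ l, r x = c) → θ l = c * cup s n l := by
    rintro c (_ | ⟨x, l⟩) h
    · simp [hθ, weightedCup]
    · rw [hθ, weightedCup, h x (by simp)]
  have θ_cocycle : ∀ ε l, IsSmall (C ε) δ l → coboundary θ l = 0 := by
    intro ε l hl
    rcases hloc ε l hl with h | ⟨i, hi, h⟩
    · rcases l with _ | ⟨x, l⟩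
      · rfl
      · rw [coboundary_congr (η := fun m => r x * cup s n m) fun q hq _ => θ_const _ _ fun y hy =>
          h y (hq.subset hy) x (by simp), coboundary_const_mul, coboundary_cup, Pi.zero_apply,
          mul_zero]
    · exact coboundary_eq_zero fun q hq _ => θ_zero q
        ⟨i, hi, fun x hx y hy => h x (hq.subset hx) y (hq.subset hy)⟩
  have θ_flip : ∀ ε l, IsSmall (C ε) δ l → θ l + θ (l.map flip) = 0 := by
    intro ε l hl
    rcases l with _ | ⟨x, l⟩
    · rfl
    · have := cup_map_of_odd (n := n) fun x hx i => hs ε x (hl.1 x hx) i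
      simp only [hθ, List.map_cons, weightedCup] at this ⊢
      rw [this, hr ε x (hl.1 x (by simp)), CharTwo.add_self_eq_zero]
  have hbot : hemisphereSum e n (fun l => subdiv^[m] θ (l.map (Prod.mk (0 : ℝ)))) = 1 := by
    rw [← bot n le_rfl, ← CharTwo.add_eq_zero, ← hemisphereSum_add]
    have := van 0 (fun l => θ l + cup s n l) h0 (fun ε l hl ht => by
      rw [θ_const 1 l fun x hx => hr0 ε x (hl.1 x hx) (ht x hx), one_mul,
        CharTwo.add_self_eq_zero]) n le_rfl
    rwa [subdiv_iterate_add] at this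
  have htop : hemisphereSum e n (fun l => subdiv^[m] θ (l.map (Prod.mk (1 : ℝ)))) = 0 :=
    van 1 θ h1 (fun ε l hl ht => by
      rw [θ_const 0 l fun x hx => hr1 ε x (hl.1 x hx) (ht x hx), zero_mul]) n le_rfl
  have hpr := congrArg (hemisphereSum e n)
    (funext fun l => prism_coboundary (Prod.mk (0 : ℝ)) (Prod.mk (1 : ℝ)) (subdiv^[m] θ) l)
  rw [hemisphereSum_add, hemisphereSum_add, hbot, htop, coboundary_subdiv_iterate,
    vanPrism _ θ_cocycle n le_rfl, zero_add, add_zero] at hpr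
  rcases n with _ | k
  · exact zero_ne_one hpr
  · have e3 := vanPrism (fun l => θ l + θ (l.map flip)) θ_flip k (by omega)
    rw [subdiv_iterate_add, subdiv_iterate_map] at e3
    rw [hemisphereSum_coboundary] at hpr
    simp only [fun l : List E => prism_map (a := Prod.mk (0 : ℝ)) (b := Prod.mk 1) (τ := Neg.neg)
      (σ := flip) (fun x => (flip_apply 0 x).symm) (fun x => (flip_apply 1 x).symm)
      (subdiv^[m] θ) l] at hpr
    have e4 := funext fun l => prism_add (Prod.mk (0 : ℝ)) (Prod.mk 1) (subdiv^[m] θ)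
      (fun q : List (ℝ × E) => subdiv^[m] θ (q.map flip)) l
    have e5 := (congrArg (hemisphereSum e k) e4).symm.trans e3
    rw [hemisphereSum_add] at e5
    exact zero_ne_one (e5.symm.trans hpr)

end Cylinder

end Cochain

open Classical in
/-- The radial projection to the unit sphere; the origin is sent to `x₀`. -/
noncomputable def sphereProj {E : Type*} [NormedAddCommGroup E] [NormedSpace ℝ E]
    (x₀ : Metric.sphere (0 : E) 1) (y : E) : Metric.sphere (0 : E) 1 :=
  if h : y = 0 then x₀ else ⟨‖y‖⁻¹ • y, by
    rw [mem_sphere_zero_iff_norm, norm_smul, norm_inv, norm_norm,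
      inv_mul_cancel₀ (norm_ne_zero_iff.2 h)]⟩

theorem sphereProj_neg {E : Type*} [NormedAddCommGroup E] [NormedSpace ℝ E]
    (x₀ : Metric.sphere (0 : E) 1) {y : E} (h : y ≠ 0) :
    sphereProj x₀ (-y) = -sphereProj x₀ y := by
  ext1
  simp [sphereProj, h]

theorem continuousOn_sphereProj {E : Type*} [NormedAddCommGroup E] [NormedSpace ℝ E]
    (x₀ : Metric.sphere (0 : E) 1) : ContinuousOn (sphereProj x₀) {0}ᶜ := by
  rw [continuousOn_iff_continuous_domRestrict]
  have : ({0}ᶜ : Set E).domRestrict (sphereProj x₀) = fun y => ⟨‖(y : E)‖⁻¹ • (y : E), by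
      rw [mem_sphere_zero_iff_norm, norm_smul, norm_inv, norm_norm,
        inv_mul_cancel₀ (norm_ne_zero_iff.2 y.2)]⟩ := by
    ext1 y
    exact dif_neg y.2
  rw [this]
  refine Continuous.subtype_mk (Continuous.smul (Continuous.inv₀ (by fun_prop) fun y => ?_)
    continuous_subtype_val) _
  exact norm_ne_zero_iff.2 y.2

/-- The lexicographic sign selects one point out of each antipodal pair. -/
theorem toLex_neg_pos_iff {n : ℕ} {y : EuclideanSpace ℝ (Fin n)} (hy : y ≠ 0) :
    0 < toLex (-y).ofLp ↔ ¬ 0 < toLex y.ofLp := by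
  have h0 : toLex y.ofLp ≠ 0 := fun h => hy (by ext i; exact congrFun h i)
  have h1 : toLex (-y).ofLp = -toLex y.ofLp := rfl
  rw [h1, neg_pos]
  exact ⟨fun h h' => lt_asymm h h', fun h => (lt_trichotomy _ _).resolve_right (not_or.2 ⟨h0, h⟩)⟩

open Cochain in
/-- A homotopy through odd maps from the `n`-sphere to `ℝⁿ`, together with an even function that
changes sign from the bottom to the top of the cylinder, has a common zero with it. For
`f (t, a) = t - 1 / 2` this is the Borsuk–Ulam theorem. -/
theorem exists_common_zero_of_odd_homotopy {n : ℕ}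
    {f : unitInterval × Metric.sphere (0 : EuclideanSpace ℝ (Fin (n + 1))) 1 → ℝ}
    {g : unitInterval × Metric.sphere (0 : EuclideanSpace ℝ (Fin (n + 1))) 1 → Fin n → ℝ}
    (hf : Continuous f) (hg : Continuous g) (hfeven : ∀ t a, f (t, -a) = f (t, a))
    (hgodd : ∀ t a, g (t, -a) = -g (t, a)) (hf0 : ∀ a, f (0, a) < 0) (hf1 : ∀ a, 0 < f (1, a)) :
    ∃ x, f x = 0 ∧ g x = 0 := by
  by_contra! hne
  set x₀ : Metric.sphere (0 : EuclideanSpace ℝ (Fin (n + 1))) 1 :=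
    ⟨EuclideanSpace.single 0 1, by simp⟩
  -- the cylinder over the boundary of the cross-polytope, and its convex pieces
  let K : Set (ℝ × EuclideanSpace ℝ (Fin (n + 1))) :=
    {x | x.1 ∈ Icc (0 : ℝ) 1 ∧ ‖x.2‖ ≤ 1 ∧ 1 ≤ ∑ j, |x.2 j|}
  let C : (ℕ → ℤˣ) → Set (ℝ × EuclideanSpace ℝ (Fin (n + 1))) := fun ε =>
    {x | x.1 ∈ Icc (0 : ℝ) 1 ∧ ‖x.2‖ ≤ 1 ∧ 1 ≤ ∑ j : Fin (n + 1), (((ε j : ℤˣ) : ℤ) : ℝ) * x.2 j}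
  let e : ℕ → EuclideanSpace ℝ (Fin (n + 1)) := fun i => EuclideanSpace.single (Fin.ofNat _ i) 1
  have hCK : ∀ ε, C ε ⊆ K := fun ε x hx =>
    ⟨hx.1, hx.2.1, hx.2.2.trans (Finset.sum_le_sum fun j _ => by
      rcases Int.units_eq_one_or (ε j) with h | h <;> simp [h, le_abs_self, neg_le_abs])⟩
  have hmem : ∀ t ∈ Icc (0 : ℝ) 1, ∀ ε, ∀ i ≤ n, (t, ε i • e i) ∈ C ε := by
    intro t ht ε i hi
    have hval : ((Fin.ofNat (n + 1) i : Fin (n + 1)) : ℕ) = i := Nat.mod_eq_of_lt (by omega)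
    have he : ε i • e i = EuclideanSpace.single (Fin.ofNat (n + 1) i) (((ε i : ℤˣ) : ℤ) : ℝ) := by
      simp only [e]
      generalize (Fin.ofNat (n + 1) i : Fin (n + 1)) = k
      ext j
      rcases Int.units_eq_one_or (ε i) with h | h <;> rcases eq_or_ne j k with rfl | hj <;> simp_all
    refine ⟨ht, ?_, ?_⟩
    · rw [he]
      rcases Int.units_eq_one_or (ε i) with h | h <;> simp [h]
    · rw [he, Finset.sum_eq_single (Fin.ofNat (n + 1) i)]
      · rw [hval]
        rcases Int.units_eq_one_or (ε i) with h | h <;> simp [h]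
      · intro j _ hj
        rw [PiLp.single_apply, if_neg hj, mul_zero]
      · simp
  have hK : IsCompact K := by
    have hsub : K ⊆ Icc (0 : ℝ) 1 ×ˢ Metric.closedBall 0 1 := fun x hx =>
      ⟨hx.1, by simpa using hx.2.1⟩
    refine (isCompact_Icc.prod (isCompact_closedBall _ _)).of_isClosed_subset ?_ hsub
    refine (isClosed_Icc.preimage continuous_fst).inter (IsClosed.inter
      (isClosed_le (f := fun x : ℝ × EuclideanSpace ℝ (Fin (n + 1)) => ‖x.2‖) (g := fun _ => 1)
        (by fun_prop) (by fun_prop))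
      (isClosed_le (f := fun _ => (1 : ℝ)) (g := fun x : ℝ × EuclideanSpace ℝ (Fin (n + 1)) =>
        ∑ j, |x.2 j|) (by fun_prop) (by fun_prop)))
  have hK0 : ∀ x ∈ K, x.2 ≠ 0 := by
    intro x hx h
    have := hx.2.2
    simp [h] at this
    linarith
  let p : ℝ × EuclideanSpace ℝ (Fin (n + 1)) → unitInterval × Metric.sphere _ 1 :=
    fun x => (projIcc 0 1 zero_le_one x.1, sphereProj x₀ x.2)
  have hp : ContinuousOn p K := by
    refine ContinuousOn.prodMk (continuous_projIcc.comp continuous_fst).continuousOn ?_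
    exact (continuousOn_sphereProj x₀).comp continuousOn_snd hK0
  have hpflip : ∀ x ∈ K, p (flip x) = ((p x).1, -(p x).2) := by
    rintro ⟨t, y⟩ hx
    simp only [p, flip_apply, sphereProj_neg x₀ (hK0 _ hx)]
  obtain ⟨η, hη, hηle⟩ : ∃ η > 0, ∀ x, η ≤ ‖(f x, g x)‖ := by
    obtain ⟨η, hη, h⟩ := isCompact_univ.exists_forall_le' (f := fun x => ‖(f x, g x)‖)
      (by fun_prop) (a := 0) fun x _ => norm_pos_iff.2 fun h => by
        obtain ⟨h1, h2⟩ := Prod.mk_eq_zero.1 h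
        exact hne x h1 h2
    exact ⟨η, hη, fun x => h x (mem_univ x)⟩
  have huc : UniformContinuousOn (fun x => (f (p x), g (p x))) K :=
    hK.uniformContinuousOn_of_continuous
      ((hf.comp_continuousOn hp).prodMk (hg.comp_continuousOn hp))
  obtain ⟨δ, hδ, hδη⟩ := Metric.uniformContinuousOn_iff.1 huc η hη
  -- signs of the components of `g`, with zeros decided by the lexicographic sign of the point
  let G : ℕ → ℝ × EuclideanSpace ℝ (Fin (n + 1)) → ℝ := fun i x =>
    if h : i < n then g (p x) ⟨i, h⟩ else 0
  have hGodd : ∀ i, ∀ x ∈ K, G i (flip x) = -G i x := by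
    intro i x hx
    by_cases h : i < n
    · simp only [G, h, dif_pos]
      rw [hpflip x hx, hgodd]
      rfl
    · simp [G, h]
  classical
  let s : ℕ → ℝ × EuclideanSpace ℝ (Fin (n + 1)) → ZMod 2 := fun i x =>
    if 0 < G i x ∨ (G i x = 0 ∧ 0 < toLex x.2.ofLp) then 1 else 0
  let r : ℝ × EuclideanSpace ℝ (Fin (n + 1)) → ZMod 2 := fun x => if f (p x) < 0 then 1 else 0
  refine not_locally_constant (e := e) (n := n) (C := C) (d := 2) (δ := δ / 2) (s := s) (r := r)
    zero_le_two (half_pos hδ) ?_ ?_ ?_ ?_ ?_ ?_ ?_ ?_ ?_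
  · intro ε
    refine ((convex_Icc (0 : ℝ) 1).linear_preimage (LinearMap.fst ℝ ℝ _)).inter (Convex.inter ?_ ?_)
    · have := (convex_closedBall (0 : EuclideanSpace ℝ (Fin (n + 1))) 1).linear_preimage
        (LinearMap.snd ℝ ℝ _)
      have heq : {x : ℝ × EuclideanSpace ℝ (Fin (n + 1)) | ‖x.2‖ ≤ 1} =
          LinearMap.snd ℝ ℝ _ ⁻¹' Metric.closedBall 0 1 :=
        Set.ext fun x => mem_closedBall_zero_iff.symm
      exact (congrArg (Convex ℝ) heq).mpr this
    · refine convex_halfSpace_ge (f := fun x : ℝ × EuclideanSpace ℝ (Fin (n + 1)) =>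
        ∑ j : Fin (n + 1), (((ε j : ℤˣ) : ℤ) : ℝ) * x.2 j) ⟨fun x y => ?_, fun c x => ?_⟩ 1
      · simp [mul_add, Finset.sum_add_distrib]
      · simp [Finset.mul_sum, mul_left_comm]
  · rintro ε ⟨t, y⟩ hx ⟨t', y'⟩ hy
    refine max_le ?_ ?_
    · have h1 := hx.1; have h2 := hy.1
      simp only [mem_Icc] at h1 h2
      rw [Real.dist_eq, abs_le]; constructor <;> linarith
    · refine (dist_le_norm_add_norm _ _).trans ?_
      have h1 := hx.2.1; have h2 := hy.2.1
      simp only at h1 h2 ⊢; linarith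
  · exact hmem 0 (by simp)
  · exact hmem 1 (by simp)
  · intro ε x hx i
    simp only [s, hGodd i x (hCK ε hx)]
    have hlex := toLex_neg_pos_iff (hK0 x (hCK ε hx))
    have hlex' : toLex (flip x).2.ofLp = toLex (-x.2).ofLp := rfl
    rw [hlex', hlex]
    rcases lt_trichotomy (G i x) 0 with h | h | h
    · simp [h, h.le, h.ne]
    · by_cases h' : 0 < toLex x.2.ofLp <;> simp [h, h']
      rfl
    · simp [h, h.ne', h.not_gt]
      rfl
  · intro ε x hx
    simp only [r, hpflip x (hCK ε hx), hfeven]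
  · intro ε x hx h
    have : p x = (0, (p x).2) := by simp [p, h]
    simp only [r]
    rw [this, if_pos (hf0 _)]
  · intro ε x hx h
    have : p x = (1, (p x).2) := by simp [p, h]
    simp only [r]
    rw [this, if_neg (hf1 _).not_gt]
  · intro ε l hl
    rcases l with _ | ⟨x, l⟩
    · left; simp
    have hclose : ∀ y ∈ x :: l, dist (f (p y), g (p y)) (f (p x), g (p x)) < η := fun y hy =>
      hδη y (hCK ε (hl.1 y hy)) x (hCK ε (hl.1 x (by simp)))
        ((hl.2 y hy x (by simp)).trans_lt (half_lt_self hδ))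
    have hsign : ∀ a b : ℝ, η ≤ |b| → dist a b < η → (0 < a ↔ 0 < b) ∧ (a < 0 ↔ b < 0) ∧ a ≠ 0 := by
      intro a b hb hab
      rw [Real.dist_eq, abs_lt] at hab
      rcases le_abs.1 hb with h | h
      · exact ⟨⟨fun _ => by linarith, fun _ => by linarith⟩,
          ⟨fun _ => by linarith, fun _ => by linarith⟩, by linarith⟩
      · exact ⟨⟨fun _ => by linarith, fun _ => by linarith⟩,
          ⟨fun _ => by linarith, fun _ => by linarith⟩, by linarith⟩
    rcases le_max_iff.1 (hηle (p x)) with h | h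
    · left
      have : ∀ y ∈ x :: l, r y = r x := fun y hy => by
        have := hsign _ _ h ((le_max_left _ _).trans_lt (hclose y hy))
        simp only [r, this.2.1]
      intro y hy z hz
      rw [this y hy, this z hz]
    · right
      obtain ⟨i, hi⟩ : ∃ i, η ≤ |g (p x) i| := by
        by_contra! hlt
        exact absurd h ((pi_norm_lt_iff hη).2 hlt).not_ge
      refine ⟨i, i.2, ?_⟩
      have : ∀ y ∈ x :: l, s i y = if 0 < g (p x) i then 1 else 0 := fun y hy => by
        have := hsign _ _ hi (((dist_le_pi_dist _ _ i).trans (le_max_right _ _)).trans_lt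
          (hclose y hy))
        simp only [s, G, i.2, dif_pos, Fin.eta, this.1, this.2.2, false_and, or_false]
      intro y hy z hz
      rw [this y hy, this z hz]

/-! ### Weak derivatives on an interval -/

theorem continuous_deriv_smoothTransition : Continuous (deriv Real.smoothTransition) :=
  (Real.smoothTransition.contDiff (n := 1)).continuous_deriv le_rfl

theorem deriv_smoothTransition_of_nonpos {x : ℝ} (hx : x ≤ 0) :
    deriv Real.smoothTransition x = 0 := by
  have : EqOn (deriv Real.smoothTransition) (fun _ => 0) (Iio 0) := by
    intro x hx
    have : Real.smoothTransition =ᶠ[𝓝 x] fun _ => 0 := by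
      filter_upwards [Iio_mem_nhds hx] with y hy using Real.smoothTransition.zero_of_nonpos hy.le
    rw [this.deriv_eq, deriv_const]
  exact this.closure continuous_deriv_smoothTransition continuous_const (by simpa using hx)

theorem deriv_smoothTransition_of_one_lt {x : ℝ} (hx : 1 < x) :
    deriv Real.smoothTransition x = 0 := by
  have : Real.smoothTransition =ᶠ[𝓝 x] fun _ => 1 := by
    filter_upwards [Ioi_mem_nhds hx] with y hy using Real.smoothTransition.one_of_one_le hy.le
  rw [this.deriv_eq, deriv_const]

theorem integral_deriv_smoothTransition : ∫ y in (0 : ℝ)..1, deriv Real.smoothTransition y = 1 := by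
  rw [intervalIntegral.integral_deriv_eq_sub
    (fun x _ => (Real.smoothTransition.contDiff (n := 1)).differentiable one_ne_zero x)
    (continuous_deriv_smoothTransition.intervalIntegrable _ _)]
  simp

/-- The functions `x ↦ n S' (n (x - s))`, with `S` the smooth transition, are an approximation of
the identity at `s`. -/
theorem tendsto_integral_deriv_smoothTransition {u : ℝ → ℝ} {a b s : ℝ} (has : a ≤ s) (hsb : s < b)
    (hu : ContinuousOn u (Icc a b)) :
    Tendsto (fun n : ℕ => ∫ x in a..b, u x * ((n : ℝ) * deriv Real.smoothTransition (n * (x - s))))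
      atTop (𝓝 (u s)) := by
  have hlim : Tendsto (fun n : ℕ => ∫ y in (0 : ℝ)..1,
      u (s + y / n) * deriv Real.smoothTransition y) atTop
      (𝓝 (∫ y in (0 : ℝ)..1, u s * deriv Real.smoothTransition y)) := by
    obtain ⟨M, hM⟩ := isCompact_Icc.exists_bound_of_continuousOn hu
    have hlarge : ∀ᶠ n : ℕ in atTop, 0 < (n : ℝ) ∧ 1 / (n : ℝ) < b - s := by
      refine ((eventually_gt_atTop 0).mono fun n hn => by exact_mod_cast hn).and ?_
      exact tendsto_one_div_atTop_nhds_zero_nat.eventually (gt_mem_nhds (sub_pos.2 hsb))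
    have hin : ∀ n : ℕ, 0 < (n : ℝ) → 1 / (n : ℝ) < b - s → ∀ y ∈ Icc (0 : ℝ) 1,
        s + y / n ∈ Icc a b := by
      intro n hn hnb y hy
      have h1 : 0 ≤ y / n := div_nonneg hy.1 hn.le
      have h2 : y / n ≤ 1 / n := div_le_div_of_nonneg_right hy.2 hn.le
      constructor <;> linarith
    refine intervalIntegral.tendsto_integral_filter_of_dominated_convergence
      (fun y => M * |deriv Real.smoothTransition y|) ?_ ?_ ?_ ?_
    · filter_upwards [hlarge] with n hn
      rw [uIoc_of_le zero_le_one]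
      refine (ContinuousOn.mul (hu.comp (by fun_prop) fun y hy => hin n hn.1 hn.2 y hy)
        continuous_deriv_smoothTransition.continuousOn).aestronglyMeasurable_of_subset_isCompact
          isCompact_Icc measurableSet_Ioc Ioc_subset_Icc_self
    · filter_upwards [hlarge] with n hn
      refine ae_of_all _ fun y hy => ?_
      rw [uIoc_of_le zero_le_one] at hy
      rw [norm_mul, Real.norm_eq_abs (deriv _ _)]
      exact mul_le_mul_of_nonneg_right (hM _ (hin n hn.1 hn.2 y (Ioc_subset_Icc_self hy)))
        (abs_nonneg _)
    · exact (continuous_const.mul continuous_deriv_smoothTransition.abs).intervalIntegrable _ _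
    · refine ae_of_all _ fun y hy => Tendsto.mul_const _ ?_
      rw [uIoc_of_le zero_le_one] at hy
      have h1 : Tendsto (fun n : ℕ => s + y / n) atTop (𝓝 s) := by
        simpa using (tendsto_const_div_atTop_nhds_zero_nat y).const_add s
      have h2 : Tendsto (fun n : ℕ => s + y / n) atTop (𝓝[Icc a b] s) :=
        tendsto_nhdsWithin_iff.2 ⟨h1, hlarge.mono fun n hn =>
          hin n hn.1 hn.2 y (Ioc_subset_Icc_self hy)⟩
      exact (hu s ⟨has, hsb.le⟩).tendsto.comp h2
  rw [intervalIntegral.integral_const_mul, integral_deriv_smoothTransition, mul_one] at hlim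
  refine hlim.congr' ?_
  have hlarge : ∀ᶠ n : ℕ in atTop, 0 < (n : ℝ) ∧ 1 / (n : ℝ) < b - s := by
    refine ((eventually_gt_atTop 0).mono fun n hn => by exact_mod_cast hn).and ?_
    exact tendsto_one_div_atTop_nhds_zero_nat.eventually (gt_mem_nhds (sub_pos.2 hsb))
  filter_upwards [hlarge] with n hn
  have hn0 : (n : ℝ) ≠ 0 := hn.1.ne'
  have hsub := intervalIntegral.integral_comp_div_add
    (f := fun x => u x * ((n : ℝ) * deriv Real.smoothTransition (n * (x - s)))) (a := 0) (b := 1)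
    hn0 s
  have hfun : ∀ y : ℝ, u (s + y / n) * deriv Real.smoothTransition y =
      (n : ℝ)⁻¹ *
        (u (y / n + s) * ((n : ℝ) * deriv Real.smoothTransition (n * (y / n + s - s)))) := by
    intro y
    rw [add_sub_cancel_right, mul_div_cancel₀ _ hn0, add_comm s]
    field_simp
  simp only [hfun]
  rw [intervalIntegral.integral_const_mul, hsub, smul_eq_mul, inv_mul_cancel_left₀ hn0]
  rw [intervalIntegral.integral_of_le (by have := hn.1; simp),
    intervalIntegral.integral_of_le (has.trans hsb.le)]
  refine (setIntegral_eq_of_subset_of_forall_sdiff_eq_zero measurableSet_Ioc ?_ ?_).symm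
  · exact Ioc_subset_Ioc (by simpa using has) (by linarith [hn.2])
  · rintro x ⟨-, hx⟩
    have : deriv Real.smoothTransition (n * (x - s)) = 0 := by
      rw [zero_div, zero_add, mem_Ioc, not_and_or, not_lt, not_le] at hx
      rcases hx with hx | hx
      · exact deriv_smoothTransition_of_nonpos
          (mul_nonpos_of_nonneg_of_nonpos hn.1.le (sub_nonpos.2 hx))
      · refine deriv_smoothTransition_of_one_lt ?_
        rw [← div_lt_iff₀' hn.1]
        linarith
    rw [this, mul_zero, mul_zero]

namespace MetricGraph

theorem IsWeakDeriv.congr {I : Set ℝ} {u v g k : ℝ → ℝ} (h : IsWeakDeriv I u g)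
    (huv : u =ᵐ[volume.restrict I] v) (hgk : g =ᵐ[volume.restrict I] k) : IsWeakDeriv I v k := by
  intro φ h1 h2 h3
  have e1 : ∫ x in I, v x * deriv φ x = ∫ x in I, u x * deriv φ x :=
    integral_congr_ae (by filter_upwards [huv] with x hx; rw [hx])
  have e2 : ∫ x in I, k x * φ x = ∫ x in I, g x * φ x :=
    integral_congr_ae (by filter_upwards [hgk] with x hx; rw [hx])
  rw [e1, e2, h φ h1 h2 h3]

/-- The fundamental theorem of calculus for a continuous function with a weak derivative, between
two interior points: the weak derivative is tested against smooth approximations of the indicator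
function of `[a, b]`. -/
theorem IsWeakDeriv.sub_eq_integral_of_interior {I : Set ℝ} {u g : ℝ → ℝ} (hIm : MeasurableSet I)
    (h : IsWeakDeriv I u g) {a b c : ℝ} (hab : a ≤ b) (hbc : b < c) (hI : Icc a c ⊆ interior I)
    (hu : ContinuousOn u (Icc a c)) (hg : IntegrableOn g (Icc a c)) :
    u b - u a = ∫ x in a..b, g x := by
  have hac : a < c := hab.trans_lt hbc
  set S := Real.smoothTransition with hS
  have hSd : ContDiff ℝ ∞ S := Real.smoothTransition.contDiff
  let φ : ℕ → ℝ → ℝ := fun n x => S (n * (x - a)) - S (n * (x - b))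
  have hφd : ∀ n, ContDiff ℝ ∞ (φ n) := fun n =>
    (hSd.comp (by fun_prop)).sub (hSd.comp (by fun_prop))
  have hderiv : ∀ (n : ℕ) x, deriv (φ n) x =
      n * deriv S (n * (x - a)) - n * deriv S (n * (x - b)) := by
    intro n x
    have hS' : ∀ y, HasDerivAt S (deriv S y) y := fun y =>
      (hSd.differentiable (by simp) y).hasDerivAt
    have hl : ∀ s : ℝ, HasDerivAt (fun x : ℝ => (n : ℝ) * (x - s)) (n : ℝ) x := fun s => by
      simpa using ((hasDerivAt_id x).sub_const s).const_mul (n : ℝ)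
    have := ((hS' _).comp x (hl a)).sub ((hS' _).comp x (hl b))
    rw [show deriv (φ n) x = _ from this.deriv]
    ring
  have hlarge : ∀ᶠ n : ℕ in atTop, 0 < (n : ℝ) ∧ 1 / (n : ℝ) < c - b := by
    refine ((eventually_gt_atTop 0).mono fun n hn => by exact_mod_cast hn).and ?_
    exact tendsto_one_div_atTop_nhds_zero_nat.eventually (gt_mem_nhds (sub_pos.2 hbc))
  have hsupp : ∀ n : ℕ, 0 < (n : ℝ) → 1 / (n : ℝ) < c - b → ∀ x ∉ Icc a c, φ n x = 0 := by
    intro n hn hnc x hx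
    rw [mem_Icc, not_and_or, not_le, not_le] at hx
    rcases hx with hx | hx
    · simp only [φ]
      rw [hS, Real.smoothTransition.zero_of_nonpos, Real.smoothTransition.zero_of_nonpos, sub_zero]
      · exact mul_nonpos_of_nonneg_of_nonpos hn.le (by linarith)
      · exact mul_nonpos_of_nonneg_of_nonpos hn.le (by linarith)
    · have key : ∀ s ≤ b, 1 ≤ n * (x - s) := fun s hs => by
        rw [← div_le_iff₀' hn]; linarith
      simp only [φ]
      rw [hS, Real.smoothTransition.one_of_one_le (key a hab),
        Real.smoothTransition.one_of_one_le (key b le_rfl), sub_self]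
  -- the identity defining the weak derivative, tested against `φ n`
  have hid : ∀ᶠ n : ℕ in atTop,
      (∫ x in a..c, u x * (n * deriv S (n * (x - a)))) -
        (∫ x in a..c, u x * (n * deriv S (n * (x - b)))) = - ∫ x in Icc a c, g x * φ n x := by
    filter_upwards [hlarge] with n hn
    have hsub : Function.support (φ n) ⊆ Icc a c := fun x hx => by
      by_contra hx'
      exact hx (hsupp n hn.1 hn.2 x hx')
    have hts : tsupport (φ n) ⊆ Icc a c := closure_minimal hsub isClosed_Icc
    have hw := h (φ n) (hφd n) (HasCompactSupport.of_support_subset_isCompact isCompact_Icc hsub)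
      (hts.trans hI)
    have hII : Icc a c ⊆ I := hI.trans interior_subset
    rw [setIntegral_eq_of_subset_of_forall_sdiff_eq_zero hIm hII fun x hx => by
        rw [Function.notMem_support.1 fun hm => hx.2 (hts (support_deriv_subset hm)), mul_zero],
      setIntegral_eq_of_subset_of_forall_sdiff_eq_zero hIm hII fun x hx => by
        rw [hsupp n hn.1 hn.2 x hx.2, mul_zero]] at hw
    rw [← hw, ← intervalIntegral.integral_sub, integral_Icc_eq_integral_Ioc,
      intervalIntegral.integral_of_le hac.le]
    · simp only [hderiv, mul_sub]
    · refine ContinuousOn.intervalIntegrable_of_Icc hac.le (hu.mul ?_)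
      exact (continuous_const.mul
        (continuous_deriv_smoothTransition.comp (by fun_prop))).continuousOn
    · refine ContinuousOn.intervalIntegrable_of_Icc hac.le (hu.mul ?_)
      exact (continuous_const.mul
        (continuous_deriv_smoothTransition.comp (by fun_prop))).continuousOn
  have hlim1 := (tendsto_integral_deriv_smoothTransition le_rfl hac hu).sub
    (tendsto_integral_deriv_smoothTransition hab hbc hu)
  have hlim2 : Tendsto (fun n : ℕ => - ∫ x in Icc a c, g x * φ n x) atTop
      (𝓝 (-∫ x in Icc a c, (Ioc a b).indicator g x)) := by
    refine Tendsto.neg (tendsto_integral_of_dominated_convergence (fun x => |g x|) ?_ ?_ ?_ ?_)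
    · exact fun n => hg.aestronglyMeasurable.mul (hφd n).continuous.aestronglyMeasurable
    · exact hg.abs
    · intro n
      refine ae_of_all _ fun x => ?_
      rw [norm_mul]
      refine mul_le_of_le_one_right (norm_nonneg _) ?_
      rw [Real.norm_eq_abs, abs_le]
      have h1 := Real.smoothTransition.nonneg (n * (x - a))
      have h2 := Real.smoothTransition.nonneg (n * (x - b))
      have h3 := Real.smoothTransition.le_one (n * (x - a))
      have h4 := Real.smoothTransition.le_one (n * (x - b))
      simp only [φ, hS]
      constructor <;> linarith
    · refine (ae_restrict_iff' measurableSet_Icc).2 (ae_of_all _ fun x hx => ?_)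
      have hev : ∀ s, s < x → ∀ᶠ n : ℕ in atTop, S (n * (x - s)) = 1 := fun s hs => by
        have := tendsto_one_div_atTop_nhds_zero_nat.eventually (gt_mem_nhds (sub_pos.2 hs))
        filter_upwards [hlarge, this] with n hn hn2
        refine Real.smoothTransition.one_of_one_le ?_
        rw [← div_le_iff₀' hn.1]
        exact hn2.le
      have hev0 : ∀ s, x ≤ s → ∀ n : ℕ, S (n * (x - s)) = 0 := fun s hs n =>
        Real.smoothTransition.zero_of_nonpos
          (mul_nonpos_of_nonneg_of_nonpos (Nat.cast_nonneg n) (sub_nonpos.2 hs))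
      refine tendsto_const_nhds.congr' ?_
      rcases le_or_gt x a with hxa | hxa
      · refine Eventually.of_forall fun n => ?_
        simp only [φ]
        rw [hev0 a hxa, hev0 b (hxa.trans hab), indicator_of_notMem (fun hm => hm.1.not_ge hxa)]
        simp
      · rcases le_or_gt x b with hxb | hxb
        · filter_upwards [hev a hxa] with n hn
          simp only [φ]
          rw [hn, hev0 b hxb, indicator_of_mem (show x ∈ Ioc a b from ⟨hxa, hxb⟩)]
          simp
        · filter_upwards [hev a hxa, hev b hxb] with n hn hn'
          simp only [φ]
          rw [hn, hn', indicator_of_notMem (fun hm => hm.2.not_gt hxb)]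
          simp
  have huniq := tendsto_nhds_unique (hlim1.congr' hid) hlim2
  rw [setIntegral_indicator measurableSet_Ioc, inter_eq_right.2
    (Ioc_subset_Icc_self.trans (Icc_subset_Icc_right hbc.le))] at huniq
  rw [intervalIntegral.integral_of_le hab]
  linarith

/-- The fundamental theorem of calculus for a continuous function with a weak derivative. -/
theorem IsWeakDeriv.sub_eq_integral {I : Set ℝ} {u g : ℝ → ℝ} (hIm : MeasurableSet I)
    (h : IsWeakDeriv I u g) {a b : ℝ} (hab : a ≤ b) (hI : Icc a b ⊆ I)
    (hu : ContinuousOn u (Icc a b)) (hg : IntegrableOn g (Icc a b)) :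
    u b - u a = ∫ x in a..b, g x := by
  rcases hab.eq_or_lt with rfl | hab'
  · simp
  have hint : Ioo a b ⊆ interior I := by
    rw [← interior_Icc]; exact interior_mono hI
  obtain ⟨c, hc⟩ := exists_between hab'
  have hgi : ∀ x ∈ Icc a b, ∀ y ∈ Icc a b, IntervalIntegrable g volume x y := fun x hx y hy =>
    (hg.mono_set (uIcc_subset_Icc hx hy)).intervalIntegrable
  have hc' : c ∈ Icc a b := Ioo_subset_Icc_self hc
  -- the two sides agree in the interior, and both are continuous up to the end points
  have key : ∀ x y, a < x → x ≤ y → y < b → u y - u x = ∫ t in x..y, g t := by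
    intro x y hx hxy hy
    obtain ⟨z, hz⟩ := exists_between hy
    have hsub : Icc x z ⊆ Icc a b := Icc_subset_Icc hx.le hz.2.le
    exact h.sub_eq_integral_of_interior hIm hxy hz.1
      (fun t ht => hint ⟨hx.trans_le ht.1, ht.2.trans_lt hz.2⟩) (hu.mono hsub) (hg.mono_set hsub)
  have hcont : ContinuousOn (fun x => ∫ t in c..x, g t) (Icc a b) := by
    have := intervalIntegral.continuousOn_primitive_interval' (hgi a (left_mem_Icc.2 hab) b
      (right_mem_Icc.2 hab)) (a := c) (by rwa [uIcc_of_le hab])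
    rwa [uIcc_of_le hab] at this
  have heq : EqOn u (fun x => u c + ∫ t in c..x, g t) (Ioo a b) := by
    intro x hx
    rcases le_total c x with hcx | hcx
    · have := key c x hc.1 hcx hx.2
      simp only; linarith
    · have := key x c hx.1 hcx hc.2
      simp only [intervalIntegral.integral_symm x c]; linarith
  have heq' : EqOn u (fun x => u c + ∫ t in c..x, g t) (Icc a b) :=
    heq.of_subset_closure hu (continuousOn_const.add hcont) Ioo_subset_Icc_self
      (closure_Ioo hab'.ne).ge
  rw [heq' (right_mem_Icc.2 hab), heq' (left_mem_Icc.2 hab),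
    ← intervalIntegral.integral_interval_sub_left (hgi c hc' b (right_mem_Icc.2 hab))
      (hgi c hc' a (left_mem_Icc.2 hab))]
  ring

theorem abs_integral_le_sqrt_mul_norm {I : Set ℝ} (u : Lp ℝ 2 (volume.restrict I)) {a b : ℝ}
    (hab : a ≤ b) (hI : Icc a b ⊆ I) : |∫ x in a..b, u x| ≤ √(b - a) * ‖u‖ := by
  have hμ : (volume.restrict I).restrict (Icc a b) = volume.restrict (Icc a b) := by
    rw [Measure.restrict_restrict measurableSet_Icc, inter_eq_left.2 hI]
  have hfin : (volume.restrict I) (Icc a b) ≠ ⊤ := by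
    rw [Measure.restrict_apply measurableSet_Icc, inter_eq_left.2 hI]
    exact isCompact_Icc.measure_lt_top.ne
  have h1 := L2.inner_indicatorConstLp_one (𝕜 := ℝ) measurableSet_Icc hfin u
  rw [hμ, integral_Icc_eq_integral_Ioc, ← intervalIntegral.integral_of_le hab] at h1
  rw [← h1, ← Real.norm_eq_abs]
  refine (norm_inner_le_norm _ _).trans (le_of_eq ?_)
  rw [norm_indicatorConstLp two_ne_zero ENNReal.ofNat_ne_top, measureReal_def,
    Measure.restrict_apply measurableSet_Icc, inter_eq_left.2 hI, Real.volume_Icc,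
    ENNReal.toReal_ofReal (sub_nonneg.2 hab), norm_one, one_mul, Real.sqrt_eq_rpow]
  simp

theorem integrableOn_Icc_of_Lp {I : Set ℝ} (u : Lp ℝ 2 (volume.restrict I)) {a b : ℝ}
    (hI : Icc a b ⊆ I) : IntegrableOn u (Icc a b) := by
  have h : MemLp u 2 (volume.restrict (Icc a b)) :=
    (Lp.memLp u).mono_measure (Measure.restrict_mono hI le_rfl)
  exact h.integrable (by norm_num)

theorem ae_eq_restrict_of_subset {I J : Set ℝ} {u v : ℝ → ℝ} (h : u =ᵐ[volume.restrict I] v)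
    (hJ : J ⊆ I) : u =ᵐ[volume.restrict J] v :=
  ae_mono (Measure.restrict_mono hJ le_rfl) h

/-- The oscillation of an `H¹` function on an interval is controlled by the `L²` norm of its
derivative. -/
theorem abs_sub_le_sqrt_mul_norm {I : Set ℝ} (hIm : MeasurableSet I)
    {u g : Lp ℝ 2 (volume.restrict I)} {f : ℝ → ℝ} (h : IsWeakDeriv I u g)
    (huf : u =ᵐ[volume.restrict I] f) (hf : ContinuousOn f I) {a b x y : ℝ} (hI : Icc a b ⊆ I)
    (hx : x ∈ Icc a b) (hy : y ∈ Icc a b) : |f x - f y| ≤ √(b - a) * ‖g‖ := by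
  wlog hxy : y ≤ x generalizing x y
  · rw [abs_sub_comm]; exact this hy hx (le_of_not_ge hxy)
  have hsub : Icc y x ⊆ I := (Icc_subset_Icc hy.1 hx.2).trans hI
  rw [(h.congr huf (ae_eq_refl _)).sub_eq_integral hIm hxy hsub (hf.mono hsub)
    (integrableOn_Icc_of_Lp g hsub)]
  refine (abs_integral_le_sqrt_mul_norm g hxy hsub).trans ?_
  gcongr
  · exact hx.2
  · exact hy.1

/-- The one-dimensional Sobolev inequality on an interval. -/
theorem abs_le_of_isWeakDeriv {I : Set ℝ} (hIm : MeasurableSet I)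
    {u g : Lp ℝ 2 (volume.restrict I)} {f : ℝ → ℝ} (h : IsWeakDeriv I u g)
    (huf : u =ᵐ[volume.restrict I] f) (hf : ContinuousOn f I) {a b x : ℝ} (hab : a < b)
    (hI : Icc a b ⊆ I) (hx : x ∈ Icc a b) :
    |f x| ≤ √(b - a) / (b - a) * ‖u‖ + √(b - a) * ‖g‖ := by
  have hpos : 0 < b - a := sub_pos.2 hab
  have hfi : IntervalIntegrable f volume a b :=
    (hf.mono hI).intervalIntegrable_of_Icc hab.le
  have h1 : (b - a) * f x = (∫ y in a..b, f y) + ∫ y in a..b, (f x - f y) := by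
    rw [intervalIntegral.integral_sub intervalIntegrable_const hfi,
      intervalIntegral.integral_const, smul_eq_mul]
    ring
  have h2 : |∫ y in a..b, f y| ≤ √(b - a) * ‖u‖ := by
    have : ∫ y in a..b, f y = ∫ y in a..b, u y := by
      rw [intervalIntegral.integral_of_le hab.le, intervalIntegral.integral_of_le hab.le]
      exact integral_congr_ae (ae_eq_restrict_of_subset huf.symm (Ioc_subset_Icc_self.trans hI))
    rw [this]
    exact abs_integral_le_sqrt_mul_norm u hab.le hI
  have h3 : |∫ y in a..b, (f x - f y)| ≤ √(b - a) * ‖g‖ * (b - a) := by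
    have := intervalIntegral.norm_integral_le_of_norm_le_const (a := a) (b := b)
      (f := fun y => f x - f y) (C := √(b - a) * ‖g‖) fun y hy => by
        rw [uIoc_of_le hab.le] at hy
        exact abs_sub_le_sqrt_mul_norm hIm h huf hf hI hx (Ioc_subset_Icc_self hy)
    rwa [abs_of_pos hpos] at this
  have h4 : (b - a) * |f x| ≤ √(b - a) * ‖u‖ + √(b - a) * ‖g‖ * (b - a) := by
    rw [← abs_of_pos hpos, ← abs_mul, abs_of_pos hpos, h1]
    exact (abs_add_le _ _).trans (add_le_add h2 h3)
  rw [← mul_le_mul_iff_right₀ hpos]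
  refine h4.trans_eq ?_
  field_simp

end MetricGraph

namespace MetricGraph

variable {V B R : Type*}

/-! ### Edges and test functions -/

theorem measurableSet_interval (G : MetricGraph V B R) (e : B ⊕ R) :
    MeasurableSet (G.interval e) := by
  rcases e with e | e
  · exact measurableSet_Icc
  · exact measurableSet_Ici

theorem exists_Icc_subset_interval (G : MetricGraph V B R) (e : B ⊕ R) :
    ∃ δ > 0, ∀ x ∈ G.interval e, ∃ a, Icc a (a + δ) ⊆ G.interval e ∧ x ∈ Icc a (a + δ) := by
  rcases e with e | e
  · exact ⟨G.len e, G.len_pos e, fun x hx => ⟨0, by simp [interval], by simpa [interval] using hx⟩⟩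
  · exact ⟨1, one_pos, fun x hx => ⟨x, fun y hy => le_trans hx hy.1, by simp⟩⟩

theorem zero_mem_interval (G : MetricGraph V B R) (e : B ⊕ R) : (0 : ℝ) ∈ G.interval e := by
  rcases e with e | e
  · exact left_mem_Icc.2 (G.len_pos e).le
  · exact self_mem_Ici

theorem len_mem_interval (G : MetricGraph V B R) (e : B) : G.len e ∈ G.interval (.inl e) :=
  right_mem_Icc.2 (G.len_pos e).le

theorem restrict_interior_interval (G : MetricGraph V B R) (e : B ⊕ R) :
    volume.restrict (interior (G.interval e)) = G.edgeMeasure e := by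
  rcases e with e | e
  · simp only [edgeMeasure, interval, interior_Icc]
    exact Measure.restrict_congr_set Ioo_ae_eq_Icc
  · simp only [edgeMeasure, interval, interior_Ici]
    exact Measure.restrict_congr_set Ioi_ae_eq_Ici

/-- The smooth functions with compact support in the interior of the edge `e`. -/
def testFunctions (G : MetricGraph V B R) (e : B ⊕ R) : Submodule ℝ (ℝ → ℝ) where
  carrier := {φ | ContDiff ℝ ∞ φ ∧ HasCompactSupport φ ∧ tsupport φ ⊆ interior (G.interval e)}
  zero_mem' := ⟨contDiff_const, HasCompactSupport.zero, by simp [tsupport]⟩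
  add_mem' := fun {φ ψ} hφ hψ => ⟨hφ.1.add hψ.1, hφ.2.1.add hψ.2.1,
    (tsupport_add φ ψ).trans (union_subset hφ.2.2 hψ.2.2)⟩
  smul_mem' := fun c φ hφ => ⟨contDiff_const.smul hφ.1, hφ.2.1.smul_left,
    (closure_mono (Function.support_const_smul_subset c φ)).trans hφ.2.2⟩

theorem memLp_of_mem_testFunctions {G : MetricGraph V B R} {e : B ⊕ R} {φ : ℝ → ℝ}
    (h : φ ∈ G.testFunctions e) : MemLp φ 2 (G.edgeMeasure e) :=
  h.1.continuous.memLp_of_hasCompactSupport h.2.1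

theorem memLp_deriv_of_mem_testFunctions {G : MetricGraph V B R} {e : B ⊕ R} {φ : ℝ → ℝ}
    (h : φ ∈ G.testFunctions e) : MemLp (deriv φ) 2 (G.edgeMeasure e) :=
  (h.1.continuous_deriv (by simp)).memLp_of_hasCompactSupport h.2.1.deriv

theorem setIntegral_interval_eq (G : MetricGraph V B R) (e : B ⊕ R) {f : ℝ → ℝ}
    (h : ∀ x ∉ G.interval e, f x = 0) : ∫ x in G.interval e, f x = ∫ x, f x :=
  setIntegral_eq_integral_of_forall_compl_eq_zero h

theorem isWeakDeriv_deriv_of_mem_testFunctions {G : MetricGraph V B R} {e : B ⊕ R} {φ : ℝ → ℝ}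
    (h : φ ∈ G.testFunctions e) : IsWeakDeriv (G.interval e) φ (deriv φ) := by
  intro ψ h1 h2 h3
  have hφ0 : ∀ x ∉ G.interval e, φ x = 0 := fun x hx =>
    image_eq_zero_of_notMem_tsupport fun hx' => hx (interior_subset (h.2.2 hx'))
  have hψ0 : ∀ x ∉ G.interval e, ψ x = 0 := fun x hx =>
    image_eq_zero_of_notMem_tsupport fun hx' => hx (interior_subset (h3 hx'))
  rw [G.setIntegral_interval_eq e fun x hx => by rw [hφ0 x hx, zero_mul],
    G.setIntegral_interval_eq e fun x hx => by rw [hψ0 x hx, mul_zero]]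
  have hφ' := h.1.continuous_deriv (n := ∞) (by simp)
  have hψ' := h1.continuous_deriv (n := ∞) (by simp)
  refine integral_mul_deriv_eq_deriv_mul_of_integrable
    (fun x _ => (h.1.differentiable (by simp) x).hasDerivAt)
    (fun x _ => (h1.differentiable (by simp) x).hasDerivAt) ?_ ?_ ?_
  · exact (h.1.continuous.mul hψ').integrable_of_hasCompactSupport (h.2.1.mul_right)
  · exact (hφ'.mul h1.continuous).integrable_of_hasCompactSupport (h2.mul_left)
  · exact (h.1.continuous.mul h1.continuous).integrable_of_hasCompactSupport (h.2.1.mul_right)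

/-- A test function on an edge, as an element of `L²`. -/
noncomputable def testLp (G : MetricGraph V B R) (e : B ⊕ R) :
    G.testFunctions e →ₗ[ℝ] Lp ℝ 2 (G.edgeMeasure e) where
  toFun φ := (memLp_of_mem_testFunctions φ.2).toLp _
  map_add' _ _ := rfl
  map_smul' _ _ := rfl

/-- The derivative of a test function on an edge, as an element of `L²`. -/
noncomputable def testDerivLp (G : MetricGraph V B R) (e : B ⊕ R) :
    G.testFunctions e →ₗ[ℝ] Lp ℝ 2 (G.edgeMeasure e) where
  toFun φ := (memLp_deriv_of_mem_testFunctions φ.2).toLp _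
  map_add' φ ψ := by
    rw [← MemLp.toLp_add]
    refine MemLp.toLp_congr _ _ (ae_of_all _ fun x => ?_)
    exact deriv_add (φ.2.1.differentiable (by simp) x) (ψ.2.1.differentiable (by simp) x)
  map_smul' c φ := by
    rw [RingHom.id_apply, ← MemLp.toLp_const_smul]
    refine MemLp.toLp_congr _ _ (ae_of_all _ fun x => ?_)
    exact deriv_const_smul c (φ.2.1.differentiable (by simp) x)

theorem coeFn_testLp (G : MetricGraph V B R) {e : B ⊕ R} (φ : G.testFunctions e) :
    G.testLp e φ =ᵐ[G.edgeMeasure e] φ.1 :=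
  MemLp.coeFn_toLp (memLp_of_mem_testFunctions φ.2)

theorem coeFn_testDerivLp (G : MetricGraph V B R) {e : B ⊕ R} (φ : G.testFunctions e) :
    G.testDerivLp e φ =ᵐ[G.edgeMeasure e] deriv φ.1 :=
  MemLp.coeFn_toLp (memLp_deriv_of_mem_testFunctions φ.2)

theorem zero_notMem_interior_interval (G : MetricGraph V B R) (e : B ⊕ R) :
    (0 : ℝ) ∉ interior (G.interval e) := by
  rcases e with e | e <;> simp [interval]

theorem len_notMem_interior_interval (G : MetricGraph V B R) (e : B) :
    G.len e ∉ interior (G.interval (.inl e)) := by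
  simp [interval]

theorem isWeakDeriv_zero {I : Set ℝ} : IsWeakDeriv I (0 : Lp ℝ 2 (volume.restrict I))
    (0 : Lp ℝ 2 (volume.restrict I)) := by
  have h : IsWeakDeriv I (fun _ => 0) (fun _ => 0) := fun φ _ _ _ => by simp
  exact h.congr (Lp.coeFn_zero ℝ 2 _).symm (Lp.coeFn_zero ℝ 2 _).symm

/-- An element of `L²` of an edge is determined by its integrals against test functions. -/
theorem eq_zero_of_forall_test (G : MetricGraph V B R) {e : B ⊕ R} {g : Lp ℝ 2 (G.edgeMeasure e)}
    (h : ∀ φ : ℝ → ℝ, ContDiff ℝ ∞ φ → HasCompactSupport φ →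
      tsupport φ ⊆ interior (G.interval e) → ∫ x in G.interval e, g x * φ x = 0) : g = 0 := by
  have hloc : LocallyIntegrable g (G.edgeMeasure e) := (Lp.memLp g).locallyIntegrable (by norm_num)
  have h2 := isOpen_interior.ae_eq_zero_of_integral_contDiff_smul_eq_zero (μ := G.edgeMeasure e)
    (f := g) (U := interior (G.interval e)) (hloc.locallyIntegrableOn _) fun φ h1 h2 h3 => by
      rw [← h φ h1 h2 h3]
      exact integral_congr_ae (ae_of_all _ fun x => by simp [mul_comm])
  have hint : ∀ᵐ x ∂G.edgeMeasure e, x ∈ interior (G.interval e) := by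
    rw [← G.restrict_interior_interval e]
    exact ae_restrict_mem isOpen_interior.measurableSet
  rw [Lp.eq_zero_iff_ae_eq_zero]
  filter_upwards [h2, hint] with x h3 h4
  exact h3 h4

open Classical in
/-- The inclusion of `L²(e)` in `L²(G)`. -/
noncomputable def edgeL2 (G : MetricGraph V B R) (e : B ⊕ R) :
    Lp ℝ 2 (G.edgeMeasure e) →ₗ[ℝ] G.L2 :=
  (WithLp.linearEquiv 2 ℝ _).symm.toLinearMap ∘ₗ
    LinearMap.single ℝ (fun e => Lp ℝ 2 (G.edgeMeasure e)) e

@[simp] theorem edgeL2_same (G : MetricGraph V B R) (e : B ⊕ R) (u : Lp ℝ 2 (G.edgeMeasure e)) :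
    G.edgeL2 e u e = u := by
  simp [edgeL2]

theorem edgeL2_of_ne (G : MetricGraph V B R) {e e' : B ⊕ R} (h : e' ≠ e)
    (u : Lp ℝ 2 (G.edgeMeasure e)) : G.edgeL2 e u e' = 0 := by
  simp [edgeL2, h]

variable [Fintype B] [Fintype R]

/-! ### Completeness of the Sobolev space of a metric graph -/

theorem exists_forall_abs_le_mul_norm (G : MetricGraph V B R) (e : B ⊕ R) :
    ∃ C > 0, ∀ w ∈ G.sobolevPairs, ∀ f : ℝ → ℝ, ContinuousOn f (G.interval e) →
      w.fst e =ᵐ[G.edgeMeasure e] f → ∀ x ∈ G.interval e, |f x| ≤ C * ‖w‖ := by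
  obtain ⟨δ, hδ, h⟩ := G.exists_Icc_subset_interval e
  refine ⟨√δ / δ + √δ, by positivity, fun w hw f hf hwf x hx => ?_⟩
  obtain ⟨a, ha, hxa⟩ := h x hx
  have := abs_le_of_isWeakDeriv (G.measurableSet_interval e) (hw.2 e) hwf hf
    (lt_add_of_pos_right a hδ) ha hxa
  rw [add_sub_cancel_left] at this
  refine this.trans ?_
  have h1 : ‖w.fst e‖ ≤ ‖w‖ := (PiLp.norm_apply_le _ e).trans (WithLp.norm_fst_le _ w)
  have h2 : ‖w.snd e‖ ≤ ‖w‖ := (PiLp.norm_apply_le _ e).trans (WithLp.norm_snd_le _ w)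
  rw [add_mul]
  gcongr

theorem tendsto_integral_mul_of_tendsto_Lp {I : Set ℝ} {u : ℕ → Lp ℝ 2 (volume.restrict I)}
    {v : Lp ℝ 2 (volume.restrict I)} (h : Tendsto u atTop (𝓝 v)) {ψ : ℝ → ℝ}
    (hc : Continuous ψ) (hs : HasCompactSupport ψ) :
    Tendsto (fun n => ∫ x in I, u n x * ψ x) atTop (𝓝 (∫ x in I, v x * ψ x)) := by
  have hm : MemLp ψ 2 (volume.restrict I) := hc.memLp_of_hasCompactSupport hs
  have key : ∀ w : Lp ℝ 2 (volume.restrict I), ∫ x in I, w x * ψ x = inner ℝ (hm.toLp ψ) w := by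
    intro w
    rw [L2.inner_def]
    refine integral_congr_ae ?_
    filter_upwards [hm.coeFn_toLp] with x hx
    rw [hx]
    simp
  simp only [key]
  exact (continuous_const.inner continuous_id).continuousAt.tendsto.comp h

theorem isClosed_sobolevPairs (G : MetricGraph V B R) :
    IsClosed (G.sobolevPairs : Set (WithLp 2 (G.L2 × G.L2))) := by
  refine IsSeqClosed.isClosed fun w z hw hz => ?_
  choose f hf hwf using fun n => (hw n).1
  choose c hc hc' using fun n => (hf n).2
  have hfst : ∀ e, Tendsto (fun n => (w n).fst e) atTop (𝓝 (z.fst e)) := fun e =>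
    (((PiLp.proj 2 _ e : G.L2 →L[ℝ] Lp ℝ 2 (G.edgeMeasure e)).comp
      (WithLp.fstL 2 ℝ G.L2 G.L2)).continuous.tendsto z).comp hz
  have hsnd : ∀ e, Tendsto (fun n => (w n).snd e) atTop (𝓝 (z.snd e)) := fun e =>
    (((PiLp.proj 2 _ e : G.L2 →L[ℝ] Lp ℝ 2 (G.edgeMeasure e)).comp
      (WithLp.sndL 2 ℝ G.L2 G.L2)).continuous.tendsto z).comp hz
  refine ⟨?_, fun e φ h1 h2 h3 => ?_⟩
  swap
  · refine tendsto_nhds_unique (tendsto_integral_mul_of_tendsto_Lp (hfst e)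
      (h1.continuous_deriv (by simp)) h2.deriv) ?_
    refine (tendsto_integral_mul_of_tendsto_Lp (hsnd e) h1.continuous h2).neg.congr fun n => ?_
    exact ((hw n).2 e φ h1 h2 h3).symm
  -- the continuous representatives converge uniformly on every edge
  have hunif : ∀ e, UniformCauchySeqOn (fun n => f n e) atTop (G.interval e) := by
    intro e
    obtain ⟨C, hC, hb⟩ := G.exists_forall_abs_le_mul_norm e
    rw [Metric.uniformCauchySeqOn_iff]
    intro ε hε
    obtain ⟨N, hN⟩ := Metric.cauchySeq_iff.1 hz.cauchySeq (ε / C) (by positivity)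
    refine ⟨N, fun m hm n hn x hx => ?_⟩
    have hae : (w m - w n).fst e =ᵐ[G.edgeMeasure e] fun x => f m e x - f n e x := by
      change ⇑((w m).fst e - (w n).fst e) =ᵐ[_] _
      filter_upwards [Lp.coeFn_sub ((w m).fst e) ((w n).fst e), hwf m e, hwf n e] with x h1 h2 h3
      rw [h1, Pi.sub_apply, h2, h3]
    have := hb _ (G.sobolevPairs.sub_mem (hw m) (hw n)) _ (((hf m).1 e).sub ((hf n).1 e)) hae x hx
    rw [Real.dist_eq]
    refine this.trans_lt ?_
    rw [← dist_eq_norm, ← lt_div_iff₀' hC]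
    exact hN m hm n hn
  have hpt : ∀ e x, ∃ y, x ∈ G.interval e → Tendsto (fun n => f n e x) atTop (𝓝 y) := by
    intro e x
    by_cases hx : x ∈ G.interval e
    · obtain ⟨y, hy⟩ := cauchySeq_tendsto_of_complete ((hunif e).cauchySeq hx)
      exact ⟨y, fun _ => hy⟩
    · exact ⟨0, fun h => absurd h hx⟩
  choose F hF using hpt
  have hcv : ∀ v, ∃ y, Tendsto (fun n => c n v) atTop (𝓝 y) := by
    intro v
    rcases G.incident v with ⟨e, rfl | rfl⟩ | ⟨e, rfl⟩
    · exact ⟨_, (hF (.inl e) 0 (G.zero_mem_interval _)).congr fun n => (hc n e).1⟩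
    · exact ⟨_, (hF (.inl e) _ (G.len_mem_interval e)).congr fun n => (hc n e).2⟩
    · exact ⟨_, (hF (.inr e) 0 (G.zero_mem_interval _)).congr fun n => hc' n e⟩
  choose d hd using hcv
  refine ⟨F, ⟨fun e => ?_, d, fun e => ⟨?_, ?_⟩, fun e => ?_⟩, fun e => ?_⟩
  · exact ((hunif e).tendstoUniformlyOn_of_tendsto (hF e)).continuousOn
      (Frequently.of_forall fun n => (hf n).1 e)
  · exact tendsto_nhds_unique (hF (.inl e) 0 (G.zero_mem_interval _))
      ((hd _).congr fun n => (hc n e).1.symm)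
  · exact tendsto_nhds_unique (hF (.inl e) _ (G.len_mem_interval e))
      ((hd _).congr fun n => (hc n e).2.symm)
  · exact tendsto_nhds_unique (hF (.inr e) 0 (G.zero_mem_interval _))
      ((hd _).congr fun n => (hc' n e).symm)
  · obtain ⟨ns, hns, hae⟩ := (tendstoInMeasure_of_tendsto_Lp (hfst e)).exists_seq_tendsto_ae
    filter_upwards [hae, ae_all_iff.2 fun n => hwf n e,
      ae_restrict_mem (G.measurableSet_interval e)] with x h1 h2 h3
    refine tendsto_nhds_unique h1 ?_
    simp only [h2]
    exact (hF e x h3).comp hns.tendsto_atTop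

instance (G : MetricGraph V B R) : CompleteSpace G.H1 :=
  G.isClosed_sobolevPairs.completeSpace_coe

theorem toL2_injective (G : MetricGraph V B R) : Function.Injective G.toL2 := by
  rw [injective_iff_map_eq_zero]
  intro u hu
  have h1 : u.1.fst = 0 := hu
  have h2 : u.1.snd = 0 := by
    ext1 e
    refine G.eq_zero_of_forall_test fun φ hφ hc hs => ?_
    have := u.2.2 e φ hφ hc hs
    rw [h1] at this
    have h0 : ∫ x in G.interval e, (0 : G.L2) e x * deriv φ x = 0 := by
      refine integral_eq_zero_of_ae ?_
      filter_upwards [Lp.coeFn_zero ℝ 2 (G.edgeMeasure e)] with x hx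
      change (0 : Lp ℝ 2 (G.edgeMeasure e)) x * _ = 0
      rw [hx]; simp
    rw [h0] at this
    linarith
  refine Subtype.ext ?_
  change u.1 = 0
  apply (WithLp.equiv 2 _).injective
  exact Prod.ext h1 h2

theorem norm_sq_eq (G : MetricGraph V B R) (u : G.H1) :
    ‖u‖ ^ 2 = ‖G.toL2 u‖ ^ 2 + ‖G.derivL2 u‖ ^ 2 :=
  WithLp.prod_norm_sq_eq_of_L2 u.1

theorem norm_toL2_le (G : MetricGraph V B R) : ‖G.toL2‖ ≤ 1 :=
  G.toL2.opNorm_le_bound zero_le_one fun u => by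
    rw [one_mul]
    exact WithLp.norm_fst_le _ u.1

/-! ### Elements of the Sobolev space supported on one edge -/

theorem norm_edgeL2_sq (G : MetricGraph V B R) (e : B ⊕ R) (u : Lp ℝ 2 (G.edgeMeasure e)) :
    ‖G.edgeL2 e u‖ ^ 2 = ‖u‖ ^ 2 := by
  rw [PiLp.norm_sq_eq_of_L2, Finset.sum_eq_single e]
  · rw [edgeL2_same]
  · intro e' _ h
    rw [G.edgeL2_of_ne h, norm_zero, zero_pow two_ne_zero]
  · simp

/-- The element of `H¹(G)` equal to a test function on the edge `e` and to zero on the other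
edges. -/
noncomputable def ofTest (G : MetricGraph V B R) (e : B ⊕ R) : G.testFunctions e →ₗ[ℝ] G.H1 :=
  LinearMap.codRestrict G.sobolevPairs
    ((WithLp.linearEquiv 2 ℝ (G.L2 × G.L2)).symm.toLinearMap ∘ₗ
      ((G.edgeL2 e ∘ₗ G.testLp e).prod (G.edgeL2 e ∘ₗ G.testDerivLp e))) fun φ => by
    classical
    refine ⟨⟨fun e' x => if e' = e then φ.1 x else 0, ⟨fun e' => ?_, fun _ => 0, fun e' => ?_,
      fun e' => ?_⟩, fun e' => ?_⟩, fun e' => ?_⟩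
    · by_cases h : e' = e
      · simpa only [h, if_true] using φ.2.1.continuous.continuousOn
      · simpa only [h, if_false] using continuousOn_const
    · by_cases h : .inl e' = e
      · subst h
        simp only [if_true]
        exact ⟨image_eq_zero_of_notMem_tsupport fun hm =>
            G.zero_notMem_interior_interval _ (φ.2.2.2 hm),
          image_eq_zero_of_notMem_tsupport fun hm =>
            G.len_notMem_interior_interval _ (φ.2.2.2 hm)⟩
      · simp [h]
    · by_cases h : .inr e' = e
      · subst h
        simp only [if_true]
        exact image_eq_zero_of_notMem_tsupport fun hm =>
            G.zero_notMem_interior_interval _ (φ.2.2.2 hm)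
      · simp [h]
    · change ⇑(G.edgeL2 e (G.testLp e φ) e') =ᵐ[G.edgeMeasure e'] _
      by_cases h : e' = e
      · subst h
        simpa using G.coeFn_testLp φ
      · rw [G.edgeL2_of_ne h]
        simp only [h, if_false]
        exact Lp.coeFn_zero ℝ 2 _
    · change IsWeakDeriv _ (G.edgeL2 e (G.testLp e φ) e') (G.edgeL2 e (G.testDerivLp e φ) e')
      by_cases h : e' = e
      · subst h
        rw [edgeL2_same, edgeL2_same]
        exact (isWeakDeriv_deriv_of_mem_testFunctions φ.2).congr (G.coeFn_testLp φ).symm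
          (G.coeFn_testDerivLp φ).symm
      · rw [G.edgeL2_of_ne h, G.edgeL2_of_ne h]
        exact isWeakDeriv_zero

theorem toL2_ofTest (G : MetricGraph V B R) (e : B ⊕ R) (φ : G.testFunctions e) :
    G.toL2 (G.ofTest e φ) = G.edgeL2 e (G.testLp e φ) := rfl

theorem derivL2_ofTest (G : MetricGraph V B R) (e : B ⊕ R) (φ : G.testFunctions e) :
    G.derivL2 (G.ofTest e φ) = G.edgeL2 e (G.testDerivLp e φ) := rfl

/-- The range of the inclusion of `H¹(G)` in `L²(G)` is dense, so that the dual map is injective. -/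
theorem inner_comp_toL2_injective (G : MetricGraph V B R) :
    Function.Injective fun h : G.L2 => (innerSL ℝ h).comp G.toL2 := by
  intro h k hhk
  rw [← sub_eq_zero]
  ext1 e
  refine G.eq_zero_of_forall_test fun φ h1 h2 h3 => ?_
  have h4 := DFunLike.congr_fun hhk (G.ofTest e ⟨φ, h1, h2, h3⟩)
  simp only [ContinuousLinearMap.comp_apply, innerSL_apply_apply] at h4
  rw [← sub_eq_zero, ← inner_sub_left, toL2_ofTest, PiLp.inner_apply,
    Finset.sum_eq_single e (fun e' _ h => by rw [G.edgeL2_of_ne h, inner_zero_right]) (by simp),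
    edgeL2_same, L2.inner_def] at h4
  rw [← h4]
  refine integral_congr_ae ?_
  filter_upwards [G.coeFn_testLp (e := e) ⟨φ, h1, h2, h3⟩] with x hx
  rw [hx]
  simp [mul_comm]

theorem integral_sq_eq_norm_sq {I : Set ℝ} (u : Lp ℝ 2 (volume.restrict I)) :
    ∫ x in I, |u x| ^ 2 = ‖u‖ ^ 2 := by
  rw [← real_inner_self_eq_norm_sq, L2.inner_def]
  exact integral_congr_ae (ae_of_all _ fun x => by simp [pow_two])

theorem norm_toL2_ofTest_sq (G : MetricGraph V B R) (e : B ⊕ R) (φ : G.testFunctions e) :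
    ‖G.toL2 (G.ofTest e φ)‖ ^ 2 = ∫ x, φ.1 x ^ 2 := by
  rw [toL2_ofTest, norm_edgeL2_sq, ← integral_sq_eq_norm_sq,
    ← G.setIntegral_interval_eq e fun x hx => by
      rw [image_eq_zero_of_notMem_tsupport fun hx' => hx (interior_subset (φ.2.2.2 hx'))]; simp]
  refine integral_congr_ae ?_
  filter_upwards [G.coeFn_testLp φ] with x hx
  rw [hx, sq_abs]

theorem norm_derivL2_ofTest_sq (G : MetricGraph V B R) (e : B ⊕ R) (φ : G.testFunctions e) :
    ‖G.derivL2 (G.ofTest e φ)‖ ^ 2 = ∫ x, deriv φ.1 x ^ 2 := by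
  rw [derivL2_ofTest, norm_edgeL2_sq, ← integral_sq_eq_norm_sq,
    ← G.setIntegral_interval_eq e fun x hx => by
      rw [Function.notMem_support.1 fun hx' =>
        hx (interior_subset (φ.2.2.2 (support_deriv_subset hx')))]; simp]
  refine integral_congr_ae ?_
  filter_upwards [G.coeFn_testDerivLp φ] with x hx
  rw [hx, sq_abs]

end MetricGraph

section

set_option maxSynthPendingDepth 3

/-! ### Functionals with locally Lipschitz second derivatives -/

/-- `Φ` is twice differentiable and its first two derivatives are Lipschitz continuous on bounded
sets. -/
def HasLipschitzDerivs {E G : Type*} [NormedAddCommGroup E] [NormedSpace ℝ E]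
    [NormedAddCommGroup G] [NormedSpace ℝ G] (Φ : E → G) : Prop :=
  ∃ (D : E → E →L[ℝ] G) (D' : E → E →L[ℝ] E →L[ℝ] G), (∀ u, HasFDerivAt Φ (D u) u) ∧
    (∀ u, HasFDerivAt D (D' u) u) ∧ ∀ r : ℝ, ∃ M : ℝ, ∀ u v, ‖u‖ ≤ r → ‖v‖ ≤ r →
      ‖D u - D v‖ ≤ M * ‖u - v‖ ∧ ‖D' u - D' v‖ ≤ M * ‖u - v‖

namespace HasLipschitzDerivs

variable {E F G : Type*} [NormedAddCommGroup E] [NormedSpace ℝ E] [NormedAddCommGroup F]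
  [NormedSpace ℝ F] [NormedAddCommGroup G] [NormedSpace ℝ G]

theorem add {Φ Ψ : E → G} (hΦ : HasLipschitzDerivs Φ) (hΨ : HasLipschitzDerivs Ψ) :
    HasLipschitzDerivs fun u => Φ u + Ψ u := by
  obtain ⟨D, D', h1, h2, h3⟩ := hΦ
  obtain ⟨T, T', k1, k2, k3⟩ := hΨ
  refine ⟨fun u => D u + T u, fun u => D' u + T' u, fun u => (h1 u).add (k1 u),
    fun u => (h2 u).add (k2 u), fun r => ?_⟩
  obtain ⟨M, hM⟩ := h3 r
  obtain ⟨N, hN⟩ := k3 r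
  refine ⟨M + N, fun u v hu hv => ?_⟩
  beta_reduce
  rw [add_mul, add_sub_add_comm, add_sub_add_comm]
  exact ⟨(norm_add_le _ _).trans (add_le_add (hM u v hu hv).1 (hN u v hu hv).1),
    (norm_add_le _ _).trans (add_le_add (hM u v hu hv).2 (hN u v hu hv).2)⟩

theorem const_smul {Φ : E → G} (hΦ : HasLipschitzDerivs Φ) (c : ℝ) :
    HasLipschitzDerivs fun u => c • Φ u := by
  obtain ⟨D, D', h1, h2, h3⟩ := hΦ
  refine ⟨fun u => c • D u, fun u => c • D' u, fun u => (h1 u).const_smul c,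
    fun u => (h2 u).const_smul c, fun r => ?_⟩
  obtain ⟨M, hM⟩ := h3 r
  refine ⟨|c| * M, fun u v hu hv => ?_⟩
  beta_reduce
  rw [← smul_sub, ← smul_sub, norm_smul, norm_smul, Real.norm_eq_abs, mul_assoc]
  exact ⟨mul_le_mul_of_nonneg_left (hM u v hu hv).1 (abs_nonneg c),
    mul_le_mul_of_nonneg_left (hM u v hu hv).2 (abs_nonneg c)⟩

theorem zero : HasLipschitzDerivs fun _ : E => (0 : G) :=
  ⟨fun _ => 0, fun _ => 0, fun _ => hasFDerivAt_const _ _, fun _ => hasFDerivAt_const _ _,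
    fun _ => ⟨0, by simp⟩⟩

theorem sum {ι : Type*} (s : Finset ι) {Φ : ι → E → G} (h : ∀ i, HasLipschitzDerivs (Φ i)) :
    HasLipschitzDerivs fun u => ∑ i ∈ s, Φ i u := by
  classical
  induction s using Finset.induction_on with
  | empty => simpa only [Finset.sum_empty] using zero
  | insert i s hi ih =>
    simp only [Finset.sum_insert hi]
    exact (h i).add ih

theorem comp {Φ : F → G} (hΦ : HasLipschitzDerivs Φ) (L : E →L[ℝ] F) :
    HasLipschitzDerivs fun u => Φ (L u) := by
  obtain ⟨D, D', h1, h2, h3⟩ := hΦ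
  let P : (F →L[ℝ] G) →L[ℝ] (E →L[ℝ] G) := (ContinuousLinearMap.compL ℝ E F G).flip L
  refine ⟨fun u => P (D (L u)), fun u => P.comp ((D' (L u)).comp L),
    fun u => (h1 (L u)).comp u L.hasFDerivAt,
    fun u => P.hasFDerivAt.comp u ((h2 (L u)).comp u L.hasFDerivAt), fun r => ?_⟩
  obtain ⟨M, hM⟩ := h3 (‖L‖ * r)
  have hM0 : ∀ u v, ‖u‖ ≤ r → ‖v‖ ≤ r → ‖D (L u) - D (L v)‖ ≤ |M| * (‖L‖ * ‖u - v‖) ∧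
      ‖D' (L u) - D' (L v)‖ ≤ |M| * (‖L‖ * ‖u - v‖) := by
    intro u v hu hv
    have hb : ∀ w, ‖w‖ ≤ r → ‖L w‖ ≤ ‖L‖ * r := fun w hw => (L.le_opNorm w).trans (by gcongr)
    have hl : M * ‖L u - L v‖ ≤ |M| * (‖L‖ * ‖u - v‖) := by
      rw [← map_sub]
      exact mul_le_mul (le_abs_self M) (L.le_opNorm _) (norm_nonneg _) (abs_nonneg M)
    have := hM (L u) (L v) (hb u hu) (hb v hv)
    exact ⟨this.1.trans hl, this.2.trans hl⟩
  refine ⟨‖P‖ * (|M| * ‖L‖) + ‖P‖ * (|M| * ‖L‖ * ‖L‖), fun u v hu hv => ?_⟩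
  have hn := norm_nonneg (u - v)
  have hnn1 : 0 ≤ ‖P‖ * (|M| * ‖L‖) * ‖u - v‖ := by positivity
  have hnn2 : 0 ≤ ‖P‖ * (|M| * ‖L‖ * ‖L‖) * ‖u - v‖ := by positivity
  rw [add_mul]
  constructor
  · rw [← map_sub]
    refine (P.le_opNorm _).trans ?_
    have := mul_le_mul_of_nonneg_left (hM0 u v hu hv).1 (norm_nonneg P)
    nlinarith
  · rw [← ContinuousLinearMap.comp_sub, ← ContinuousLinearMap.sub_comp]
    refine (ContinuousLinearMap.opNorm_comp_le _ _).trans ?_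
    have h4 : ‖(D' (L u) - D' (L v)).comp L‖ ≤ |M| * (‖L‖ * ‖u - v‖) * ‖L‖ :=
      (ContinuousLinearMap.opNorm_comp_le _ _).trans
        (mul_le_mul_of_nonneg_right (hM0 u v hu hv).2 (norm_nonneg L))
    have := mul_le_mul_of_nonneg_left h4 (norm_nonneg P)
    nlinarith

theorem norm_sq {F : Type*} [NormedAddCommGroup F] [InnerProductSpace ℝ F] :
    HasLipschitzDerivs fun u : F => ‖u‖ ^ 2 := by
  refine ⟨fun u => 2 • innerSL ℝ u, fun _ => 2 • innerSL ℝ, fun u => ?_,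
    fun u => ((innerSL ℝ : F →L[ℝ] F →L[ℝ] ℝ).hasFDerivAt).const_smul 2, fun r => ?_⟩
  · exact (hasStrictFDerivAt_norm_sq u).hasFDerivAt
  · refine ⟨2, fun u v _ _ => ⟨?_, ?_⟩⟩
    · have e1 : 2 • innerSL ℝ u - 2 • innerSL ℝ v = (2 : ℝ) • innerSL ℝ (u - v) := by
        ext w; simp; ring
      beta_reduce
      rw [e1, norm_smul, innerSL_apply_norm]
      simp
    · beta_reduce
      rw [sub_self, norm_zero]
      positivity

theorem contDiff {Φ : E → G} (hΦ : HasLipschitzDerivs Φ) : ContDiff ℝ 2 Φ := by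
  obtain ⟨D, D', h1, h2, h3⟩ := hΦ
  have hD : fderiv ℝ Φ = D := funext fun u => (h1 u).fderiv
  have hD' : fderiv ℝ D = D' := funext fun u => (h2 u).fderiv
  have hcont : Continuous D' := by
    rw [continuous_iff_continuousAt]
    intro u
    obtain ⟨M, hM⟩ := h3 (‖u‖ + 1)
    refine (tendsto_iff_norm_sub_tendsto_zero (f := D')).2 ?_
    have hlim : Tendsto (fun v => M * ‖v - u‖) (𝓝 u) (𝓝 0) := by
      have : Continuous fun v => M * ‖v - u‖ := by fun_prop
      simpa using this.tendsto u
    refine squeeze_zero' (Eventually.of_forall fun _ => norm_nonneg _) ?_ hlim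
    filter_upwards [Metric.ball_mem_nhds u one_pos] with v hv
    refine (hM v u ?_ (by simp)).2
    have hvu := norm_le_norm_add_norm_sub' v u
    have hv' := mem_ball_iff_norm.1 hv
    linarith
  rw [show (2 : WithTop ℕ∞) = 1 + 1 from by norm_num, contDiff_succ_iff_fderiv]
  refine ⟨fun u => (h1 u).differentiableAt, by simp, ?_⟩
  rw [hD, contDiff_one_iff_fderiv]
  exact ⟨fun u => (h2 u).differentiableAt, by rwa [hD']⟩

end HasLipschitzDerivs

theorem HasLipschitzDerivs.holderDerivsOnBounded {E : Type*} [NormedAddCommGroup E]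
    [InnerProductSpace ℝ E] {Φ : E → ℝ} (hΦ : HasLipschitzDerivs Φ) :
    HolderDerivsOnBounded 1 Φ := by
  obtain ⟨D, D', h1, h2, h3⟩ := hΦ
  have hD : fderiv ℝ Φ = D := funext fun u => (h1 u).fderiv
  have hD' : fderiv ℝ D = D' := funext fun u => (h2 u).fderiv
  intro r hr
  obtain ⟨M, hM⟩ := h3 r
  refine ⟨|M| + 1, by positivity, fun u hu v hv => ?_⟩
  rw [hD, hD', Real.rpow_one]
  have := hM u v (mem_ball_zero_iff.1 hu).le (mem_ball_zero_iff.1 hv).le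
  have hle : M * ‖u - v‖ ≤ (|M| + 1) * ‖u - v‖ :=
    mul_le_mul_of_nonneg_right ((le_abs_self M).trans (by linarith)) (norm_nonneg _)
  exact ⟨this.1.trans hle, this.2.trans hle⟩

/-- In a normed algebra, a functional `v ↦ ℓ (T₀ v)` has Lipschitz derivatives when the derivatives
of `T₀` and `T₁` are the multiplications by `T₁` and `T₂`, and `T₁`, `T₂` are Lipschitz continuous
on bounded sets. -/
theorem HasLipschitzDerivs.of_mul {W : Type*} [NormedCommRing W] [NormedAlgebra ℝ W]
    {T₀ T₁ T₂ : W → W} (h0 : ∀ v, HasFDerivAt T₀ (ContinuousLinearMap.mul ℝ W (T₁ v)) v)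
    (h1 : ∀ v, HasFDerivAt T₁ (ContinuousLinearMap.mul ℝ W (T₂ v)) v)
    (k1 : ∀ r, ∃ M, 0 ≤ M ∧ ∀ u v, ‖u‖ ≤ r → ‖v‖ ≤ r → ‖T₁ u - T₁ v‖ ≤ M * ‖u - v‖)
    (k2 : ∀ r, ∃ M, 0 ≤ M ∧ ∀ u v, ‖u‖ ≤ r → ‖v‖ ≤ r → ‖T₂ u - T₂ v‖ ≤ M * ‖u - v‖)
    {G : Type*} [NormedAddCommGroup G] [NormedSpace ℝ G] (ℓ : W →L[ℝ] G) :
    HasLipschitzDerivs fun v => ℓ (T₀ v) := by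
  let A : W →L[ℝ] W →L[ℝ] G :=
    (ContinuousLinearMap.compL ℝ W W G ℓ).comp (ContinuousLinearMap.mul ℝ W)
  refine ⟨fun v => A (T₁ v), fun v => A.comp (ContinuousLinearMap.mul ℝ W (T₂ v)),
    fun v => ℓ.hasFDerivAt.comp v (h0 v), fun v => A.hasFDerivAt.comp v (h1 v), fun r => ?_⟩
  obtain ⟨M, hM0, hM⟩ := k1 r
  obtain ⟨N, hN0, hN⟩ := k2 r
  refine ⟨‖A‖ * (M + N), fun u v hu hv => ⟨?_, ?_⟩⟩
  · beta_reduce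
    rw [← map_sub, mul_assoc]
    refine (A.le_opNorm _).trans (mul_le_mul_of_nonneg_left ((hM u v hu hv).trans ?_)
      (norm_nonneg A))
    exact mul_le_mul_of_nonneg_right (by linarith) (norm_nonneg _)
  · beta_reduce
    rw [← ContinuousLinearMap.comp_sub, ← map_sub, mul_assoc]
    refine (ContinuousLinearMap.opNorm_comp_le _ _).trans (mul_le_mul_of_nonneg_left
      ((ContinuousLinearMap.opNorm_mul_apply_le _ _ _).trans ((hN u v hu hv).trans ?_))
      (norm_nonneg A))
    exact mul_le_mul_of_nonneg_right (by linarith) (norm_nonneg _)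

/-! ### Superposition operators on continuous functions -/

section Superposition

variable {K : Type*} [TopologicalSpace K]

/-- The superposition operator `v ↦ ψ ∘ v` on continuous functions. -/
def superposition (ψ : C(ℝ, ℝ)) (v : C(K, ℝ)) : C(K, ℝ) := ψ.comp v

@[simp] theorem superposition_apply (ψ : C(ℝ, ℝ)) (v : C(K, ℝ)) (x : K) :
    superposition ψ v x = ψ (v x) := rfl

variable [CompactSpace K]

theorem exists_lipschitz_of_hasDerivAt {ψ ψ' : C(ℝ, ℝ)} (h : ∀ x, HasDerivAt ψ (ψ' x) x) (r : ℝ) :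
    ∃ M, 0 ≤ M ∧ ∀ x y, |x| ≤ r → |y| ≤ r → |ψ x - ψ y| ≤ M * |x - y| := by
  obtain ⟨M, hM⟩ := (isCompact_Icc (a := -r) (b := r)).exists_bound_of_continuousOn
    ψ'.continuous.continuousOn
  refine ⟨|M|, abs_nonneg M, fun x y hx hy => ?_⟩
  exact (convex_Icc (-r) r).norm_image_sub_le_of_norm_hasDerivWithin_le
    (fun z _ => (h z).hasDerivWithinAt) (fun z hz => (hM z hz).trans (le_abs_self M))
    (abs_le.1 hy) (abs_le.1 hx)

theorem exists_lipschitz_superposition {ψ ψ' : C(ℝ, ℝ)} (h : ∀ x, HasDerivAt ψ (ψ' x) x) (r : ℝ) :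
    ∃ M, 0 ≤ M ∧ ∀ u v : C(K, ℝ), ‖u‖ ≤ r → ‖v‖ ≤ r →
      ‖superposition ψ u - superposition ψ v‖ ≤ M * ‖u - v‖ := by
  obtain ⟨M, hM0, hM⟩ := exists_lipschitz_of_hasDerivAt h r
  refine ⟨M, hM0, fun u v hu hv => ?_⟩
  rw [ContinuousMap.norm_le _ (by positivity)]
  intro x
  refine (hM (u x) (v x) ((u.norm_coe_le_norm x).trans hu)
    ((v.norm_coe_le_norm x).trans hv)).trans ?_
  exact mul_le_mul_of_nonneg_left ((u - v).norm_coe_le_norm x) hM0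

theorem hasFDerivAt_superposition {ψ ψ' ψ'' : C(ℝ, ℝ)} (h : ∀ x, HasDerivAt ψ (ψ' x) x)
    (h' : ∀ x, HasDerivAt ψ' (ψ'' x) x) (v : C(K, ℝ)) :
    HasFDerivAt (superposition ψ) (ContinuousLinearMap.mul ℝ C(K, ℝ) (superposition ψ' v)) v := by
  obtain ⟨M, hM0, hM⟩ := exists_lipschitz_of_hasDerivAt h' (‖v‖ + 1)
  rw [hasFDerivAt_iff_isLittleO_nhds_zero]
  refine Asymptotics.IsBigO.trans_isLittleO (g := fun w : C(K, ℝ) => ‖w‖ ^ 2) ?_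
    (Asymptotics.isLittleO_norm_pow_id one_lt_two)
  refine Asymptotics.IsBigO.of_bound M ?_
  filter_upwards [Metric.closedBall_mem_nhds (0 : C(K, ℝ)) one_pos] with w hw
  rw [mem_closedBall_zero_iff] at hw
  rw [norm_pow, norm_norm, ContinuousMap.norm_le _ (by positivity)]
  intro x
  have hv := v.norm_coe_le_norm x
  have hwx := w.norm_coe_le_norm x
  rw [Real.norm_eq_abs] at hv hwx
  -- the mean value inequality for `t ↦ ψ t - ψ' (v x) * t` between `v x` and `v x + w x`
  have key := (convex_uIcc (v x) (v x + w x)).norm_image_sub_le_of_norm_hasDerivWithin_le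
    (f := fun t => ψ t - ψ' (v x) * t) (f' := fun t => ψ' t - ψ' (v x)) (C := M * |w x|)
    (fun t _ => by
      have := ((h t).sub ((hasDerivAt_id t).const_mul (ψ' (v x)))).hasDerivWithinAt
        (s := uIcc (v x) (v x + w x))
      rw [mul_one] at this
      exact this)
    (fun t ht => by
      have ht' : |t - v x| ≤ |w x| := by
        have := abs_sub_left_of_mem_uIcc ht
        simpa using this
      refine (hM t (v x) ?_ (by linarith)).trans (mul_le_mul_of_nonneg_left ht' hM0)
      have := abs_sub_abs_le_abs_sub t (v x)
      linarith)
    left_mem_uIcc right_mem_uIcc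
  have heq : (superposition ψ (v + w) - superposition ψ v -
      (ContinuousLinearMap.mul ℝ C(K, ℝ) (superposition ψ' v)) w) x =
      ψ (v x + w x) - ψ' (v x) * (v x + w x) - (ψ (v x) - ψ' (v x) * v x) := by
    simp
    ring
  rw [heq]
  refine key.trans ?_
  rw [add_sub_cancel_left, Real.norm_eq_abs, mul_assoc, ← pow_two]
  gcongr

theorem HasLipschitzDerivs.superposition {ψ₀ ψ₁ ψ₂ ψ₃ : C(ℝ, ℝ)}
    (h0 : ∀ x, HasDerivAt ψ₀ (ψ₁ x) x) (h1 : ∀ x, HasDerivAt ψ₁ (ψ₂ x) x)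
    (h2 : ∀ x, HasDerivAt ψ₂ (ψ₃ x) x) (ℓ : C(K, ℝ) →L[ℝ] ℝ) :
    HasLipschitzDerivs fun v : C(K, ℝ) => ℓ (superposition ψ₀ v) :=
  HasLipschitzDerivs.of_mul (W := C(K, ℝ)) (T₀ := _root_.superposition ψ₀)
    (T₁ := _root_.superposition ψ₁) (T₂ := _root_.superposition ψ₂)
    (hasFDerivAt_superposition h0 h1) (hasFDerivAt_superposition h1 h2)
    (exists_lipschitz_superposition h1) (exists_lipschitz_superposition h2) ℓ

end Superposition

/-- The function `x ↦ |x| ^ q`, for `1 < q`. -/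
noncomputable def absRpow (q : ℝ) (hq : 1 < q) : C(ℝ, ℝ) :=
  ⟨fun x => |x| ^ q, continuous_abs.rpow_const fun _ => Or.inr (by linarith)⟩

theorem hasDerivAt_abs_rpow_mul {q : ℝ} (hq : 1 < q) (x : ℝ) :
    HasDerivAt (fun x : ℝ => |x| ^ q * x) ((q + 1) * |x| ^ q) x := by
  have := (hasDerivAt_abs_rpow x hq).mul (hasDerivAt_id x)
  refine this.congr_deriv ?_
  have h1 : |x| ^ (q - 2) * x * x = |x| ^ q := by
    rcases eq_or_ne x 0 with rfl | hx
    · simp [Real.zero_rpow (show q ≠ 0 by linarith)]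
    · have hpos := abs_pos.2 hx
      rw [mul_assoc, ← pow_two, ← sq_abs, ← Real.rpow_natCast, ← Real.rpow_add hpos]
      norm_num
  simp only [id, mul_one]
  linear_combination q * h1

/-- The functional `v ↦ ℓ (|v| ^ p)` has Lipschitz derivatives as soon as `4 < p`. -/
theorem hasLipschitzDerivs_abs_rpow {K : Type*} [TopologicalSpace K] [CompactSpace K] {p : ℝ}
    (hp : 4 < p) (ℓ : C(K, ℝ) →L[ℝ] ℝ) :
    HasLipschitzDerivs fun v : C(K, ℝ) => ℓ (superposition (absRpow p (by linarith)) v) := by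
  have h1 : Continuous fun x : ℝ => |x| ^ (p - 2) :=
    continuous_abs.rpow_const fun _ => Or.inr (by linarith)
  have h2 : Continuous fun x : ℝ => |x| ^ (p - 2 - 2) * x :=
    (continuous_abs.rpow_const fun _ => Or.inr (by linarith)).mul continuous_id
  refine HasLipschitzDerivs.superposition
    (ψ₁ := ⟨fun x => p * (|x| ^ (p - 2) * x), by fun_prop⟩)
    (ψ₂ := ⟨fun x => p * ((p - 2 + 1) * |x| ^ (p - 2)), by fun_prop⟩)
    (ψ₃ := ⟨fun x => p * ((p - 2 + 1) * ((p - 2) * (|x| ^ (p - 2 - 2) * x))), by fun_prop⟩)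
    (fun x => ?_) (fun x => ?_) (fun x => ?_) ℓ
  · have := hasDerivAt_abs_rpow x (show 1 < p by linarith)
    rwa [mul_assoc] at this
  · exact (hasDerivAt_abs_rpow_mul (by linarith) x).const_mul p
  · have := hasDerivAt_abs_rpow x (show 1 < p - 2 by linarith)
    rw [mul_assoc] at this
    exact (this.const_mul (p - 2 + 1)).const_mul p

end

namespace MetricGraph

variable {V B R : Type*}

/-! ### Continuous representatives and the energy -/

/-- The continuous representative of an element of `H¹(G)`. -/
noncomputable def rep [Fintype B] [Fintype R] (G : MetricGraph V B R) (u : G.H1) : B ⊕ R → ℝ → ℝ :=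
  u.2.1.choose

variable [Fintype B]

/-- The total length of the compact core. -/
noncomputable def coreLength (G : MetricGraph V B R) : ℝ := ∑ e : B, G.len e

theorem len_le_coreLength (G : MetricGraph V B R) (e : B) : G.len e ≤ G.coreLength :=
  Finset.single_le_sum (f := G.len) (fun e _ => (G.len_pos e).le) (Finset.mem_univ e)

theorem coreLength_pos [Nonempty B] (G : MetricGraph V B R) : 0 < G.coreLength :=
  Finset.sum_pos (fun e _ => G.len_pos e) Finset.univ_nonempty

variable [Fintype R]

theorem continuousOn_rep (G : MetricGraph V B R) (u : G.H1) (e : B ⊕ R) :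
    ContinuousOn (G.rep u e) (G.interval e) :=
  u.2.1.choose_spec.1.1 e

theorem toL2_ae_eq_rep (G : MetricGraph V B R) (u : G.H1) (e : B ⊕ R) :
    G.toL2 u e =ᵐ[G.edgeMeasure e] G.rep u e :=
  u.2.1.choose_spec.2 e

theorem eqOn_rep (G : MetricGraph V B R) {u : G.H1} {e : B} {f : ℝ → ℝ}
    (hf : ContinuousOn f (Icc 0 (G.len e))) (h : G.toL2 u (.inl e) =ᵐ[G.edgeMeasure (.inl e)] f) :
    EqOn (G.rep u (.inl e)) f (Icc 0 (G.len e)) :=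
  Measure.eqOn_Icc_of_ae_eq volume (G.len_pos e).ne ((G.toL2_ae_eq_rep u _).symm.trans h)
    (G.continuousOn_rep u (.inl e)) hf

/-- The restriction of an element of `H¹(G)` to a bounded edge, as a continuous function. -/
noncomputable def restrictEdge (G : MetricGraph V B R) (e : B) :
    G.H1 →L[ℝ] C(Icc (0 : ℝ) (G.len e), ℝ) :=
  LinearMap.mkContinuousOfExistsBound
    { toFun := fun u => ⟨(Icc (0 : ℝ) (G.len e)).domRestrict (G.rep u (.inl e)),
        continuousOn_iff_continuous_domRestrict.1 (G.continuousOn_rep u (.inl e))⟩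
      map_add' := fun u v => by
        ext x
        refine G.eqOn_rep (f := fun x => G.rep u (.inl e) x + G.rep v (.inl e) x)
          ((G.continuousOn_rep u (.inl e)).add (G.continuousOn_rep v (.inl e))) ?_ x.2
        rw [map_add]
        filter_upwards [Lp.coeFn_add (G.toL2 u (.inl e)) (G.toL2 v (.inl e)),
          G.toL2_ae_eq_rep u (.inl e), G.toL2_ae_eq_rep v (.inl e)] with x h1 h2 h3
        rw [← h2, ← h3]
        exact h1
      map_smul' := fun c u => by
        ext x
        refine G.eqOn_rep (f := fun x => c * G.rep u (.inl e) x)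
          (continuousOn_const.mul (G.continuousOn_rep u (.inl e))) ?_ x.2
        rw [map_smul]
        filter_upwards [Lp.coeFn_smul c (G.toL2 u (.inl e)), G.toL2_ae_eq_rep u (.inl e)]
          with x h1 h2
        rw [← h2]
        exact h1 } <| by
    obtain ⟨C, hC, h⟩ := G.exists_forall_abs_le_mul_norm (.inl e)
    refine ⟨C, fun u => ?_⟩
    rw [ContinuousMap.norm_le _ (by positivity)]
    exact fun x => h u.1 u.2 _ (G.continuousOn_rep u (.inl e)) (G.toL2_ae_eq_rep u _) x x.2

@[simp] theorem restrictEdge_apply (G : MetricGraph V B R) (e : B) (u : G.H1)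
    (x : Icc (0 : ℝ) (G.len e)) : G.restrictEdge e u x = G.rep u (.inl e) x := rfl

instance isFiniteMeasure_comap_Icc (a : ℝ) :
    IsFiniteMeasure (Measure.comap (Subtype.val : Icc (0 : ℝ) a → ℝ) volume) :=
  ⟨by
    rw [(MeasurableEmbedding.subtype_coe measurableSet_Icc).comap_apply, image_univ,
      Subtype.range_coe]
    exact isCompact_Icc.measure_lt_top⟩

/-- Integration over the interval `[0, a]`, as a functional on continuous functions. -/
noncomputable def integralIcc (a : ℝ) : C(Icc (0 : ℝ) a, ℝ) →L[ℝ] ℝ :=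
  LinearMap.mkContinuousOfExistsBound
    { toFun := fun v => ∫ x, v x ∂(Measure.comap (Subtype.val : Icc (0 : ℝ) a → ℝ) volume)
      map_add' := fun v w => integral_add
        (v.continuous.integrable_of_hasCompactSupport (HasCompactSupport.of_compactSpace _))
        (w.continuous.integrable_of_hasCompactSupport (HasCompactSupport.of_compactSpace _))
      map_smul' := fun c v => integral_const_mul c _ } <| by
    refine ⟨(Measure.comap (Subtype.val : Icc (0 : ℝ) a → ℝ) volume).real univ, fun v => ?_⟩
    rw [mul_comm]
    exact norm_integral_le_of_norm_le_const (ae_of_all _ v.norm_coe_le_norm)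

theorem integralIcc_apply {a : ℝ} (f : ℝ → ℝ) (v : C(Icc (0 : ℝ) a, ℝ))
    (h : ∀ x : Icc (0 : ℝ) a, v x = f x) : integralIcc a v = ∫ x in Icc 0 a, f x := by
  rw [← integral_subtype_comap measurableSet_Icc]
  exact integral_congr_ae (ae_of_all _ h)

/-- The integral of `|u| ^ p` over the compact core. -/
noncomputable def corePower (G : MetricGraph V B R) (p : ℝ) (u : G.H1) : ℝ :=
  ∑ e : B, ∫ x in G.interval (.inl e), |G.toL2 u (.inl e) x| ^ p

theorem corePower_eq (G : MetricGraph V B R) (p : ℝ) (u : G.H1) :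
    G.corePower p u = ∑ e : B, ∫ x in Icc 0 (G.len e), |G.rep u (.inl e) x| ^ p := by
  refine Finset.sum_congr rfl fun e _ => integral_congr_ae ?_
  filter_upwards [G.toL2_ae_eq_rep u (.inl e)] with x hx
  rw [hx]

theorem corePower_nonneg (G : MetricGraph V B R) (p : ℝ) (u : G.H1) : 0 ≤ G.corePower p u :=
  Finset.sum_nonneg fun _ _ => integral_nonneg fun _ => Real.rpow_nonneg (abs_nonneg _) _

theorem energy_eq (G : MetricGraph V B R) (p ρ : ℝ) (u : G.H1) :
    G.energy p ρ u = 1 / 2 * ‖G.derivL2 u‖ ^ 2 - ρ / p * G.corePower p u := by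
  rw [energy, corePower, PiLp.norm_sq_eq_of_L2]
  simp only [← integral_sq_eq_norm_sq]

theorem energy_neg (G : MetricGraph V B R) (p ρ : ℝ) (u : G.H1) :
    G.energy p ρ (-u) = G.energy p ρ u := by
  rw [energy_eq, energy_eq, map_neg, norm_neg]
  congr 2
  refine Finset.sum_congr rfl fun e _ => integral_congr_ae ?_
  rw [map_neg]
  filter_upwards [Lp.coeFn_neg (G.toL2 u (.inl e))] with x hx
  change |(-G.toL2 u (.inl e) : Lp ℝ 2 _) x| ^ p = _
  rw [hx, Pi.neg_apply, abs_neg]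

theorem hasLipschitzDerivs_energy (G : MetricGraph V B R) {p : ℝ} (hp : 4 < p) (ρ : ℝ) :
    HasLipschitzDerivs (G.energy p ρ) := by
  have h : G.energy p ρ = fun u => (1 / 2 : ℝ) • ‖G.derivL2 u‖ ^ 2 + (-(ρ / p)) • ∑ e : B,
      integralIcc (G.len e) (superposition (absRpow p (by linarith)) (G.restrictEdge e u)) := by
    ext u
    rw [energy_eq, corePower_eq, smul_eq_mul, smul_eq_mul, neg_mul, ← sub_eq_add_neg]
    congr 2
    exact Finset.sum_congr rfl fun e _ => (integralIcc_apply _ _ fun x => rfl).symm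
  rw [h]
  exact ((HasLipschitzDerivs.norm_sq.comp G.derivL2).const_smul _).add
    ((HasLipschitzDerivs.sum _ fun e =>
      (hasLipschitzDerivs_abs_rpow hp (integralIcc (G.len e))).comp
        (G.restrictEdge e)).const_smul _)

/-- On the sphere of mass `μ` the kinetic energy is coercive. -/
theorem tendsto_norm_derivL2_sq (G : MetricGraph V B R) (μ : ℝ) :
    Tendsto (fun u => 1 / 2 * ‖G.derivL2 u‖ ^ 2)
      (Bornology.cobounded G.H1 ⊓ 𝓟 (massSphere G.toL2 μ)) atTop := by
  have h1 : Tendsto (fun u : G.H1 => 1 / 2 * (‖u‖ ^ 2 - μ))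
      (Bornology.cobounded G.H1 ⊓ 𝓟 (massSphere G.toL2 μ)) atTop := by
    refine Tendsto.const_mul_atTop (by norm_num) (tendsto_atTop_add_const_right _ (-μ) ?_)
    exact ((tendsto_pow_atTop two_ne_zero).comp tendsto_norm_cobounded_atTop).mono_left inf_le_left
  refine h1.congr' ?_
  filter_upwards [mem_inf_of_right (mem_principal_self _)] with u hu
  rw [G.norm_sq_eq, show ‖G.toL2 u‖ ^ 2 = μ from hu]
  ring

/-! ### The lower bound for functions vanishing on a grid -/

/-- The grid point number `j` on the edge `e`, which is divided into `m` intervals. -/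
noncomputable def gridPoint (G : MetricGraph V B R) (m : ℕ) (e : B) (j : Fin (m + 1)) :
    Icc (0 : ℝ) (G.len e) :=
  ⟨j / m * G.len e, by
    have h1 := (G.len_pos e).le
    have h2 : (j : ℝ) / m ≤ 1 := div_le_one_of_le₀ (by exact_mod_cast Nat.lt_succ_iff.1 j.2)
      (Nat.cast_nonneg m)
    exact ⟨by positivity, mul_le_of_le_one_left h1 h2⟩⟩

theorem abs_rep_le_of_grid (G : MetricGraph V B R) {m : ℕ} (hm : 0 < m) {u : G.H1}
    (h : ∀ e j, G.restrictEdge e u (G.gridPoint m e j) = 0) {e : B} {x : ℝ}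
    (hx : x ∈ Icc 0 (G.len e)) :
    |G.rep u (.inl e) x| ≤ √(G.coreLength / m) * ‖G.derivL2 u‖ := by
  have hl := G.len_pos e
  have hm' : (0 : ℝ) < m := by exact_mod_cast hm
  have hq : 0 ≤ x / G.len e * m := mul_nonneg (div_nonneg hx.1 hl.le) hm'.le
  have hj1 := Nat.floor_le hq
  have hj2 := Nat.lt_floor_add_one (x / G.len e * m)
  have hjm : ⌊x / G.len e * m⌋₊ < m + 1 := by
    refine Nat.lt_succ_of_le (Nat.floor_le_of_le ?_)
    exact mul_le_of_le_one_left hm'.le (div_le_one_of_le₀ hx.2 hl.le)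
  set j : Fin (m + 1) := ⟨⌊x / G.len e * m⌋₊, hjm⟩
  have hjv : ((j : ℕ) : ℝ) = ⌊x / G.len e * m⌋₊ := rfl
  have hle : (j : ℝ) / m * G.len e ≤ x := by
    rw [hjv, div_mul_eq_mul_div, div_le_iff₀ hm']
    calc _ ≤ x / G.len e * m * G.len e := mul_le_mul_of_nonneg_right hj1 hl.le
      _ = x * m := by field_simp
  have hge : x - (j : ℝ) / m * G.len e ≤ G.len e / m := by
    rw [hjv, sub_le_iff_le_add, ← mul_le_mul_iff_left₀ hm']
    have : x * m ≤ (⌊x / G.len e * m⌋₊ + 1) * G.len e := by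
      calc x * m = x / G.len e * m * G.len e := by field_simp
        _ ≤ _ := mul_le_mul_of_nonneg_right hj2.le hl.le
    refine this.trans_eq ?_
    field_simp
    ring
  have hg := h e j
  rw [restrictEdge_apply] at hg
  have hsub : Icc ((j : ℝ) / m * G.len e) x ⊆ G.interval (.inl e) :=
    Icc_subset_Icc (G.gridPoint m e j).2.1 hx.2
  have := abs_sub_le_sqrt_mul_norm (G.measurableSet_interval _) (u.2.2 (.inl e))
    (G.toL2_ae_eq_rep u (.inl e)) (G.continuousOn_rep u (.inl e)) hsub
    (right_mem_Icc.2 hle) (left_mem_Icc.2 hle)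
  rw [show G.rep u (.inl e) ((j : ℝ) / m * G.len e) = 0 from hg, sub_zero] at this
  refine this.trans ?_
  gcongr
  · exact hge.trans (div_le_div_of_nonneg_right (G.len_le_coreLength e) hm'.le)
  · exact PiLp.norm_apply_le (G.derivL2 u) (.inl e)

/-- If `u` vanishes at the grid points and `‖u'‖² = m / |K|`, then `|u| ≤ 1` on the compact core, so
that the nonlinear term is bounded while the kinetic energy is large. -/
theorem le_energy_of_grid [Nonempty B] (G : MetricGraph V B R) {m : ℕ} (hm : 0 < m) {p ρ : ℝ}
    (hp : 1 ≤ p) (hρ : ρ ≤ 1) {u : G.H1}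
    (h : ∀ e j, G.restrictEdge e u (G.gridPoint m e j) = 0)
    (hu : ‖G.derivL2 u‖ ^ 2 = m / G.coreLength) :
    m / (2 * G.coreLength) - G.coreLength ≤ G.energy p ρ u := by
  have hL := G.coreLength_pos
  have hm' : (0 : ℝ) < m := by exact_mod_cast hm
  have hone : √(G.coreLength / m) * ‖G.derivL2 u‖ = 1 := by
    rw [← Real.sqrt_sq (norm_nonneg (G.derivL2 u)), hu, ← Real.sqrt_mul (by positivity),
      div_mul_div_comm, mul_comm, div_self (by positivity), Real.sqrt_one]
  have hcore : G.corePower p u ≤ G.coreLength := by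
    rw [corePower_eq]
    refine Finset.sum_le_sum fun e _ => ?_
    have hb : ∀ x ∈ Icc 0 (G.len e), ‖|G.rep u (.inl e) x| ^ p‖ ≤ 1 := fun x hx => by
      rw [Real.norm_of_nonneg (Real.rpow_nonneg (abs_nonneg _) _)]
      exact Real.rpow_le_one (abs_nonneg _) ((G.abs_rep_le_of_grid hm h hx).trans_eq hone)
        (by linarith)
    have := norm_setIntegral_le_of_norm_le_const (μ := volume) (s := Icc 0 (G.len e))
      isCompact_Icc.measure_lt_top hb
    rw [Real.volume_real_Icc_of_le (G.len_pos e).le, sub_zero, one_mul] at this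
    exact (le_abs_self _).trans this
  have h1 : ρ / p ≤ 1 := div_le_one_of_le₀ (hρ.trans hp) (by linarith)
  have h2 : ρ / p * G.corePower p u ≤ 1 * G.coreLength :=
    mul_le_mul h1 hcore (G.corePower_nonneg p u) zero_le_one
  rw [energy_eq, hu]
  have : (m : ℝ) / (2 * G.coreLength) = 1 / 2 * (m / G.coreLength) := by field_simp
  linarith

end MetricGraph

namespace MetricGraph

/-! ### Combinations of bumps with disjoint supports -/

/-- A smooth bump equal to `1` on `[-1/2, 1/2]` and supported in `[-1, 1]`. -/
noncomputable def unitBump : ContDiffBump (0 : ℝ) := ⟨1 / 2, 1, by norm_num, by norm_num⟩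

theorem unitBump_eq_one {x : ℝ} (h : |x| ≤ 1 / 2) : unitBump x = 1 :=
  unitBump.one_of_mem_closedBall (by rwa [Metric.mem_closedBall, Real.dist_eq, sub_zero])

theorem unitBump_eq_zero {x : ℝ} (h : 1 ≤ |x|) : unitBump x = 0 :=
  unitBump.zero_of_le_dist (by rwa [Real.dist_eq, sub_zero])

theorem deriv_unitBump_eq_zero {x : ℝ} (h : 1 < |x|) : deriv unitBump x = 0 := by
  refine Function.notMem_support.1 fun hx => ?_
  have := support_deriv_subset hx
  rw [unitBump.tsupport_eq, Metric.mem_closedBall, Real.dist_eq, sub_zero] at this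
  exact absurd (lt_of_lt_of_le h this) (lt_irrefl _)

/-- The combination, with coefficients `a`, of the copies of `f` rescaled by the factor `w` and
centred at the points `(3 i + 2) w`.  If `f` is supported in `[-1, 1]`, the supports of the copies
are disjoint and contained in `[w, 3 n w]`. -/
noncomputable def spread (f : ℝ → ℝ) (w : ℝ) {n : ℕ} (a : Fin n → ℝ) (x : ℝ) : ℝ :=
  ∑ i, a i * f (x / w - (3 * i + 2))

theorem spread_eq_mul {f : ℝ → ℝ} (hf : ∀ x, 1 < |x| → f x = 0) {w : ℝ} {n : ℕ} (a : Fin n → ℝ)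
    {x : ℝ} {i : Fin n} (hi : |x / w - (3 * i + 2)| ≤ 1) :
    spread f w a x = a i * f (x / w - (3 * i + 2)) := by
  refine Finset.sum_eq_single i (fun j _ hj => ?_) (by simp)
  rw [hf, mul_zero]
  rw [abs_le] at hi
  rw [lt_abs]
  rcases lt_or_gt_of_ne hj with h | h
  · have : (j : ℝ) + 1 ≤ i := by exact_mod_cast h
    left; linarith
  · have : (i : ℝ) + 1 ≤ j := by exact_mod_cast h
    right; linarith

theorem spread_sq {f : ℝ → ℝ} (hf : ∀ x, 1 < |x| → f x = 0) (w : ℝ) {n : ℕ} (a : Fin n → ℝ)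
    (x : ℝ) : spread f w a x ^ 2 = spread (fun x => f x ^ 2) w (fun i => a i ^ 2) x := by
  by_cases h : ∃ i : Fin n, |x / w - (3 * i + 2)| ≤ 1
  · obtain ⟨i, hi⟩ := h
    rw [spread_eq_mul hf a hi, spread_eq_mul (fun x hx => by rw [hf x hx]; simp) _ hi, mul_pow]
  · push Not at h
    simp only [spread]
    rw [Finset.sum_eq_zero, Finset.sum_eq_zero] <;> simp +contextual [hf, h]

theorem spread_eq_zero {f : ℝ → ℝ} (hf : ∀ x, 1 < |x| → f x = 0) {w : ℝ} (hw : 0 < w) {n : ℕ}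
    (a : Fin n → ℝ) {x : ℝ} (hx : x ∉ Icc w (3 * n * w)) : spread f w a x = 0 := by
  refine Finset.sum_eq_zero fun i _ => ?_
  rw [hf, mul_zero]
  by_contra! h
  rw [abs_le] at h
  refine hx ⟨?_, ?_⟩
  · rw [← one_le_div hw]
    have : (0 : ℝ) ≤ i := Nat.cast_nonneg _
    linarith
  · rw [← div_le_iff₀ hw]
    have : (i : ℝ) + 1 ≤ n := by exact_mod_cast i.2
    linarith

theorem integral_spread {f : ℝ → ℝ} (hf : Continuous f) (hs : HasCompactSupport f) {w : ℝ}
    (hw : 0 < w) {n : ℕ} (a : Fin n → ℝ) :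
    ∫ x, spread f w a x = w * (∫ x, f x) * ∑ i, a i := by
  have h1 : Integrable f := hf.integrable_of_hasCompactSupport hs
  have h2 : ∀ i : Fin n, Integrable fun x => a i * f (x / w - (3 * i + 2)) := fun i =>
    ((h1.comp_sub_right (3 * i + 2)).comp_div hw.ne').const_mul (a i)
  simp only [spread]
  rw [integral_finsetSum _ fun i _ => h2 i, Finset.mul_sum]
  refine Finset.sum_congr rfl fun i _ => ?_
  rw [integral_const_mul, Measure.integral_comp_div (fun x => f (x - (3 * i + 2))),
    integral_sub_right_eq_self, abs_of_pos hw, smul_eq_mul]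
  ring

theorem integral_spread_sq {f : ℝ → ℝ} (hf : Continuous f) (hs : HasCompactSupport f)
    (h0 : ∀ x, 1 < |x| → f x = 0) {w : ℝ} (hw : 0 < w) {n : ℕ} (a : Fin n → ℝ) :
    ∫ x, spread f w a x ^ 2 = w * (∫ x, f x ^ 2) * ∑ i, a i ^ 2 := by
  simp only [spread_sq h0]
  refine integral_spread (hf.pow 2) ?_ hw _
  simpa only [pow_two] using hs.mul_right

theorem contDiff_spread_unitBump (w : ℝ) {n : ℕ} (a : Fin n → ℝ) :
    ContDiff ℝ ∞ (spread unitBump w a) := by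
  refine ContDiff.sum fun i _ => contDiff_const.mul ?_
  exact unitBump.contDiff.comp ((contDiff_id.div_const _).sub contDiff_const)

theorem deriv_spread_unitBump (w : ℝ) {n : ℕ} (a : Fin n → ℝ) (x : ℝ) :
    deriv (spread unitBump w a) x = w⁻¹ * spread (deriv unitBump) w a x := by
  have h : ∀ i : Fin n, HasDerivAt (fun x => a i * unitBump (x / w - (3 * i + 2)))
      (a i * (deriv unitBump (x / w - (3 * i + 2)) * (1 / w))) x := fun i => by
    refine HasDerivAt.const_mul (a i) ?_
    refine HasDerivAt.comp x (h₂ := unitBump) ?_ (((hasDerivAt_id x).div_const w).sub_const _)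
    exact (unitBump.contDiff (n := 1).differentiable (by simp) _).hasDerivAt
  have := HasDerivAt.fun_sum (u := Finset.univ) fun i _ => h i
  change HasDerivAt (spread unitBump w a) _ x at this
  rw [this.deriv, spread, Finset.mul_sum]
  exact Finset.sum_congr rfl fun i _ => by ring

theorem integral_unitBump_sq_pos : 0 < ∫ x, unitBump x ^ 2 := by
  refine Continuous.integral_pos_of_hasCompactSupport_nonneg_nonzero (x := 0)
    (unitBump.continuous.pow 2) ?_ (fun x => sq_nonneg _) ?_
  · exact unitBump.hasCompactSupport.comp_left (g := fun y : ℝ => y ^ 2) (by simp)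
  · simp [unitBump_eq_one (x := 0) (by norm_num)]

theorem integral_deriv_unitBump_sq_pos : 0 < ∫ x, deriv unitBump x ^ 2 := by
  have hc : Continuous (deriv unitBump) := unitBump.contDiff.continuous_deriv (n := 1) le_rfl
  obtain ⟨x, hx⟩ : ∃ x, deriv unitBump x ≠ 0 := by
    by_contra! h
    have := is_const_of_deriv_eq_zero (unitBump.contDiff (n := 1).differentiable (by simp)) h 0 1
    rw [unitBump_eq_one (by norm_num), unitBump_eq_zero (by norm_num)] at this
    exact one_ne_zero this
  refine Continuous.integral_pos_of_hasCompactSupport_nonneg_nonzero (x := x) (hc.pow 2) ?_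
    (fun x => sq_nonneg _) (pow_ne_zero 2 hx)
  exact unitBump.hasCompactSupport.deriv.comp_left (g := fun y : ℝ => y ^ 2) (by simp)

variable {V B R : Type*}

theorem spread_mem_testFunctions (G : MetricGraph V B R) {e : B ⊕ R} {n : ℕ} {w : ℝ} (hw : 0 < w)
    (h : Icc w (3 * n * w) ⊆ interior (G.interval e)) (a : Fin n → ℝ) :
    spread unitBump w a ∈ G.testFunctions e := by
  have h0 : ∀ x, 1 < |x| → unitBump x = 0 := fun x hx => unitBump_eq_zero hx.le
  have hs : tsupport (spread unitBump w a) ⊆ Icc w (3 * n * w) :=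
    closure_minimal (fun x hx => by_contra fun hx' => hx (spread_eq_zero h0 hw a hx')) isClosed_Icc
  exact ⟨contDiff_spread_unitBump w a,
    isCompact_Icc.of_isClosed_subset (isClosed_tsupport _) hs, hs.trans h⟩

variable [Fintype B] [Fintype R]

/-- The combinations of `n` bumps of width `w` on the edge `e`, multiplied by `s`, as a linear map
of the coefficients. -/
noncomputable def bumpMap (G : MetricGraph V B R) {e : B ⊕ R} {n : ℕ} {w : ℝ} (hw : 0 < w)
    (h : Icc w (3 * n * w) ⊆ interior (G.interval e)) (s : ℝ) :
    EuclideanSpace ℝ (Fin n) →ₗ[ℝ] G.H1 :=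
  s • (G.ofTest e ∘ₗ
    { toFun := fun a : EuclideanSpace ℝ (Fin n) =>
        ⟨spread unitBump w a, G.spread_mem_testFunctions hw h a⟩
      map_add' := fun a b => Subtype.ext <| funext fun x => by
        simp [spread, add_mul, Finset.sum_add_distrib]
      map_smul' := fun c a => Subtype.ext <| funext fun x => by
        simp [spread, Finset.mul_sum, mul_assoc] })

theorem bumpMap_apply (G : MetricGraph V B R) {e : B ⊕ R} {n : ℕ} {w : ℝ} (hw : 0 < w)
    (h : Icc w (3 * n * w) ⊆ interior (G.interval e)) (s : ℝ) (a : EuclideanSpace ℝ (Fin n)) :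
    G.bumpMap hw h s a =
      s • G.ofTest e ⟨spread unitBump w a, G.spread_mem_testFunctions hw h a⟩ := rfl

theorem norm_toL2_bumpMap_sq (G : MetricGraph V B R) {e : B ⊕ R} {n : ℕ} {w : ℝ} (hw : 0 < w)
    (h : Icc w (3 * n * w) ⊆ interior (G.interval e)) (s : ℝ) (a : EuclideanSpace ℝ (Fin n)) :
    ‖G.toL2 (G.bumpMap hw h s a)‖ ^ 2 = s ^ 2 * (w * (∫ x, unitBump x ^ 2) * ‖a‖ ^ 2) := by
  rw [bumpMap_apply, map_smul, norm_smul, mul_pow, norm_toL2_ofTest_sq,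
    integral_spread_sq unitBump.continuous unitBump.hasCompactSupport
      (fun x hx => unitBump_eq_zero hx.le) hw, EuclideanSpace.real_norm_sq_eq,
    Real.norm_eq_abs, sq_abs]

theorem norm_derivL2_bumpMap_sq (G : MetricGraph V B R) {e : B ⊕ R} {n : ℕ} {w : ℝ} (hw : 0 < w)
    (h : Icc w (3 * n * w) ⊆ interior (G.interval e)) (s : ℝ) (a : EuclideanSpace ℝ (Fin n)) :
    ‖G.derivL2 (G.bumpMap hw h s a)‖ ^ 2 =
      s ^ 2 * (w⁻¹ * (∫ x, deriv unitBump x ^ 2) * ‖a‖ ^ 2) := by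
  rw [bumpMap_apply, map_smul, norm_smul, mul_pow, norm_derivL2_ofTest_sq]
  simp only [deriv_spread_unitBump, mul_pow]
  rw [integral_const_mul,
    integral_spread_sq (unitBump.contDiff.continuous_deriv (n := 1) le_rfl)
      unitBump.hasCompactSupport.deriv (fun x => deriv_unitBump_eq_zero) hw,
    EuclideanSpace.real_norm_sq_eq, Real.norm_eq_abs, sq_abs]
  field_simp

theorem toL2_bumpMap_of_ne (G : MetricGraph V B R) {e e' : B ⊕ R} {n : ℕ} {w : ℝ} (hw : 0 < w)
    (h : Icc w (3 * n * w) ⊆ interior (G.interval e)) (s : ℝ) (a : EuclideanSpace ℝ (Fin n))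
    (he : e' ≠ e) : G.toL2 (G.bumpMap hw h s a) e' = 0 := by
  rw [bumpMap_apply, map_smul, toL2_ofTest, PiLp.smul_apply, G.edgeL2_of_ne he, smul_zero]

theorem le_corePower_bumpMap (G : MetricGraph V B R) {e : B} {n : ℕ} {w : ℝ} (hw : 0 < w)
    (h : Icc w (3 * n * w) ⊆ interior (G.interval (.inl e))) (s : ℝ)
    (a : EuclideanSpace ℝ (Fin n)) {p : ℝ} (hp : 0 < p) (i : Fin n) :
    w * |s * a i| ^ p ≤ G.corePower p (G.bumpMap hw h s a) := by
  have h0 : ∀ x, 1 < |x| → unitBump x = 0 := fun x hx => unitBump_eq_zero hx.le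
  have hrep : EqOn (G.rep (G.bumpMap hw h s a) (.inl e)) (fun x => s * spread unitBump w a x)
      (Icc 0 (G.len e)) := by
    refine G.eqOn_rep (contDiff_const.mul (contDiff_spread_unitBump w a)).continuous.continuousOn ?_
    rw [bumpMap_apply, map_smul, toL2_ofTest, PiLp.smul_apply, edgeL2_same]
    filter_upwards [Lp.coeFn_smul s (G.testLp (.inl e)
      ⟨spread unitBump w a, G.spread_mem_testFunctions hw h a⟩), G.coeFn_testLp (e := .inl e)
      ⟨spread unitBump w a, G.spread_mem_testFunctions hw h a⟩] with x h1 h2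
    rw [h1, Pi.smul_apply, h2, smul_eq_mul]
  have hi : (i : ℝ) + 1 ≤ n := by exact_mod_cast i.2
  have hi0 : (0 : ℝ) ≤ i := Nat.cast_nonneg _
  -- the plateau of the bump with index `i`
  have hsub : Icc ((3 * i + 3 / 2) * w) ((3 * i + 5 / 2) * w) ⊆ Icc 0 (G.len e) := by
    refine Subset.trans (Icc_subset_Icc ?_ ?_) (h.trans interior_subset)
    · nlinarith
    · exact mul_le_mul_of_nonneg_right (by linarith) hw.le
  have hint : IntegrableOn (fun x => |G.rep (G.bumpMap hw h s a) (.inl e) x| ^ p)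
      (Icc 0 (G.len e)) :=
    ((G.continuousOn_rep _ (.inl e)).abs.rpow_const fun _ _ => Or.inr hp.le).integrableOn_Icc
  rw [corePower_eq]
  refine le_trans ?_ (Finset.single_le_sum
    (f := fun e => ∫ x in Icc 0 (G.len e), |G.rep (G.bumpMap hw h s a) (.inl e) x| ^ p)
    (fun e _ => integral_nonneg fun _ => Real.rpow_nonneg (abs_nonneg _) _) (Finset.mem_univ e))
  refine le_trans ?_ (setIntegral_mono_set hint
    (ae_of_all _ fun _ => Real.rpow_nonneg (abs_nonneg _) _) hsub.eventuallyLE)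
  rw [setIntegral_congr_fun (g := fun _ => |s * a i| ^ p) measurableSet_Icc]
  · rw [setIntegral_const, smul_eq_mul, measureReal_def, Real.volume_Icc,
      ENNReal.toReal_ofReal (by nlinarith)]
    exact le_of_eq (by ring)
  · intro x hx
    have h2 : |x / w - (3 * i + 2)| ≤ 1 / 2 := by
      have h3 := (le_div_iff₀ hw).2 hx.1
      have h4 := (div_le_iff₀ hw).2 hx.2
      rw [abs_le]
      constructor <;> linarith
    simp only
    rw [hrep (hsub hx)]
    simp only
    rw [spread_eq_mul h0 a (h2.trans (by norm_num)), unitBump_eq_one h2, mul_one]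

/-! ### The end maps -/

/-- Bumps spread over a long part of a half-line have small kinetic energy. -/
theorem exists_linearMap_halfLine (G : MetricGraph V B R) (e : R) {μ : ℝ} (hμ : 0 < μ) (n : ℕ)
    {r : ℝ} (hr : 0 < r) : ∃ T : EuclideanSpace ℝ (Fin n) →ₗ[ℝ] G.H1,
      (∀ a, ‖G.toL2 (T a)‖ ^ 2 = μ * ‖a‖ ^ 2) ∧ (∀ a, ‖a‖ = 1 → ‖G.derivL2 (T a)‖ ^ 2 < r) ∧
      ∀ a e', e' ≠ .inr e → G.toL2 (T a) e' = 0 := by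
  have hm := integral_unitBump_sq_pos
  set m := ∫ x, unitBump x ^ 2
  set k := ∫ x, deriv unitBump x ^ 2
  have hlim : Tendsto (fun w : ℝ => μ * k / m / w ^ 2) atTop (𝓝 0) :=
    (tendsto_pow_atTop two_ne_zero).const_div_atTop _
  obtain ⟨w, hw, hwr⟩ := ((eventually_gt_atTop 0).and (hlim.eventually_lt_const hr)).exists
  have h : Icc w (3 * n * w) ⊆ interior (G.interval (.inr e)) := by
    simp only [interval, interior_Ici]
    exact fun x hx => hw.trans_le hx.1
  have hs : √(μ / (w * m)) ^ 2 = μ / (w * m) := Real.sq_sqrt (by positivity)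
  refine ⟨G.bumpMap hw h √(μ / (w * m)), fun a => ?_, fun a ha => ?_,
    fun a e' he => G.toL2_bumpMap_of_ne hw h _ a he⟩
  · rw [norm_toL2_bumpMap_sq, hs]
    field_simp
    rfl
  · rw [norm_derivL2_bumpMap_sq, hs, ha]
    refine lt_of_eq_of_lt ?_ hwr
    field_simp
    rfl

/-- Bumps concentrated on a short part of a bounded edge have large kinetic energy, but, since
`p > 6`, nonpositive energy. -/
theorem exists_linearMap_core (G : MetricGraph V B R) (e : B) {μ p : ℝ} (hμ : 0 < μ) (hp : 6 < p)
    (n : ℕ) (r : ℝ) : ∃ T : EuclideanSpace ℝ (Fin n) →ₗ[ℝ] G.H1,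
      (∀ a, ‖G.toL2 (T a)‖ ^ 2 = μ * ‖a‖ ^ 2) ∧ (∀ a, ‖a‖ = 1 → r < ‖G.derivL2 (T a)‖ ^ 2) ∧
      (∀ a, ‖a‖ = 1 → ∀ ρ, 1 / 2 ≤ ρ → G.energy p ρ (T a) ≤ 0) ∧
      ∀ a e', e' ≠ .inl e → G.toL2 (T a) e' = 0 := by
  have hm := integral_unitBump_sq_pos
  have hk := integral_deriv_unitBump_sq_pos
  set m := ∫ x, unitBump x ^ 2
  set k := ∫ x, deriv unitBump x ^ 2
  have hp0 : 0 < p := by linarith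
  -- the width of the bumps is `y⁻¹`
  have h1 : ∀ᶠ y : ℝ in atTop, 0 < y := eventually_gt_atTop 0
  have h2 : ∀ᶠ y : ℝ in atTop, 3 * n / y < G.len e :=
    (tendsto_id.const_div_atTop _).eventually_lt_const (G.len_pos e)
  have h3 : ∀ᶠ y : ℝ in atTop, r < μ * k / m * y ^ 2 :=
    ((tendsto_pow_atTop two_ne_zero).const_mul_atTop (by positivity)).eventually_gt_atTop r
  -- this is where `p > 6` enters: `y² ≤ y⁻¹ y ^ (p / 2)`, up to constants, for large `y`
  have h4 : ∀ᶠ y : ℝ in atTop, 0 < n →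
      p * (μ * k / m) / (μ / (m * n)) ^ (p / 2) ≤ y ^ (p / 2 - 3) :=
    ((tendsto_rpow_atTop (by linarith)).eventually_ge_atTop _).mono fun _ h _ => h
  obtain ⟨y, hy, hlen, hyr, hyp⟩ := (h1.and (h2.and (h3.and h4))).exists
  have hw : 0 < y⁻¹ := inv_pos.2 hy
  have h : Icc y⁻¹ (3 * n * y⁻¹) ⊆ interior (G.interval (.inl e)) := by
    simp only [interval, interior_Icc]
    exact fun x hx => ⟨hw.trans_le hx.1, hx.2.trans_lt (by rwa [← div_eq_mul_inv])⟩
  have hs : √(μ / (y⁻¹ * m)) ^ 2 = μ / (y⁻¹ * m) := Real.sq_sqrt (by positivity)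
  have hder : ∀ a : EuclideanSpace ℝ (Fin n), ‖a‖ = 1 →
      ‖G.derivL2 (G.bumpMap hw h √(μ / (y⁻¹ * m)) a)‖ ^ 2 = μ * k / m * y ^ 2 := fun a ha => by
    rw [norm_derivL2_bumpMap_sq, hs, ha]
    field_simp
    rfl
  refine ⟨G.bumpMap hw h √(μ / (y⁻¹ * m)), fun a => ?_, fun a ha => ?_, fun a ha ρ hρ => ?_,
    fun a e' he => G.toL2_bumpMap_of_ne hw h _ a he⟩
  · rw [norm_toL2_bumpMap_sq, hs]
    field_simp
    rfl
  · rwa [hder a ha]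
  · have hsum : ∑ i, a i ^ 2 = 1 := by rw [← EuclideanSpace.real_norm_sq_eq, ha, one_pow]
    have hn : 0 < n := by
      rcases Nat.eq_zero_or_pos n with rfl | h
      · simp at hsum
      · exact h
    have hn' : (0 : ℝ) < n := by exact_mod_cast hn
    obtain ⟨i, -, hi⟩ : ∃ i ∈ Finset.univ, (1 : ℝ) / n ≤ a i ^ 2 := by
      have : Nonempty (Fin n) := ⟨⟨0, hn⟩⟩
      refine Finset.exists_le_of_sum_le Finset.univ_nonempty ?_
      rw [hsum]
      simp [hn'.ne']
    have hcore := G.le_corePower_bumpMap hw h √(μ / (y⁻¹ * m)) a hp0 i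
    have hpow : (μ / (m * n)) ^ (p / 2) * y ^ (p / 2) ≤ |√(μ / (y⁻¹ * m)) * a i| ^ p := by
      have h5 : |√(μ / (y⁻¹ * m)) * a i| ^ p = ((√(μ / (y⁻¹ * m)) * a i) ^ 2) ^ (p / 2) := by
        rw [← sq_abs, ← Real.rpow_natCast, ← Real.rpow_mul (abs_nonneg _)]
        congr 1
        push_cast
        ring
      rw [h5, ← Real.mul_rpow (by positivity) hy.le, mul_pow, hs]
      refine Real.rpow_le_rpow (by positivity) ?_ (by positivity)
      calc μ / (m * n) * y = μ / (y⁻¹ * m) * (1 / n) := by field_simp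
        _ ≤ _ := by gcongr
    have hc0 : 0 < (μ / (m * n)) ^ (p / 2) := Real.rpow_pos_of_pos (by positivity) _
    have hmain : p * (μ * k / m) * y ^ 2 ≤ y⁻¹ * |√(μ / (y⁻¹ * m)) * a i| ^ p := by
      calc p * (μ * k / m) * y ^ 2
          ≤ (y ^ (p / 2 - 3) * (μ / (m * n)) ^ (p / 2)) * y ^ 2 := by
            exact mul_le_mul_of_nonneg_right ((div_le_iff₀ hc0).1 (hyp hn)) (sq_nonneg y)
        _ = y⁻¹ * ((μ / (m * n)) ^ (p / 2) * y ^ (p / 2)) := by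
            rw [Real.rpow_sub hy, show (3 : ℝ) = ((3 : ℕ) : ℝ) by norm_num, Real.rpow_natCast]
            field_simp
        _ ≤ _ := by gcongr
    rw [energy_eq, hder a ha, sub_nonpos]
    calc 1 / 2 * (μ * k / m * y ^ 2) = (1 / 2) / p * (p * (μ * k / m) * y ^ 2) := by field_simp
      _ ≤ ρ / p * G.corePower p _ := by
        gcongr
        exact hmain.trans hcore

theorem energy_le (G : MetricGraph V B R) {p ρ : ℝ} (hp : 0 ≤ p) (hρ : 0 ≤ ρ) (u : G.H1) :
    G.energy p ρ u ≤ 1 / 2 * ‖G.derivL2 u‖ ^ 2 := by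
  rw [energy_eq]
  have := G.corePower_nonneg p u
  have : 0 ≤ ρ / p * G.corePower p u := by positivity
  linarith

theorem not_finiteDimensional_H1 [Nonempty R] (G : MetricGraph V B R) :
    ¬ FiniteDimensional ℝ G.H1 := by
  intro hfin
  obtain ⟨e⟩ := ‹Nonempty R›
  obtain ⟨T, hT, -⟩ := G.exists_linearMap_halfLine e one_pos (Module.finrank ℝ G.H1 + 1) one_pos
  have hinj : Function.Injective T := by
    rw [injective_iff_map_eq_zero]
    intro a ha
    have := hT a
    rw [ha, map_zero, norm_zero, one_mul, zero_pow two_ne_zero] at this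
    exact norm_eq_zero.1 (pow_eq_zero_iff two_ne_zero |>.1 this.symm)
  have := LinearMap.finrank_le_finrank_of_injective hinj
  rw [finrank_euclideanSpace_fin] at this
  omega

theorem not_finiteDimensional_L2 [Nonempty R] (G : MetricGraph V B R) :
    ¬ FiniteDimensional ℝ G.L2 := fun _ =>
  G.not_finiteDimensional_H1 (FiniteDimensional.of_injective G.toL2.toLinearMap G.toL2_injective)

end MetricGraph

/-! ### Minimax levels over odd homotopies -/

/-- Two isometric linear images of the sphere with orthogonal values are joined, inside the mass
sphere, by rotation. -/
theorem oddHomotopies_nonempty {E H : Type*} [NormedAddCommGroup E] [InnerProductSpace ℝ E]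
    [NormedAddCommGroup H] [InnerProductSpace ℝ H] {ι : E →L[ℝ] H} {μ : ℝ} {N : ℕ}
    (T₀ T₁ : EuclideanSpace ℝ (Fin (N - 1)) →ₗ[ℝ] E) {γ₀ γ₁ : unitSphere N → massSphere ι μ}
    (h₀ : ∀ a, (γ₀ a : E) = T₀ a) (h₁ : ∀ a, (γ₁ a : E) = T₁ a)
    (h : ∀ a : unitSphere N, inner ℝ (ι (T₀ a)) (ι (T₁ a)) = 0) :
    (oddHomotopies ι μ N γ₀ γ₁).Nonempty := by
  have hc₀ : Continuous T₀ := T₀.continuous_of_finiteDimensional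
  have hc₁ : Continuous T₁ := T₁.continuous_of_finiteDimensional
  refine ⟨⟨fun x => ⟨Real.cos (Real.pi / 2 * x.1) • T₀ x.2 + Real.sin (Real.pi / 2 * x.1) • T₁ x.2,
    ?_⟩, ?_⟩, fun t a => ?_, fun a => ?_, fun a => ?_⟩
  · have hm₀ : ‖ι (T₀ x.2)‖ ^ 2 = μ := by rw [← h₀]; exact (γ₀ x.2).2
    have hm₁ : ‖ι (T₁ x.2)‖ ^ 2 = μ := by rw [← h₁]; exact (γ₁ x.2).2
    change ‖ι _‖ ^ 2 = μ
    rw [map_add, map_smul, map_smul, norm_add_sq_real, norm_smul, norm_smul, mul_pow, mul_pow,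
      real_inner_smul_left, real_inner_smul_right, h, hm₀, hm₁, Real.norm_eq_abs, sq_abs,
      Real.norm_eq_abs, sq_abs, mul_zero, mul_zero, mul_zero, add_zero, ← add_mul,
      Real.cos_sq_add_sin_sq, one_mul]
  · refine Continuous.subtype_mk ?_ _
    fun_prop
  · simp [add_comm]
  · exact Subtype.ext (by simp [h₀])
  · exact Subtype.ext (by simp [h₁])

theorem minimaxLevel_lt_top {E H : Type*} [NormedAddCommGroup E] [InnerProductSpace ℝ E]
    [NormedAddCommGroup H] [InnerProductSpace ℝ H] {ι : E →L[ℝ] H} {μ : ℝ} {N : ℕ}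
    {γ₀ γ₁ : unitSphere N → massSphere ι μ} (h : (oddHomotopies ι μ N γ₀ γ₁).Nonempty)
    {Φ : E → ℝ} (hΦ : Continuous Φ) : minimaxLevel ι μ N γ₀ γ₁ Φ < ⊤ := by
  obtain ⟨γ, hγ⟩ := h
  have hc : Continuous fun x => Φ (γ x) := hΦ.comp (continuous_subtype_val.comp γ.continuous)
  obtain ⟨M, hM⟩ := (isCompact_range hc).bddAbove
  refine lt_of_le_of_lt (iInf₂_le γ hγ) (lt_of_le_of_lt (iSup_le fun x => ?_) (EReal.coe_lt_top M))
  exact EReal.coe_le_coe_iff.2 (hM ⟨x, rfl⟩)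

namespace MetricGraph

variable {V B R : Type*} [Fintype B] [Fintype R]

/-- Every odd homotopy between the region of small and the region of large kinetic energy meets the
set of functions of prescribed kinetic energy vanishing on a given grid of the compact core, as soon
as the dimension exceeds the number of points of the grid. -/
theorem exists_vanishing_on_grid [Nonempty B] (G : MetricGraph V B R) {μ r : ℝ} {m N : ℕ}
    (hN : Fintype.card B * (m + 1) + 2 ≤ N) {γ₀ γ₁ : unitSphere N → massSphere G.toL2 μ}
    (h₀ : ∀ a, ‖G.derivL2 (γ₀ a)‖ ^ 2 < r) (h₁ : ∀ a, r < ‖G.derivL2 (γ₁ a)‖ ^ 2)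
    {γ : C(unitInterval × unitSphere N, massSphere G.toL2 μ)}
    (hγ : γ ∈ oddHomotopies G.toL2 μ N γ₀ γ₁) :
    ∃ x, ‖G.derivL2 (γ x)‖ ^ 2 = r ∧ ∀ e j, G.restrictEdge e (γ x) (G.gridPoint m e j) = 0 := by
  obtain ⟨n, rfl⟩ : ∃ n, N = n + 2 := ⟨N - 2, by omega⟩
  obtain ⟨hodd, hγ₀, hγ₁⟩ := hγ
  obtain ⟨q⟩ := Function.Embedding.nonempty_of_card_le (α := B × Fin (m + 1)) (β := Fin n)
    (by simp only [Fintype.card_prod, Fintype.card_fin]; omega)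
  have hq := Function.invFun_surjective q.injective
  have hval : Continuous fun x => (γ x : G.H1) := continuous_subtype_val.comp γ.continuous
  obtain ⟨x, hx, hx'⟩ := exists_common_zero_of_odd_homotopy (n := n)
    (f := fun x => ‖G.derivL2 (γ x)‖ ^ 2 - r)
    (g := fun x i => G.restrictEdge (Function.invFun q i).1 (γ x)
      (G.gridPoint m (Function.invFun q i).1 (Function.invFun q i).2))
    (((G.derivL2.continuous.comp hval).norm.pow 2).sub continuous_const)
    (continuous_pi fun i => (continuous_eval_const _).comp
      ((G.restrictEdge _).continuous.comp hval))
    (fun t a => by rw [hodd, map_neg, norm_neg])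
    (fun t a => by
      ext i
      rw [hodd, map_neg]
      rfl)
    (fun a => by rw [hγ₀, sub_neg]; exact h₀ a)
    (fun a => by rw [hγ₁, sub_pos]; exact h₁ a)
  refine ⟨x, sub_eq_zero.1 hx, fun e j => ?_⟩
  obtain ⟨i, hi⟩ := hq (e, j)
  have key : (fun b : B × Fin (m + 1) => G.restrictEdge b.1 (γ x) (G.gridPoint m b.1 b.2))
      (Function.invFun q i) = 0 := congrFun hx' i
  rwa [hi] at key

theorem le_minimaxLevel [Nonempty B] (G : MetricGraph V B R) {μ p ρ : ℝ} {m N : ℕ} (hm : 0 < m)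
    (hp : 1 ≤ p) (hρ : ρ ≤ 1) (hN : Fintype.card B * (m + 1) + 2 ≤ N)
    {γ₀ γ₁ : unitSphere N → massSphere G.toL2 μ}
    (h₀ : ∀ a, ‖G.derivL2 (γ₀ a)‖ ^ 2 < m / G.coreLength)
    (h₁ : ∀ a, m / G.coreLength < ‖G.derivL2 (γ₁ a)‖ ^ 2) :
    ((m / (2 * G.coreLength) - G.coreLength : ℝ) : EReal) ≤
      minimaxLevel G.toL2 μ N γ₀ γ₁ (G.energy p ρ) := by
  refine le_iInf₂ fun γ hγ => ?_
  obtain ⟨x, hx, hx'⟩ := G.exists_vanishing_on_grid hN h₀ h₁ hγ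
  exact (EReal.coe_le_coe_iff.2 (G.le_energy_of_grid hm hp hρ hx' hx)).trans
    (le_iSup (fun x => ((G.energy p ρ (γ x) : ℝ) : EReal)) x)

end MetricGraph

/-! ### The geometry of the minimax problem -/

theorem proposition4p1 {V B R : Type*} [Finite V] [Fintype B] [Fintype R] [Nonempty B] [Nonempty R]
    (G : MetricGraph V B R) (μ p : ℝ) (hμ : 0 < μ) (hp : 6 < p) :
    ∃ (N₀ : ℕ) (γ₀ γ₁ : ∀ N : ℕ, unitSphere N → massSphere G.toL2 μ),
      (∀ N ≥ N₀, MinimaxHypotheses G.toL2 μ (Set.Icc (1 / 2 : ℝ) 1) (G.energy p) N (γ₀ N) (γ₁ N)) ∧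
      (∀ M : ℝ, ∃ N₁ ≥ N₀, ∀ N ≥ N₁, ∀ ρ ∈ Set.Icc (1 / 2 : ℝ) 1,
        (M : EReal) < minimaxLevel G.toL2 μ N (γ₀ N) (γ₁ N) (G.energy p ρ)) ∧
      (∀ ρ ∈ Set.Icc (1 / 2 : ℝ) 1,
        {c : ℝ | ∃ N ≥ N₀, minimaxLevel G.toL2 μ N (γ₀ N) (γ₁ N) (G.energy p ρ) = c}.Infinite) := by
  obtain ⟨e₀⟩ := ‹Nonempty R›
  have : Nonempty R := ⟨e₀⟩
  obtain ⟨e₁⟩ := ‹Nonempty B›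
  have : Nonempty B := ⟨e₁⟩
  have hL := G.coreLength_pos
  have hp0 : 0 < p := by linarith
  choose T₀ hT₀ hd₀ hs₀ using fun N : ℕ => G.exists_linearMap_halfLine e₀ hμ (N - 1)
    (r := min (1 / G.coreLength) 2) (by positivity)
  -- the grids that the level `N` can detect have mesh parameter `m ≤ N`
  choose T₁ hT₁ hd₁ hE₁ hs₁ using fun N : ℕ => G.exists_linearMap_core e₁ hμ hp (N - 1)
    (N / G.coreLength)
  have hsphere : ∀ N (a : unitSphere N), ‖(a : EuclideanSpace ℝ (Fin (N - 1)))‖ = 1 :=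
    fun N a => norm_eq_of_mem_sphere a
  let γ₀ : ∀ N : ℕ, unitSphere N → massSphere G.toL2 μ := fun N a =>
    ⟨T₀ N a, by rw [massSphere, mem_ofPred_eq, hT₀, hsphere, one_pow, mul_one]⟩
  let γ₁ : ∀ N : ℕ, unitSphere N → massSphere G.toL2 μ := fun N a =>
    ⟨T₁ N a, by rw [massSphere, mem_ofPred_eq, hT₁, hsphere, one_pow, mul_one]⟩
  have hne : ∀ N, (oddHomotopies G.toL2 μ N (γ₀ N) (γ₁ N)).Nonempty := fun N =>
    oddHomotopies_nonempty (T₀ N) (T₁ N) (fun _ => rfl) (fun _ => rfl) fun a => by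
      rw [PiLp.inner_apply]
      refine Finset.sum_eq_zero fun e _ => ?_
      rcases e with e | e
      · rw [hs₀ N a _ (by simp), inner_zero_left]
      · rw [hs₁ N a _ (by simp), inner_zero_right]
  have hlevel : ∀ m : ℕ, 0 < m → ∀ N ≥ Fintype.card B * (m + 1) + 2, ∀ ρ ∈ Icc (1 / 2 : ℝ) 1,
      ((m / (2 * G.coreLength) - G.coreLength : ℝ) : EReal) ≤
        minimaxLevel G.toL2 μ N (γ₀ N) (γ₁ N) (G.energy p ρ) := by
    intro m hm N hN ρ hρ
    refine G.le_minimaxLevel hm (by linarith) hρ.2 hN (fun a => ?_) fun a => ?_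
    · refine (hd₀ N a (hsphere N a)).trans_le ((min_le_left _ _).trans ?_)
      gcongr
      exact_mod_cast hm
    · refine lt_of_le_of_lt ?_ (hd₁ N a (hsphere N a))
      gcongr
      have : 1 * (m + 1) ≤ Fintype.card B * (m + 1) := Nat.mul_le_mul_right _ Fintype.card_pos
      omega
  have hexists : ∀ M : ℝ, ∃ m₁ : ℕ, ∀ m ≥ m₁, M < m / (2 * G.coreLength) - G.coreLength :=
    fun M => eventually_atTop.1 <| (tendsto_atTop_add_const_right _ (-G.coreLength)
      (tendsto_natCast_atTop_atTop.atTop_div_const (by positivity))).eventually_gt_atTop M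
  obtain ⟨m₀, hm₀⟩ := hexists 1
  have hlarge : ∀ M : ℝ, ∃ N₁ ≥ Fintype.card B * (m₀ + 1 + 1) + 2, ∀ N ≥ N₁,
      ∀ ρ ∈ Set.Icc (1 / 2 : ℝ) 1,
        (M : EReal) < minimaxLevel G.toL2 μ N (γ₀ N) (γ₁ N) (G.energy p ρ) := by
    intro M
    obtain ⟨m₁, hm₁⟩ := hexists M
    refine ⟨Fintype.card B * (max m₁ (m₀ + 1) + 1) + 2, by gcongr; exact le_max_right _ _,
      fun N hN ρ hρ => ?_⟩
    exact lt_of_lt_of_le (EReal.coe_lt_coe_iff.2 (hm₁ _ (le_max_left _ _)))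
      (hlevel _ (lt_of_lt_of_le m₀.succ_pos (le_max_right _ _)) N hN ρ hρ)
  have hcont : ∀ ρ, Continuous (G.energy p ρ) := fun ρ =>
    (G.hasLipschitzDerivs_energy (by linarith) ρ).contDiff.continuous
  refine ⟨Fintype.card B * (m₀ + 1 + 1) + 2, γ₀, γ₁, fun N hN => ?_, hlarge, fun ρ hρ hfin => ?_⟩
  · exact
      { complete_left := inferInstance
        complete_right := inferInstance
        infinite_left := G.not_finiteDimensional_H1
        infinite_right := G.not_finiteDimensional_L2
        injective := G.toL2_injective
        norm_le := G.norm_toL2_le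
        injective_dual := G.inner_comp_toL2_injective
        interval := ordConnected_Icc
        interval_pos := fun ρ hρ => lt_of_lt_of_le (by norm_num) hρ.1
        form := ⟨fun u => 1 / 2 * ‖G.derivL2 u‖ ^ 2, fun u => G.corePower p u / p,
          fun ρ _ u => by rw [G.energy_eq]; ring,
          fun u => div_nonneg (G.corePower_nonneg p u) hp0.le,
          Or.inl (G.tendsto_norm_derivL2_sq μ)⟩
        even := fun ρ _ u _ => G.energy_neg p ρ u
        contDiff := fun ρ _ => (G.hasLipschitzDerivs_energy (by linarith) ρ).contDiff
        holder := ⟨1, one_pos, le_rfl, fun ρ _ =>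
          (G.hasLipschitzDerivs_energy (by linarith) ρ).holderDerivsOnBounded⟩
        two_le := by omega
        odd_zero := fun a => map_neg (T₀ N) (a : EuclideanSpace ℝ (Fin (N - 1)))
        odd_one := fun a => map_neg (T₁ N) (a : EuclideanSpace ℝ (Fin (N - 1)))
        nonempty := hne N
        level := fun ρ hρ => by
          have hρ0 : (0 : ℝ) < ρ := lt_of_lt_of_le (by norm_num) hρ.1
          have h1 : ((1 : ℝ) : EReal) < minimaxLevel G.toL2 μ N (γ₀ N) (γ₁ N) (G.energy p ρ) :=
            lt_of_lt_of_le (EReal.coe_lt_coe_iff.2 (hm₀ _ (Nat.le_succ m₀)))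
              (hlevel _ m₀.succ_pos N hN ρ hρ)
          refine lt_of_le_of_lt (max_le (iSup_le fun a => ?_) (iSup_le fun a => ?_)) h1
          · refine EReal.coe_le_coe_iff.2 ((G.energy_le hp0.le hρ0.le _).trans ?_)
            have := (hd₀ N a (hsphere N a)).le.trans (min_le_right _ _)
            change 1 / 2 * ‖G.derivL2 (T₀ N a)‖ ^ 2 ≤ 1
            linarith
          · exact EReal.coe_le_coe_iff.2 ((hE₁ N a (hsphere N a) ρ hρ.1).trans zero_le_one) }
  · obtain ⟨M, hM⟩ := hfin.bddAbove
    obtain ⟨N, hN, h⟩ := hlarge M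
    have hlt := h N le_rfl ρ hρ
    have hreal := EReal.coe_toReal (minimaxLevel_lt_top (hne N) (hcont ρ)).ne hlt.ne_bot
    have := hM ⟨N, hN, hreal.symm⟩
    rw [← EReal.coe_le_coe_iff, hreal] at this
    exact absurd hlt this.not_gt
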